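/- Let $k$ be a field of characteristic $0$, let $L/k$ be a quadratic extension with nontrivial automorphism $\tau$, and let $n \ge 2$. For a commutative $k$-algebra $R$ put $R_L = R \otimes_k L$, write $x \mapsto \bar x$ for the extension of $\tau$ to $R_L$ via the second factor, and let $$G(R) = \mathrm{SU}_{2n}(L,h)(R) = \{X \in \mathrm{SL}_{2n}(R_L) : X^* J X = J\},$$ where $X^*$ is the conjugate transpose of $X$ and $J$ is block diagonal with $n$ blocks $\begin{pmatrix} 0 & -1 \\ 1 & 0\end{pmatrix}$. For odd $i$, $1 \le i \le 2n$, let $\alpha_i$ be the character $\mathrm{diag}(t_1,t_1^{-1},\dots,t_n,t_n^{-1}) \mapsto t_{(i+1)/2}$, and let $\Phi_k = \{\pm 2\alpha_i\} \cup \{\pm\alpha_i \pm \alpha_j : i \ne j\}$ ($i,j$ odd) be the relative root system, of type $\mathsf C_n$. Put $V_\alpha(R) = R$ for $\alpha$ long and $V_\alpha(R) = R_L$ for $\alpha$ short, and define $X_\alpha : V_\alpha(R) \to G(R)$ by $$X_{2\alpha_i}(x) = 1 + E_{i,i+1}(x), \quad X_{-2\alpha_i}(x) = 1 + E_{i+1,i}(x),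 \quad X_{\alpha_i-\alpha_j}(x) = 1 + E_{ij}(x) - E_{j+1,i+1}(\bar x) \ (i \neq j),$$ $$X_{\alpha_i+\alpha_j}(x) = 1 + E_{i,j+1}(x) + E_{j,i+1}(\bar x), \quad X_{-\alpha_i-\alpha_j}(x) = 1 + E_{j+1,i}(x) + E_{i+1,j}(\bar x) \ (i < j),$$ where $E_{pq}(x)$ is the matrix with $(p,q)$ entry $x$ and all other entries $0$. The Steinberg group $\tilde G(R)$ is generated by symbols $\tilde X_\alpha(v)$ ($\alpha \in \Phi_k$, $v \in V_\alpha(R)$) subject to $\tilde X_\alpha(v)\tilde X_\alpha(w) = \tilde X_\alpha(v+w)$ and, for $\alpha \ne \pm\beta$, $$[\tilde X_\alpha(u), \tilde X_\beta(v)] = \prod_{i,j \ge 1,\ i\alpha+j\beta \in \Phi_k} \tilde X_{i\alpha+j\beta}\big(N_{ij}^{\alpha\beta}(u,v)\big),$$ where the $N_{ij}^{\alpha\beta}$ are determined by the Chevalley commutator formula $[X_\alpha(u), X_\beta(v)] = \prod X_{i\alpha+j\beta}(N_{ij}^{\alpha\beta}(u,v))$ in $G(R)$. Let $\pi_R : \tilde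 G(R) \to G(R)$ be the homomorphism $\tilde X_\alpha(v) \mapsto X_\alpha(v)$. Let $K$ be an algebraically closed field of characteristic $0$, let $\rho : G(k) \to \mathrm{GL}_m(K)$ be a group homomorphism, and let $H$ be the Zariski closure of $\rho(G(k))$ in $\mathrm{GL}_m(K)$. Consider data $(A, f, (\psi_\alpha)_{\alpha \in \Phi_k}, \tilde\sigma)$ consisting of - a finite-dimensional commutative $K$-algebra $A$ (possibly zero) and a ring homomorphism $f : k \to A$ with Zariski-dense image, through which $A$ is viewed as a $k$-algebra; - regular maps $\psi_\alpha : V_\alpha(A) \to H$ with $\psi_\alpha \circ V_\alpha(f) = \rho \circ X_\alpha$ on $V_\alpha(k)$, where $V_\alpha(f) : V_\alpha(k) \to V_\alpha(A)$ is induced by $f$; - a group homomorphism $\tilde\sigma : \tilde G(A) \to H$ with $\tilde\sigma \circ \tilde F = \rho \circ \pi_k$ and $\tilde\sigma \circ \tilde X_\alpha = \psi_\alpha$ for all $\alpha$, where $\tilde F : \tilde G(k) \to \tilde G(A)$ is induced by $f$. Then such data exist; for every choice of such data, the homomorphism $\tilde\sigma : \tilde G(A) \to H$ is surjective; and the algebraic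 group $H$ is connected (in the Zariski topology) and perfect, that is, $H = [H,H]$. -/

import Mathlib

open scoped TensorProduct Kronecker commutatorElement

universe v w

namespace SUHom

noncomputable section

/-! ## The special unitary group `SU_{2n}(L, h)` -/

section Unitary

variable {k L : Type*} [Field k] [Field L] [Algebra k L] (τ : L ≃ₐ[k] L) (n : ℕ)
  (R : Type*) [CommRing R] [Algebra k R]

/-- The conjugation `x ↦ x̄` of `R_L = R ⊗ L`: the extension of `τ` via the second factor. -/
def conj : (R ⊗[k] L) →ₐ[R] (R ⊗[k] L) :=
  Algebra.TensorProduct.map (AlgHom.id R R) τ.toAlgHom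

/-- The block diagonal matrix of the form `h`, with `n` diagonal blocks `(0, -1; 1, 0)`.
Rows and columns are indexed by `Fin n × Fin 2`: the pairs `(i, 0)`, `(i, 1)` stand for the two
coordinates of the `i`-th hyperbolic plane. -/
def formMatrix (S : Type*) [CommRing S] : Matrix (Fin n × Fin 2) (Fin n × Fin 2) S :=
  (1 : Matrix (Fin n) (Fin n) S) ⊗ₖ !![0, -1; 1, 0]

variable {n R} in
/-- The conjugate transpose `X* = (ā_{ji})` of `X = (a_{ij})`. -/
def star (X : Matrix (Fin n × Fin 2) (Fin n × Fin 2) (R ⊗[k] L)) :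
    Matrix (Fin n × Fin 2) (Fin n × Fin 2) (R ⊗[k] L) :=
  (X.map (conj τ R)).transpose

variable {n R} in
lemma star_mul (X Y : Matrix (Fin n × Fin 2) (Fin n × Fin 2) (R ⊗[k] L)) :
    star τ (X * Y) = star τ Y * star τ X := by
  simp [star, Matrix.map_mul, Matrix.transpose_mul]

variable {n R} in
lemma star_one : star τ (1 : Matrix (Fin n × Fin 2) (Fin n × Fin 2) (R ⊗[k] L)) = 1 := by
  simp [star, Matrix.map_one]

/-- `G(R) = {X ∈ SL_{2n}(R_L) | X* H X = H}` for a commutative `k`-algebra `R`. -/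
def SU : Subgroup (Matrix.SpecialLinearGroup (Fin n × Fin 2) (R ⊗[k] L)) where
  carrier := {X | star τ X.1 * formMatrix n (R ⊗[k] L) * X.1 = formMatrix n (R ⊗[k] L)}
  one_mem' := by simp [star_one]
  mul_mem' := by
    intro X Y hX hY
    simp only [Set.mem_ofPred_eq, Matrix.SpecialLinearGroup.coe_mul, star_mul] at *
    calc _ = star τ Y.1 * (star τ X.1 * formMatrix n (R ⊗[k] L) * X.1) * Y.1 := by
            simp only [Matrix.mul_assoc]
      _ = _ := by rw [hX, hY]
  inv_mem' := by
    intro X hX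
    simp only [Set.mem_ofPred_eq] at *
    have h1 : X.1 * (X⁻¹).1 = 1 := by
      rw [← Matrix.SpecialLinearGroup.coe_mul, mul_inv_cancel, Matrix.SpecialLinearGroup.coe_one]
    have h2 : star τ (X⁻¹).1 * star τ X.1 = 1 := by rw [← star_mul, h1, star_one]
    calc star τ (X⁻¹).1 * formMatrix n (R ⊗[k] L) * (X⁻¹).1
        = star τ (X⁻¹).1 * (star τ X.1 * formMatrix n (R ⊗[k] L) * X.1) * (X⁻¹).1 := by rw [hX]
      _ = (star τ (X⁻¹).1 * star τ X.1) * formMatrix n (R ⊗[k] L) * (X.1 * (X⁻¹).1) := by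
            simp only [Matrix.mul_assoc]
      _ = _ := by rw [h1, h2]; simp

/-! ## Relative roots and root subgroups -/

/-- The relative roots, of type `C_n`. The characters `α_i`, `i ∈ Fin n`, are those that send
`diag(t_1, t_1⁻¹, …, t_n, t_n⁻¹)` to `t_i`. -/
inductive Root (n : ℕ) : Type
  /-- `2 α_i` -/
  | twoPos (i : Fin n) : Root n
  /-- `-2 α_i` -/
  | twoNeg (i : Fin n) : Root n
  /-- `α_i - α_j` -/
  | diff (i j : Fin n) (h : i ≠ j) : Root n
  /-- `α_i + α_j` -/
  | sumPos (i j : Fin n) (h : i < j) : Root n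
  /-- `-α_i - α_j` -/
  | sumNeg (i j : Fin n) (h : i < j) : Root n

variable {n} in
/-- A root as an element of the character group `ℤ^n` (with basis the `α_i`). -/
def Root.char : Root n → (Fin n → ℤ)
  | .twoPos i => Pi.single i 2
  | .twoNeg i => Pi.single i (-2)
  | .diff i j _ => Pi.single i 1 - Pi.single j 1
  | .sumPos i j _ => Pi.single i 1 + Pi.single j 1
  | .sumNeg i j _ => -Pi.single i 1 - Pi.single j 1

variable {n}

variable (k L) in
/-- `V_α(R)`, as an `R`-submodule of `R_L`: it is `R` for a long root `α` (embedded in `R_L` by the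
injective map `r ↦ r ⊗ 1`) and `R_L` for a short root `α`. -/
def rootSpace : Root n → Submodule R (R ⊗[k] L)
  | .twoPos _ => LinearMap.range (Algebra.linearMap R (R ⊗[k] L))
  | .twoNeg _ => LinearMap.range (Algebra.linearMap R (R ⊗[k] L))
  | .diff _ _ _ => ⊤
  | .sumPos _ _ _ => ⊤
  | .sumNeg _ _ _ => ⊤

variable {R}

/-- The matrix `X_α(x)`. -/
def rootMatrix (α : Root n) (x : R ⊗[k] L) :
    Matrix (Fin n × Fin 2) (Fin n × Fin 2) (R ⊗[k] L) :=
  match α with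
  | .twoPos i => 1 + Matrix.single (i, 0) (i, 1) x
  | .twoNeg i => 1 + Matrix.single (i, 1) (i, 0) x
  | .diff i j _ => 1 + Matrix.single (i, 0) (j, 0) x - Matrix.single (j, 1) (i, 1) (conj τ R x)
  | .sumPos i j _ => 1 + Matrix.single (i, 0) (j, 1) x + Matrix.single (j, 0) (i, 1) (conj τ R x)
  | .sumNeg i j _ => 1 + Matrix.single (j, 1) (i, 0) x + Matrix.single (i, 1) (j, 0) (conj τ R x)

lemma conj_of_mem_range (x : R ⊗[k] L)
    (hx : x ∈ LinearMap.range (Algebra.linearMap R (R ⊗[k] L))) : conj τ R x = x := by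
  obtain ⟨r, rfl⟩ := hx
  exact (conj τ R).commutes r

lemma star_add (X Y : Matrix (Fin n × Fin 2) (Fin n × Fin 2) (R ⊗[k] L)) :
    star τ (X + Y) = star τ X + star τ Y := by
  simp [star, Matrix.map_add]

lemma star_sub (X Y : Matrix (Fin n × Fin 2) (Fin n × Fin 2) (R ⊗[k] L)) :
    star τ (X - Y) = star τ X - star τ Y := by
  simp [star, Matrix.map_sub]

lemma star_single (p q : Fin n × Fin 2) (x : R ⊗[k] L) :
    star τ (Matrix.single p q x) = Matrix.single q p (conj τ R x) := by
  simp [star, Matrix.map_single, Matrix.transpose_single]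

lemma form_mul_single_zero (S : Type*) [CommRing S] (i : Fin n) (q : Fin n × Fin 2) (x : S) :
    formMatrix n S * Matrix.single (i, 0) q x = Matrix.single (i, 1) q x := by
  ext ⟨a, b⟩ ⟨c, d⟩
  by_cases h : q = (c, d)
  · subst h
    fin_cases b <;> simp [formMatrix, Matrix.single_apply, Matrix.one_apply, eq_comm]
  · simp [h, Matrix.mul_apply]

lemma form_mul_single_one (S : Type*) [CommRing S] (i : Fin n) (q : Fin n × Fin 2) (x : S) :
    formMatrix n S * Matrix.single (i, 1) q x = -Matrix.single (i, 0) q x := by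
  ext ⟨a, b⟩ ⟨c, d⟩
  by_cases h : q = (c, d)
  · subst h
    fin_cases b <;> simp [formMatrix, Matrix.single_apply, Matrix.one_apply, eq_comm]
  · simp [h, Matrix.mul_apply]

lemma single_mul_form_zero (S : Type*) [CommRing S] (i : Fin n) (p : Fin n × Fin 2) (x : S) :
    Matrix.single p (i, 0) x * formMatrix n S = -Matrix.single p (i, 1) x := by
  ext ⟨a, b⟩ ⟨c, d⟩
  by_cases h : p = (a, b)
  · subst h
    fin_cases d <;> simp [formMatrix, Matrix.single_apply, Matrix.one_apply]
  · simp [h, Matrix.mul_apply]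

lemma single_mul_form_one (S : Type*) [CommRing S] (i : Fin n) (p : Fin n × Fin 2) (x : S) :
    Matrix.single p (i, 1) x * formMatrix n S = Matrix.single p (i, 0) x := by
  ext ⟨a, b⟩ ⟨c, d⟩
  by_cases h : p = (a, b)
  · subst h
    fin_cases d <;> simp [formMatrix, Matrix.single_apply, Matrix.one_apply]
  · simp [h, Matrix.mul_apply]

lemma det_two {ι S : Type*} [CommRing S] [Fintype ι] [DecidableEq ι] (p q r s : ι) (hpq : p ≠ q)
    (hrs : r ≠ s) (hqr : q ≠ r) (x y : S) :
    (1 + Matrix.single p q x + Matrix.single r s y).det = 1 := by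
  have h : 1 + Matrix.single p q x + Matrix.single r s y
      = Matrix.transvection p q x * Matrix.transvection r s y := by
    simp [Matrix.transvection, Matrix.add_mul, Matrix.mul_add, Matrix.single_mul_single_of_ne, hqr,
      add_assoc, add_comm (Matrix.single p q x)]
  rw [h, Matrix.det_mul, Matrix.det_transvection_of_ne _ _ hpq,
    Matrix.det_transvection_of_ne _ _ hrs, one_mul]

lemma det_rootMatrix (α : Root n) (x : R ⊗[k] L) : (rootMatrix τ α x).det = 1 := by
  cases α with
  | twoPos i => exact Matrix.det_transvection_of_ne (i, 0) (i, 1) (by simp) x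
  | twoNeg i => exact Matrix.det_transvection_of_ne (i, 1) (i, 0) (by simp) x
  | diff i j h =>
    have h1 : rootMatrix τ (.diff i j h) x = 1 + Matrix.single (i, 0) (j, 0) x
        + Matrix.single (j, 1) (i, 1) (-(conj τ R x)) := by
      rw [rootMatrix, sub_eq_add_neg]
      congr 1
      ext
      simp only [Matrix.neg_apply, Matrix.single_apply]
      split_ifs <;> simp
    rw [h1]
    exact det_two _ _ _ _ (by simp [h]) (by simp [h.symm]) (by simp) _ _
  | sumPos i j h => exact det_two _ _ _ _ (by simp) (by simp) (by simp) _ _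
  | sumNeg i j h => exact det_two _ _ _ _ (by simp) (by simp) (by simp) _ _

section

variable [Algebra.IsQuadraticExtension k L]

lemma tau_tau (x : L) : τ (τ x) = x := by
  have h1 : Nat.card (L ≃ₐ[k] L) ≤ 2 := by
    rw [← Algebra.IsQuadraticExtension.finrank_eq_two k L, Nat.card_eq_fintype_card]
    exact AlgEquiv.card_le
  have h2 : τ ^ 2 = 1 := by
    have h3 : orderOf τ ≤ 2 := (orderOf_le_card).trans h1
    have h4 : 0 < orderOf τ := orderOf_pos τ
    interval_cases h : orderOf τ
    · rw [orderOf_eq_one_iff.1 h]; simp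
    · rw [← h]; exact pow_orderOf_eq_one τ
  rw [pow_two] at h2
  exact congrArg (fun σ : L ≃ₐ[k] L => σ x) h2

lemma conj_conj (x : R ⊗[k] L) : conj τ R (conj τ R x) = x := by
  induction x using TensorProduct.induction_on with
  | zero => simp
  | tmul r l => simp [conj, tau_tau]
  | add x y hx hy => simp [hx, hy]

lemma star_rootMatrix (α : Root n) (x : R ⊗[k] L) (hx : x ∈ rootSpace k L R α) :
    star τ (rootMatrix τ α x) * formMatrix n (R ⊗[k] L) * rootMatrix τ α x
      = formMatrix n (R ⊗[k] L) := by
  have hne : ∀ (p q r s : Fin n × Fin 2), q ≠ r → ∀ x y : R ⊗[k] L,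
      Matrix.single p q x * Matrix.single r s y = 0 := fun p q r s h x y =>
    Matrix.single_mul_single_of_ne _ _ _ _ h _
  cases α with
  | twoPos i =>
    simp only [rootMatrix, star_add, star_one, star_single, add_mul, mul_add, one_mul, mul_one,
      form_mul_single_zero, single_mul_form_zero, conj_of_mem_range τ x hx]
    simp [hne]
  | twoNeg i =>
    simp only [rootMatrix, star_add, star_one, star_single, add_mul, mul_add, one_mul, mul_one,
      form_mul_single_one, single_mul_form_one, conj_of_mem_range τ x hx]
    simp [hne]
  | diff i j h =>
    simp only [rootMatrix, star_add, star_sub, star_one, star_single, add_mul, mul_add, sub_mul,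
      mul_sub, one_mul, mul_one, form_mul_single_one, single_mul_form_zero, form_mul_single_zero,
      single_mul_form_one, conj_conj]
    simp [hne, h, h.symm]
  | sumPos i j h =>
    simp only [rootMatrix, star_add, star_one, star_single, add_mul, mul_add, one_mul, mul_one,
      form_mul_single_zero, single_mul_form_zero, conj_conj]
    simp [hne, h.ne, h.ne']
  | sumNeg i j h =>
    simp only [rootMatrix, star_add, star_one, star_single, add_mul, mul_add, one_mul, mul_one,
      form_mul_single_one, single_mul_form_one, conj_conj]
    simp [hne, h.ne, h.ne']

/-- The root subgroup map `X_α : V_α(R) → G(R)`. -/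
def rootElt (α : Root n) (v : rootSpace k L R α) : SU τ n R :=
  ⟨⟨rootMatrix τ α v.1, det_rootMatrix τ α v.1⟩, star_rootMatrix τ α v.1 v.2⟩

end

/-! ## Functoriality in `R` -/

variable {R' : Type*} [CommRing R'] [Algebra k R']

variable (L) in
/-- The homomorphism `R_L → R'_L` induced by `R → R'`. -/
def baseChange (f : R →ₐ[k] R') : (R ⊗[k] L) →ₐ[k] (R' ⊗[k] L) :=
  Algebra.TensorProduct.map f (AlgHom.id k L)

lemma baseChange_conj (f : R →ₐ[k] R') (x : R ⊗[k] L) :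
    baseChange L f (conj τ R x) = conj τ R' (baseChange L f x) := by
  induction x using TensorProduct.induction_on with
  | zero => simp
  | tmul r l => simp [conj, baseChange]
  | add x y hx hy => simp [hx, hy]

lemma map_formMatrix (f : R →ₐ[k] R') :
    (formMatrix n (R ⊗[k] L)).map (baseChange L f) = formMatrix n (R' ⊗[k] L) := by
  ext ⟨a, b⟩ ⟨c, d⟩
  fin_cases b <;> fin_cases d <;> by_cases h : a = c <;> simp [formMatrix, h]

lemma map_star (f : R →ₐ[k] R') (X : Matrix (Fin n × Fin 2) (Fin n × Fin 2) (R ⊗[k] L)) :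
    (star τ X).map (baseChange L f) = star τ (X.map (baseChange L f)) := by
  ext p q
  simp [star, baseChange_conj]

/-- The group homomorphism `F : G(R) → G(R')` induced by `f : R → R'`. -/
def SU.map (f : R →ₐ[k] R') : SU τ n R →* SU τ n R' :=
  ((Matrix.SpecialLinearGroup.map (baseChange L f : (R ⊗[k] L) →+* (R' ⊗[k] L))).comp
    (SU τ n R).subtype).codRestrict (SU τ n R') (by
      intro X
      have h := congrArg (fun M => M.map (baseChange L f)) X.2
      simp only [Matrix.map_mul, map_star, map_formMatrix] at h
      exact h)

/-- The map `V_α(f) : V_α(R) → V_α(R')` induced by `f : R → R'`. -/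
def rootSpaceMap (f : R →ₐ[k] R') (α : Root n) (v : rootSpace k L R α) : rootSpace k L R' α :=
  ⟨baseChange L f v, by
    obtain ⟨x, hx⟩ := v
    cases α <;> first | trivial | skip
    all_goals
      obtain ⟨r, rfl⟩ := hx
      exact ⟨f r, by simp [baseChange]⟩⟩

lemma rootSpaceMap_add (f : R →ₐ[k] R') (α : Root n) (v w : rootSpace k L R α) :
    rootSpaceMap f α (v + w) = rootSpaceMap f α v + rootSpaceMap f α w :=
  Subtype.ext (map_add (baseChange L f) _ _)

/-! ## The generalized Steinberg group -/

section

variable [Algebra.IsQuadraticExtension k L]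

lemma SU.map_rootElt (f : R →ₐ[k] R') (α : Root n) (v : rootSpace k L R α) :
    SU.map τ f (rootElt τ α v) = rootElt τ α (rootSpaceMap f α v) := by
  have hs : ∀ (p q : Fin n × Fin 2) (x : R ⊗[k] L), (Matrix.single p q x).map (baseChange L f)
      = Matrix.single p q (baseChange L f x) := fun p q x => Matrix.map_single _ _ _ _
  have h1 : (1 : Matrix (Fin n × Fin 2) (Fin n × Fin 2) (R ⊗[k] L)).map (baseChange L f) = 1 :=
    Matrix.map_one _ (map_zero _) (map_one _)
  apply Subtype.ext
  apply Subtype.ext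
  change (rootMatrix τ α v.1).map (baseChange L f) = rootMatrix τ α (baseChange L f v.1)
  cases α <;>
    simp only [rootMatrix, Matrix.map_add _ (map_add _), Matrix.map_sub _ (map_sub _), hs, h1,
      baseChange_conj]

/-- `γ = i α + j β` for some integers `i, j ≥ 1`. -/
def IsPosComb (α β γ : Root n) : Prop :=
  ∃ i j : ℕ, 1 ≤ i ∧ 1 ≤ j ∧ γ.char = i • α.char + j • β.char

/-- The free generator that corresponds to `α` and `v ∈ V_α(R)`. -/
def freeGen (α : Root n) (v : rootSpace k L R α) :
    FreeGroup (Σ α : Root n, rootSpace k L R α) :=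
  FreeGroup.of ⟨α, v⟩

variable (n R) in
/-- The defining relations of the Steinberg group.

(R1): `X̃_α(v) X̃_α(w) = X̃_α(v + w)`.

(R2): for `α ≠ ±β`, `[X̃_α(u), X̃_β(v)] = ∏ X̃_γ(N_γ(u, v))`, the product over the roots
`γ = i α + j β`, `i, j ≥ 1`. The arguments `N_γ(u, v) ∈ V_γ(R)` are those of the Chevalley
commutator formula `[X_α(u), X_β(v)] = ∏ X_γ(N_γ(u, v))` in `G(R)`, which determines them
uniquely; they are called `w γ` here. At most two roots `γ` occur, and the factors commute, so that
the order `l` in which these roots are listed is immaterial. -/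
def steinbergRels : Set (FreeGroup (Σ α : Root n, rootSpace k L R α)) :=
  {r | ∃ (α : Root n) (v w : rootSpace k L R α),
    r = freeGen α v * freeGen α w * (freeGen α (v + w))⁻¹} ∪
  {r | ∃ (α β : Root n) (u : rootSpace k L R α) (v : rootSpace k L R β) (l : List (Root n))
      (w : ∀ γ : Root n, rootSpace k L R γ),
    α.char ≠ β.char ∧ α.char ≠ -β.char ∧ l.Nodup ∧ (∀ γ, γ ∈ l ↔ IsPosComb α β γ) ∧
    ⁅rootElt τ α u, rootElt τ β v⁆ = (l.map fun γ => rootElt τ γ (w γ)).prod ∧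
    r = ⁅freeGen α u, freeGen β v⁆ * ((l.map fun γ => freeGen γ (w γ)).prod)⁻¹}

variable (n R) in
/-- The generalized Steinberg group `G̃(R)`. -/
abbrev Steinberg : Type _ := PresentedGroup (steinbergRels τ n R)

/-- The generator `X̃_α(v)` of `G̃(R)`. -/
def steinbergGen (α : Root n) (v : rootSpace k L R α) : Steinberg τ n R :=
  PresentedGroup.of ⟨α, v⟩

lemma steinbergGen_add (α : Root n) (v w : rootSpace k L R α) :
    steinbergGen τ α v * steinbergGen τ α w = steinbergGen τ α (v + w) := by
  have h : PresentedGroup.mk (steinbergRels τ n R)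
      (freeGen α v * freeGen α w * (freeGen α (v + w))⁻¹) = 1 :=
    PresentedGroup.one_of_mem (Or.inl ⟨α, v, w, rfl⟩)
  rw [map_mul, map_mul, map_inv] at h
  exact mul_inv_eq_one.1 h

lemma steinbergGen_commutator {α β : Root n} (u : rootSpace k L R α) (v : rootSpace k L R β)
    (l : List (Root n)) (w : ∀ γ : Root n, rootSpace k L R γ) (h1 : α.char ≠ β.char)
    (h2 : α.char ≠ -β.char) (hl : l.Nodup) (hmem : ∀ γ, γ ∈ l ↔ IsPosComb α β γ)
    (h : ⁅rootElt τ α u, rootElt τ β v⁆ = (l.map fun γ => rootElt τ γ (w γ)).prod) :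
    ⁅steinbergGen τ α u, steinbergGen τ β v⁆ = (l.map fun γ => steinbergGen τ γ (w γ)).prod := by
  have h : PresentedGroup.mk (steinbergRels τ n R)
      (⁅freeGen α u, freeGen β v⁆ * ((l.map fun γ => freeGen γ (w γ)).prod)⁻¹) = 1 :=
    PresentedGroup.one_of_mem (Or.inr ⟨α, β, u, v, l, w, h1, h2, hl, hmem, h, rfl⟩)
  rw [map_mul, map_inv, map_commutatorElement, map_list_prod, List.map_map] at h
  exact mul_inv_eq_one.1 h

/-- A family of elements of a group that satisfies the defining relations defines a homomorphism
from the Steinberg group. -/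
def Steinberg.lift {Γ : Type*} [Group Γ] (g : ∀ α : Root n, rootSpace k L R α → Γ)
    (hadd : ∀ α v w, g α v * g α w = g α (v + w))
    (hcomm : ∀ (α β : Root n) (u : rootSpace k L R α) (v : rootSpace k L R β) (l : List (Root n))
      (w : ∀ γ : Root n, rootSpace k L R γ), α.char ≠ β.char → α.char ≠ -β.char → l.Nodup →
      (∀ γ, γ ∈ l ↔ IsPosComb α β γ) →
      ⁅rootElt τ α u, rootElt τ β v⁆ = (l.map fun γ => rootElt τ γ (w γ)).prod →
      ⁅g α u, g β v⁆ = (l.map fun γ => g γ (w γ)).prod) :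
    Steinberg τ n R →* Γ :=
  PresentedGroup.toGroup (f := fun x => g x.1 x.2) (by
    have hg : ∀ (α : Root n) (v : rootSpace k L R α),
        FreeGroup.lift (fun x : (Σ α : Root n, rootSpace k L R α) => g x.1 x.2) (freeGen α v)
          = g α v := fun α v => FreeGroup.lift_apply_of ..
    rintro r (⟨α, v, w, rfl⟩ | ⟨α, β, u, v, l, w, h1, h2, hl, hmem, h, rfl⟩)
    · rw [map_mul, map_mul, map_inv, hg, hg, hg, hadd, mul_inv_cancel]
    · rw [map_mul, map_inv, map_commutatorElement, map_list_prod, List.map_map, hg, hg,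
        hcomm α β u v l w h1 h2 hl hmem h]
      simp only [Function.comp_def, hg, mul_inv_cancel])

lemma rootElt_add (α : Root n) (v w : rootSpace k L R α) :
    rootElt τ α v * rootElt τ α w = rootElt τ α (v + w) := by
  apply Subtype.ext
  apply Subtype.ext
  change rootMatrix τ α v.1 * rootMatrix τ α w.1 = rootMatrix τ α (v.1 + w.1)
  have hne : ∀ (p q r s : Fin n × Fin 2), q ≠ r → ∀ x y : R ⊗[k] L,
      Matrix.single p q x * Matrix.single r s y = 0 := fun p q r s h x y =>
    Matrix.single_mul_single_of_ne _ _ _ _ h _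
  cases α with
  | twoPos i =>
    simp [rootMatrix, add_mul, mul_add, hne, Matrix.single_add]
    abel
  | twoNeg i =>
    simp [rootMatrix, add_mul, mul_add, hne, Matrix.single_add]
    abel
  | diff i j h =>
    simp [rootMatrix, add_mul, mul_add, sub_mul, mul_sub, hne, Matrix.single_add, h, h.symm]
    abel
  | sumPos i j h =>
    simp [rootMatrix, add_mul, mul_add, hne, Matrix.single_add]
    abel
  | sumNeg i j h =>
    simp [rootMatrix, add_mul, mul_add, hne, Matrix.single_add]
    abel

variable (n R) in
/-- The natural homomorphism `π_R : G̃(R) → G(R)`, `X̃_α(v) ↦ X_α(v)`. -/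
def steinbergProj : Steinberg τ n R →* SU τ n R :=
  Steinberg.lift τ (fun α v => rootElt τ α v) (fun α v w => rootElt_add τ α v w)
    (fun _ _ _ _ _ _ _ _ _ _ h => h)

/-- The homomorphism `F̃ : G̃(R) → G̃(R')`, `X̃_α(v) ↦ X̃_α(V_α(f)(v))`, induced by
`f : R → R'`. -/
def steinbergMap (f : R →ₐ[k] R') : Steinberg τ n R →* Steinberg τ n R' :=
  Steinberg.lift τ (fun α v => steinbergGen τ α (rootSpaceMap f α v))
    (fun α v w => by rw [steinbergGen_add, rootSpaceMap_add])
    (fun α β u v l w h1 h2 hl hmem h => by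
      refine steinbergGen_commutator τ _ _ l (fun γ => rootSpaceMap f γ (w γ)) h1 h2 hl hmem ?_
      have := congrArg (SU.map τ f) h
      simpa only [map_commutatorElement, map_list_prod, List.map_map, Function.comp_def,
        SU.map_rootElt] using this)

end

end Unitary

/-! ## Affine varieties over `K`, given by their algebras of regular functions -/

section Zariski

variable {K : Type*} [Field K]

/-- The Zariski topology on a set `X` with algebra of regular functions `𝒪`: the sets
`{x | F x ≠ 0}`, `F ∈ 𝒪`, form a basis of it. -/
abbrev zariski {X : Type*} (𝒪 : Subalgebra K (X → K)) : TopologicalSpace X :=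
  TopologicalSpace.generateFrom {U | ∃ F ∈ 𝒪, U = {x | F x ≠ 0}}

/-- Regular maps: those that pull back regular functions to regular functions. -/
def IsRegularMap {X Y : Type*} (𝒪X : Subalgebra K (X → K)) (𝒪Y : Subalgebra K (Y → K))
    (φ : X → Y) : Prop :=
  ∀ F ∈ 𝒪Y, F ∘ φ ∈ 𝒪X

variable (K) in
/-- The regular functions on the affine space that underlies a module `M` over a `K`-algebra `A`
(of finite dimension over `K`): the polynomials in the `K`-linear forms `M → K`. -/
def polyFunctions (A M : Type*) [CommRing A] [Algebra K A] [AddCommGroup M] [Module A M] :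
    Subalgebra K (M → K) :=
  Algebra.adjoin K {F | (∀ x y, F (x + y) = F x + F y) ∧
    ∀ (c : K) (x : M), F (algebraMap K A c • x) = c * F x}

variable (K) in
/-- The regular functions on `GL_m(K)`: the polynomials in the entries of `g` and of `g⁻¹`
(equivalently, in the entries of `g` and in `1 / det g`). -/
def glFunctions (m : ℕ) : Subalgebra K (Matrix.GeneralLinearGroup (Fin m) K → K) :=
  Algebra.adjoin K ({F | ∃ i j, F = fun g => g.1 i j} ∪ {F | ∃ i j, F = fun g => (g⁻¹).1 i j})

lemma IsRegularMap.continuous {X Y : Type*} {𝒪X : Subalgebra K (X → K)} {𝒪Y : Subalgebra K (Y → K)}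
    {φ : X → Y} (h : IsRegularMap 𝒪X 𝒪Y φ) : @Continuous X Y (zariski 𝒪X) (zariski 𝒪Y) φ := by
  let _ := zariski 𝒪X
  refine continuous_generateFrom_iff.2 ?_
  rintro _ ⟨F, hF, rfl⟩
  exact TopologicalSpace.isOpen_generateFrom_of_mem ⟨F ∘ φ, h F hF, rfl⟩

lemma isRegularMap_adjoin {X Y : Type*} {𝒪X : Subalgebra K (X → K)} {S : Set (Y → K)}
    {φ : X → Y} (h : ∀ F ∈ S, F ∘ φ ∈ 𝒪X) : IsRegularMap 𝒪X (Algebra.adjoin K S) φ := by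
  intro F hF
  induction hF using Algebra.adjoin_induction with
  | mem F hF => exact h F hF
  | algebraMap c => exact 𝒪X.algebraMap_mem c
  | add F G _ _ hF hG => exact 𝒪X.add_mem hF hG
  | mul F G _ _ hF hG => exact 𝒪X.mul_mem hF hG

variable {m : ℕ}

lemma entry_mem (i j : Fin m) : (fun g => g.1 i j) ∈ glFunctions K m :=
  Algebra.subset_adjoin (Or.inl ⟨i, j, rfl⟩)

lemma inv_entry_mem (i j : Fin m) : (fun g => (g⁻¹).1 i j) ∈ glFunctions K m :=
  Algebra.subset_adjoin (Or.inr ⟨i, j, rfl⟩)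

lemma isRegularMap_inv : IsRegularMap (glFunctions K m) (glFunctions K m) fun g => g⁻¹ := by
  refine isRegularMap_adjoin ?_
  rintro F (⟨i, j, rfl⟩ | ⟨i, j, rfl⟩)
  · exact inv_entry_mem i j
  · convert entry_mem (K := K) i j using 1
    ext g
    simp

lemma isRegularMap_mul_left (s : Matrix.GeneralLinearGroup (Fin m) K) :
    IsRegularMap (glFunctions K m) (glFunctions K m) fun g => s * g := by
  refine isRegularMap_adjoin ?_
  rintro F (⟨i, j, rfl⟩ | ⟨i, j, rfl⟩)
  · have h : (∑ l, s.1 i l • fun g : Matrix.GeneralLinearGroup (Fin m) K => g.1 l j)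
        ∈ glFunctions K m := Subalgebra.sum_mem _ fun l _ => Subalgebra.smul_mem _ (entry_mem l j) _
    convert h using 1
    ext g
    simp [Matrix.mul_apply]
  · have h : (∑ l, (s⁻¹).1 l j • fun g : Matrix.GeneralLinearGroup (Fin m) K => (g⁻¹).1 i l)
        ∈ glFunctions K m :=
      Subalgebra.sum_mem _ fun l _ => Subalgebra.smul_mem _ (inv_entry_mem i l) _
    convert h using 1
    ext g
    simp only [Function.comp_apply, mul_inv_rev, Units.val_mul, Matrix.mul_apply, Finset.sum_apply,
      Pi.smul_apply, smul_eq_mul]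
    exact Finset.sum_congr rfl fun l _ => mul_comm _ _

lemma isRegularMap_mul_right (s : Matrix.GeneralLinearGroup (Fin m) K) :
    IsRegularMap (glFunctions K m) (glFunctions K m) fun g => g * s := by
  have h := (isRegularMap_mul_left s⁻¹)
  intro F hF
  have h2 := isRegularMap_inv _ (h _ (isRegularMap_inv F hF))
  convert h2 using 1
  ext g
  simp

/-- The Zariski closure of a subgroup of `GL_m(K)`, which is a subgroup. -/
def zariskiClosure (Γ : Subgroup (Matrix.GeneralLinearGroup (Fin m) K)) :
    Subgroup (Matrix.GeneralLinearGroup (Fin m) K) :=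
  letI := zariski (glFunctions K m)
  { carrier := closure (Γ : Set (Matrix.GeneralLinearGroup (Fin m) K))
    one_mem' := subset_closure Γ.one_mem
    inv_mem' := fun {x} hx =>
      map_mem_closure isRegularMap_inv.continuous hx fun _ hs => Γ.inv_mem hs
    mul_mem' := fun {x y} hx hy => by
      have h1 : ∀ s ∈ Γ, s * y ∈ closure (Γ : Set (Matrix.GeneralLinearGroup (Fin m) K)) :=
        fun s hs => map_mem_closure (isRegularMap_mul_left s).continuous hy
          fun _ ht => Γ.mul_mem hs ht
      have h2 := map_mem_closure (isRegularMap_mul_right y).continuous hx h1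
      rwa [closure_closure] at h2 }

end Zariski

/-! ## Lifting a representation to the Steinberg group -/

section Lift

variable {k L : Type*} [Field k] [Field L] [Algebra k L] [Algebra.IsQuadraticExtension k L]
  {τ : L ≃ₐ[k] L} {n m : ℕ} {K : Type*} [Field K]

/-- `H`, the Zariski closure of `ρ(G(k))`. -/
def imageClosure (ρ : SU τ n k →* Matrix.GeneralLinearGroup (Fin m) K) :
    Subgroup (Matrix.GeneralLinearGroup (Fin m) K) :=
  zariskiClosure ρ.range

/-- Let `A` be a finite-dimensional `K`-algebra and `f = algebraMap k A : k → A` a ring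
homomorphism. The maps `ψ_α : V_α(A) → H` and the homomorphism `σ̃ : G̃(A) → H` lift `ρ` to the
Steinberg group of `A`. -/
structure IsSteinbergLift (ρ : SU τ n k →* Matrix.GeneralLinearGroup (Fin m) K)
    (A : Type*) [CommRing A] [Algebra K A] [Algebra k A]
    (ψ : ∀ α : Root n, rootSpace k L A α → imageClosure ρ)
    (σ : Steinberg τ n A →* imageClosure ρ) : Prop where
  finite : Module.Finite K A
  /-- `f` has Zariski-dense image in the affine space `A`. -/
  dense : @Dense A (zariski (polyFunctions K A A)) (Set.range (algebraMap k A))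
  /-- `ψ_α` is a regular map. -/
  regular : ∀ α, IsRegularMap (polyFunctions K A (rootSpace k L A α)) (glFunctions K m)
    fun v => (ψ α v : Matrix.GeneralLinearGroup (Fin m) K)
  /-- `ψ_α ∘ V_α(f) = ρ ∘ X_α`. -/
  comp_rootElt : ∀ α (v : rootSpace k L k α),
    (ψ α (rootSpaceMap (Algebra.ofId k A) α v) : Matrix.GeneralLinearGroup (Fin m) K)
      = ρ (rootElt τ α v)
  /-- `σ̃ ∘ F̃ = ρ ∘ π_k`. -/
  comp_map : ∀ x : Steinberg τ n k,
    (σ (steinbergMap τ (Algebra.ofId k A) x) : Matrix.GeneralLinearGroup (Fin m) K)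
      = ρ (steinbergProj τ n k x)
  /-- `σ̃ ∘ X̃_α = ψ_α`. -/
  comp_gen : ∀ α (v : rootSpace k L A α), σ (steinbergGen τ α v) = ψ α v

end Lift

end

end SUHom

namespace SUHom

noncomputable section

/-! Everything is expressed by elementary elements `elemSU τ hτ p q x`, one for each off-diagonal
position `(p, q)`; the positions `(p, q)` and `(opp q, opp p)` describe the same root subgroup. The
relations among them are collected in `IsElemSystem`. A family with these relations in any group
yields a homomorphism from the Steinberg group (`steinbergOfSystem`): it satisfies the commutator
formula with the same arguments as `SU`, where the arguments are unique (`eq_of_prod_rootElt_eq`).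

Existence. A diagonal element conjugates an elementary element of `G(k)` to its square or fourth
power. Hence the eigenvalues of its image under `ρ` are roots of unity of bounded order, and since
the root subgroups are divisible, the image is unipotent (`isNilpotent_map_elemSU_sub_one`). The
logarithms are additive maps that satisfy Lie relations (`IsLieSystem`). Brackets express all of
them `K`-linearly by a single map `D₀ : k → M_m(K)`, the logarithm on one long root subgroup
(`IsLieSystem.factorsThrough`, where `n ≥ 2` enters). In particular `D₀ (t x)` depends linearly on
`D₀ x`, so `k` acts on the finite-dimensional span of `D₀`, and the operators of this action span
the algebra `A` (`exists_algebra_of_forall_mul`). The logarithms extend to `A ⊗ L`. The exponentials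
of the extensions are polynomial maps, take values in `H` by density, and form an elementary system,
which gives `ψ` and `σ̃`.

Surjectivity and connectedness. For any such data the image of `σ̃` is generated by the sets
`ψ_α(V_α(A))`, images of affine spaces that contain `1`. Such a group is closed and irreducible
(`closed_and_irreducible_of_generated`, which rests on Chevalley's theorem on constructible images).
It contains `ρ(G(k))`, because Gaussian elimination shows that root subgroups generate `G(k)`
(`elemSubgroup_eq_top`). So it is `H`.

Perfectness. A diagonal element `t` scales the argument of a root subgroup by an integer `c ≥ 2`, so
the root element with argument `z` is the commutator of `t` and the one with argument `z / (c - 1)`.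
-/

/-- The index set of the rows and columns of the matrices of `SU_{2n}`. -/
abbrev Idx (n : ℕ) : Type := Fin n × Fin 2

/-- The index of the basis vector that is paired with that of index `p`. -/
def opp {n : ℕ} (p : Idx n) : Idx n := (p.1, p.2.rev)

/-! ### Paired indices and signs. -/

section Opp

variable {n : ℕ}

@[simp] lemma opp_opp (p : Idx n) : opp (opp p) = p := by simp [opp]

@[simp] lemma opp_inj {p q : Idx n} : opp p = opp q ↔ p = q :=
  ⟨fun h => by rw [← opp_opp p, h, opp_opp], fun h => h ▸ rfl⟩

@[simp] lemma opp_zero (i : Fin n) : opp (i, 0) = (i, 1) := rfl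

@[simp] lemma opp_one (i : Fin n) : opp (i, 1) = (i, 0) := rfl

lemma rev_ne_self (a : Fin 2) : a.rev ≠ a := by fin_cases a <;> decide

@[simp] lemma opp_ne_self (p : Idx n) : opp p ≠ p := fun h => rev_ne_self p.2 (congrArg Prod.snd h)

@[simp] lemma self_ne_opp (p : Idx n) : p ≠ opp p := (opp_ne_self p).symm

lemma eq_opp_comm {p q : Idx n} : p = opp q ↔ q = opp p :=
  ⟨fun h => by rw [h, opp_opp], fun h => by rw [h, opp_opp]⟩

/-- The sign that relates the entries at `(p, q)` and `(opp q, opp p)` of elements of the Lie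
algebra of `SU_{2n}`. -/
def sgn (p q : Idx n) : ℤ := if p.2 = q.2 then -1 else 1

lemma sgn_mul_self (p q : Idx n) : sgn p q * sgn p q = 1 := by
  unfold sgn; split_ifs <;> rfl

@[simp] lemma sgn_smul_sgn_smul {M : Type*} [AddCommGroup M] (p q : Idx n) (x : M) :
    sgn p q • sgn p q • x = x := by
  rw [smul_smul, sgn_mul_self, one_smul]

@[simp] lemma sgn_self_opp (p : Idx n) : sgn p (opp p) = 1 :=
  if_neg fun h => rev_ne_self p.2 h.symm

@[simp] lemma sgn_opp_opp (p q : Idx n) : sgn (opp q) (opp p) = sgn p q := by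
  simp [sgn, opp, eq_comm]

lemma sgn_opp_right (p q : Idx n) : sgn p (opp q) = -sgn p q := by
  obtain ⟨i, a⟩ := p
  obtain ⟨j, b⟩ := q
  fin_cases a <;> fin_cases b <;> simp [sgn, opp]

/-- With `ε = ±1` according to the second coordinate, `sgn p q = -ε_p ε_q`; this accounts for the
minus sign. -/
lemma sgn_mul_sgn (p q t : Idx n) : sgn p q * sgn q t = -sgn p t := by
  obtain ⟨i, a⟩ := p
  obtain ⟨j, b⟩ := q
  obtain ⟨l, c⟩ := t
  fin_cases a <;> fin_cases b <;> fin_cases c <;> simp [sgn]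

end Opp

/-! ### Elementary matrices and their relations. -/

section ElemMatrix

variable {k L : Type*} [Field k] [Field L] [Algebra k L] (τ : L ≃ₐ[k] L) {n : ℕ}
  {R : Type*} [CommRing R] [Algebra k R]

/-- The element `E_{pq}(x) ± E_{q'p'}(x̄)` of the Lie algebra of `SU_{2n}`, with `'` for `opp`. -/
def lieMatrix (p q : Idx n) (x : R ⊗[k] L) : Matrix (Idx n) (Idx n) (R ⊗[k] L) :=
  Matrix.single p q x + Matrix.single (opp q) (opp p) (sgn p q • conj τ R x)

lemma single_mul_single_ite {ι S : Type*} [DecidableEq ι] [Fintype ι] [CommRing S] (a b c d : ι)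
    (x y : S) : Matrix.single a b x * Matrix.single c d y
      = if b = c then Matrix.single a d (x * y) else 0 := by
  split_ifs with h
  · subst h; simp
  · simp [h]

lemma lieMatrix_add (p q : Idx n) (x y : R ⊗[k] L) :
    lieMatrix τ p q (x + y) = lieMatrix τ p q x + lieMatrix τ p q y := by
  simp only [lieMatrix, map_add, smul_add, Matrix.single_add]
  abel

lemma lieMatrix_mul_self (p q : Idx n) (h : p ≠ q) (x y : R ⊗[k] L) :
    lieMatrix τ p q x * lieMatrix τ p q y = 0 := by
  simp [lieMatrix, add_mul, mul_add, h, h.symm]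

lemma lieMatrix_opp [Algebra.IsQuadraticExtension k L] (p q : Idx n) (x : R ⊗[k] L) :
    lieMatrix τ (opp q) (opp p) (sgn p q • conj τ R x) = lieMatrix τ p q x := by
  simp [-zsmul_eq_mul, lieMatrix, conj_conj, add_comm]

/-- The two positions coincide here, so that only the trace of `x` is visible. This is the origin of
the factor `1/2` at long roots. -/
lemma lieMatrix_long (p : Idx n) (x : R ⊗[k] L) :
    lieMatrix τ p (opp p) x = Matrix.single p (opp p) (x + conj τ R x) := by
  simp [lieMatrix, Matrix.single_add]

/-- The hypotheses say that no column index `q`, `opp p` of the first factor meets a row index `r`,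
`opp t` of the second. -/
lemma lieMatrix_comm {p q r t : Idx n} (h1 : q ≠ r) (h2 : opp q ≠ t) (h3 : p ≠ t)
    (h4 : opp p ≠ r) (x y : R ⊗[k] L) :
    lieMatrix τ p q x * lieMatrix τ r t y = 0 := by
  have h5 : q ≠ opp t := fun h => h2 (by rw [h, opp_opp])
  simp [lieMatrix, add_mul, mul_add, h1, h5, h3, h4]

/-- Products in the order `(q, t)`, `(p, q)` of Lie algebra elements vanish if `q = r` is the only
coincidence. -/
lemma lieMatrix_mul_eq {p q t : Idx n} (hqt : q ≠ t) (hpq : p ≠ q) (hpt : p ≠ t) (h1 : p ≠ opp q)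
    (h2 : t ≠ opp q) (x y : R ⊗[k] L) :
    lieMatrix τ p q x * lieMatrix τ q t y = Matrix.single p t (x * y) ∧
    lieMatrix τ q t y * lieMatrix τ p q x
      = - Matrix.single (opp t) (opp p) (sgn p t • conj τ R (x * y)) := by
  have h3 : q ≠ opp t := fun h => h2 (by rw [h, opp_opp])
  have h4 : opp p ≠ q := fun h => h1 (by rw [← h, opp_opp])
  constructor
  · simp [lieMatrix, add_mul, mul_add, hpt, h3, h4]
  · simp only [lieMatrix, add_mul, mul_add, single_mul_single_ite, hpt.symm, h2.symm, h1.symm,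
      if_true, if_false, add_zero, zero_add, eq_comm (a := t)]
    rw [smul_mul_smul_comm, mul_comm, sgn_mul_sgn, neg_smul, ← Matrix.single_neg, map_mul, mul_comm]
/-- `1 + lieMatrix τ p q x`. -/
def elemMatrix (p q : Idx n) (x : R ⊗[k] L) : Matrix (Idx n) (Idx n) (R ⊗[k] L) :=
  1 + lieMatrix τ p q x

/-- This is a commutator formula in the form `ab = bca`, which avoids inverse matrices. -/
lemma elemMatrix_conj_short {p q t : Idx n} (hpq : p ≠ q) (hqt : q ≠ t) (hpt : p ≠ t)
    (h1 : p ≠ opp q) (h2 : t ≠ opp q) (x y : R ⊗[k] L) :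
    elemMatrix τ p q x * elemMatrix τ q t y
      = elemMatrix τ q t y * elemMatrix τ p t (x * y) * elemMatrix τ p q x := by
  obtain ⟨h3, h4⟩ := lieMatrix_mul_eq τ hqt hpq hpt h1 h2 x y
  have h5 := lieMatrix_comm τ (p := q) (q := t) (r := p) (t := t) hpt.symm (opp_ne_self t) hqt
    (fun h => h1 h.symm) y (x * y)
  have h6 := lieMatrix_comm τ (p := p) (q := t) (r := p) (t := q) hpt.symm
    (fun h => h2 (by rw [← h, opp_opp])) hpq (opp_ne_self p) (x * y) x
  have h7 : lieMatrix τ p q x * lieMatrix τ q t y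
      = lieMatrix τ p t (x * y) + lieMatrix τ q t y * lieMatrix τ p q x := by
    rw [h3, h4, lieMatrix]; abel
  simp only [elemMatrix, add_mul, mul_add, one_mul, mul_one, h5, h6, h7, zero_mul, add_zero]
  abel

/-- With `X`, `Y` the two Lie algebra elements, `X² = 0` and the factor at `(p, opp p)` is the
second order term `[X, [X, Y]] / 2 = -XYX`, which does not vanish when the second position is long.
-/
lemma elemMatrix_conj_long [Algebra.IsQuadraticExtension k L] {p q : Idx n} (hpq : p ≠ q)
    (h1 : p ≠ opp q) (x y : R ⊗[k] L) :
    elemMatrix τ p q x * elemMatrix τ q (opp q) y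
      = elemMatrix τ q (opp q) y * elemMatrix τ p (opp q) (x * (y + conj τ R y))
        * elemMatrix τ p (opp p) (-(sgn p q • (x * conj τ R x * y))) * elemMatrix τ p q x := by
  have h2 : opp p ≠ q := fun h => h1 (by rw [← h, opp_opp])
  have h3 : conj τ R (y + conj τ R y) = y + conj τ R y := by rw [map_add, conj_conj, add_comm]
  have h4 : -(sgn p q • (x * conj τ R x * y)) + conj τ R (-(sgn p q • (x * conj τ R x * y)))
      = -(sgn p q • (x * conj τ R x * (y + conj τ R y))) := by
    simp only [map_neg, map_zsmul, map_mul, conj_conj, mul_add, smul_add,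
      mul_comm (conj τ R x) x]
    abel
  have h5 : lieMatrix τ p (opp q) (x * (y + conj τ R y)) = Matrix.single p (opp q)
      (x * (y + conj τ R y)) - Matrix.single q (opp p) (sgn p q • (conj τ R x * (y + conj τ R y))) := by
    rw [lieMatrix, sgn_opp_right, map_mul, h3, opp_opp, neg_smul, ← Matrix.single_neg, sub_eq_add_neg]
  simp only [elemMatrix, lieMatrix_long, h4, h5]
  set T := y + conj τ R y
  simp only [lieMatrix, add_mul, mul_add, sub_mul, mul_sub, one_mul, mul_one,
    single_mul_single_ite, hpq, hpq.symm, h1, h1.symm, h2, h2.symm, opp_ne_self, self_ne_opp,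
    opp_inj, if_true, if_false, add_zero, zero_add, sub_zero, zero_sub, zero_mul, mul_zero]
  have h6 : x * T * sgn p q • conj τ R x = sgn p q • (x * conj τ R x * T) := by
    rw [mul_smul_comm]; congr 1; ring
  have h7 : T * sgn p q • conj τ R x = sgn p q • (conj τ R x * T) := by
    rw [mul_smul_comm, mul_comm]
  rw [h6, h7, ← Matrix.single_neg]
  abel

lemma elemMatrix_mul_self {p q : Idx n} (h : p ≠ q) (x y : R ⊗[k] L) :
    elemMatrix τ p q x * elemMatrix τ p q y = elemMatrix τ p q (x + y) := by
  simp only [elemMatrix, add_mul, mul_add, one_mul, mul_one, lieMatrix_mul_self τ p q h,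
    lieMatrix_add]
  abel

end ElemMatrix

/-! ### Roots as matrix positions. -/

section Roots

variable {n : ℕ}

/-- The row of the matrix entry that belongs to a root. -/
def Root.fst : Root n → Idx n
  | .twoPos i => (i, 0)
  | .twoNeg i => (i, 1)
  | .diff i _ _ => (i, 0)
  | .sumPos i _ _ => (i, 0)
  | .sumNeg _ j _ => (j, 1)

/-- The column of the matrix entry that belongs to a root. -/
def Root.snd : Root n → Idx n
  | .twoPos i => (i, 1)
  | .twoNeg i => (i, 0)
  | .diff _ j _ => (j, 0)
  | .sumPos _ j _ => (j, 1)
  | .sumNeg i _ _ => (i, 0)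

lemma Root.fst_ne_snd (α : Root n) : α.fst ≠ α.snd := by
  cases α <;> simp_all [Root.fst, Root.snd]

/-- Every position off the diagonal belongs to a root, up to the symmetry. -/
lemma exists_root {p q : Idx n} (h : p ≠ q) :
    ∃ γ : Root n, (γ.fst = p ∧ γ.snd = q) ∨ (γ.fst = opp q ∧ γ.snd = opp p) := by
  obtain ⟨i, a⟩ := p
  obtain ⟨j, b⟩ := q
  rcases eq_or_ne i j with rfl | hij
  · fin_cases a <;> fin_cases b
    · exact absurd rfl h
    · exact ⟨.twoPos i, Or.inl ⟨rfl, rfl⟩⟩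
    · exact ⟨.twoNeg i, Or.inl ⟨rfl, rfl⟩⟩
    · exact absurd rfl h
  · fin_cases a <;> fin_cases b
    · exact ⟨.diff i j hij, Or.inl ⟨rfl, rfl⟩⟩
    · rcases lt_or_gt_of_ne hij with h' | h'
      · exact ⟨.sumPos i j h', Or.inl ⟨rfl, rfl⟩⟩
      · exact ⟨.sumPos j i h', Or.inr ⟨rfl, rfl⟩⟩
    · rcases lt_or_gt_of_ne hij with h' | h'
      · exact ⟨.sumNeg i j h', Or.inr ⟨rfl, rfl⟩⟩
      · exact ⟨.sumNeg j i h', Or.inl ⟨rfl, rfl⟩⟩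
    · exact ⟨.diff j i hij.symm, Or.inr ⟨rfl, rfl⟩⟩

variable (k : Type*) [Field k]

/-- The factor `1/2` for long roots and `1` for short roots. -/
def Root.coeff : Root n → k
  | .twoPos _ => 2⁻¹
  | .twoNeg _ => 2⁻¹
  | _ => 1

end Roots

/-! ### Arguments in the root spaces; traces. -/

section RootArg

variable {k L : Type*} [Field k] [Field L] [Algebra k L] {τ : L ≃ₐ[k] L} {n : ℕ}
  {R : Type*} [CommRing R] [Algebra k R]

section

variable [CharZero k] [Algebra.IsQuadraticExtension k L]

/-- Otherwise `1, x` would be a basis of `L` over `k` that is fixed by `τ`. -/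
lemma mem_range_of_tau_eq (hτ : τ ≠ AlgEquiv.refl) {x : L} (hx : τ x = x) :
    x ∈ Set.range (algebraMap k L) := by
  by_contra h
  have hli : LinearIndependent k ![1, x] := by
    rw [LinearIndependent.pair_iff]
    intro s t hst
    rcases eq_or_ne t 0 with rfl | ht
    · simpa using hst
    · refine absurd ⟨-(s / t), ?_⟩ h
      have h1 : algebraMap k L t ≠ 0 := by simpa using ht
      rw [map_neg, map_div₀]
      rw [Algebra.smul_def, Algebra.smul_def, mul_one] at hst
      field_simp
      linear_combination -hst
  have htop := hli.span_eq_top_of_card_eq_finrank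
    (by simp [Algebra.IsQuadraticExtension.finrank_eq_two k L])
  apply hτ
  ext y
  have hy : y ∈ Submodule.span k (Set.range ![1, x]) := htop ▸ Submodule.mem_top
  rw [Matrix.range_cons, Matrix.range_cons, Matrix.range_empty, Set.union_empty,
    Set.singleton_union, Submodule.mem_span_pair] at hy
  obtain ⟨a, b, rfl⟩ := hy
  simp [hx]

/-- On a pure tensor the trace is `r ⊗ (l + τ l)`, and `l + τ l` is fixed by `τ`, hence in `k`. -/
lemma add_conj_mem (hτ : τ ≠ AlgEquiv.refl) (x : R ⊗[k] L) :
    x + conj τ R x ∈ LinearMap.range (Algebra.linearMap R (R ⊗[k] L)) := by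
  induction x using TensorProduct.induction_on with
  | zero => simp
  | tmul r l =>
    obtain ⟨c, hc⟩ := mem_range_of_tau_eq hτ (x := l + τ l) (by
      rw [map_add, tau_tau, add_comm])
    refine ⟨c • r, ?_⟩
    have : r ⊗ₜ[k] l + conj τ R (r ⊗ₜ[k] l) = r ⊗ₜ[k] (l + τ l) := by
      rw [TensorProduct.tmul_add]; simp [conj]
    rw [this, ← hc]
    rw [Algebra.algebraMap_eq_smul_one, TensorProduct.tmul_smul, TensorProduct.smul_tmul']
    rfl
  | add x y hx hy =>
    rw [map_add, add_add_add_comm]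
    exact Submodule.add_mem _ hx hy

/-- The argument in `V_γ(R)` that corresponds to `x ∈ R_L`: it is `x` for short roots and the trace
of `x` for long roots. -/
def rootArg (hτ : τ ≠ AlgEquiv.refl) (x : R ⊗[k] L) : ∀ γ : Root n, rootSpace k L R γ
  | .twoPos _ => ⟨x + conj τ R x, add_conj_mem hτ x⟩
  | .twoNeg _ => ⟨x + conj τ R x, add_conj_mem hτ x⟩
  | .diff _ _ _ => ⟨x, trivial⟩
  | .sumPos _ _ _ => ⟨x, trivial⟩
  | .sumNeg _ _ _ => ⟨x, trivial⟩

end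

variable (τ)

lemma half_add_half [CharZero k] (x : R ⊗[k] L) : (2⁻¹ : k) • x + (2⁻¹ : k) • x = x := by
  rw [← add_smul, ← two_mul, mul_inv_cancel₀ two_ne_zero, one_smul]

lemma conj_smul (c : k) (x : R ⊗[k] L) : conj τ R (c • x) = c • conj τ R x := by
  rw [← algebraMap_smul R c x, map_smul, algebraMap_smul]

/-- At a long root the argument is fixed by `conj` and the two coinciding entries of `lieMatrix` add
up, which the coefficient `1/2` compensates. -/
lemma rootMatrix_eq [CharZero k] (α : Root n) (v : rootSpace k L R α) :
    rootMatrix τ α v = elemMatrix τ α.fst α.snd (α.coeff k • (v : R ⊗[k] L)) := by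
  cases α with
  | twoPos i =>
    have h := lieMatrix_long τ (i, 0) ((2⁻¹ : k) • (v : R ⊗[k] L))
    rw [conj_smul, conj_of_mem_range τ _ v.2, half_add_half] at h
    rw [elemMatrix]
    exact congrArg (1 + ·) h.symm
  | twoNeg i =>
    have h := lieMatrix_long τ (i, 1) ((2⁻¹ : k) • (v : R ⊗[k] L))
    rw [conj_smul, conj_of_mem_range τ _ v.2, half_add_half] at h
    rw [elemMatrix]
    exact congrArg (1 + ·) h.symm
  | diff i j h =>
    simp [rootMatrix, elemMatrix, lieMatrix, Root.fst, Root.snd, Root.coeff, sgn, ← Matrix.single_neg]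
    abel
  | sumPos i j h =>
    simp [rootMatrix, elemMatrix, lieMatrix, Root.fst, Root.snd, Root.coeff, sgn, add_assoc]
  | sumNeg i j h =>
    simp [rootMatrix, elemMatrix, lieMatrix, Root.fst, Root.snd, Root.coeff, sgn, add_assoc]

end RootArg

/-! ### Weights, and positive combinations of roots. -/

section Weights

variable {n : ℕ}

/-- The character by which the diagonal torus acts on the basis vector of index `p`. -/
def wt (p : Idx n) : Fin n → ℤ := Pi.single p.1 (if p.2 = 0 then 1 else -1)

lemma wt_opp (p : Idx n) : wt (opp p) = -wt p := by
  obtain ⟨i, a⟩ := p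
  fin_cases a <;> simp [wt, opp, Pi.single_neg]

lemma Root.char_eq (α : Root n) : α.char = wt α.fst - wt α.snd := by
  cases α with
  | twoPos i =>
    simp only [Root.char, wt, Root.fst, Root.snd, ← Pi.single_sub]
    norm_num
  | twoNeg i =>
    simp only [Root.char, wt, Root.fst, Root.snd, ← Pi.single_sub]
    norm_num
  | diff i j h => simp [Root.char, wt, Root.fst, Root.snd]
  | sumPos i j h => simp [Root.char, wt, Root.fst, Root.snd, Pi.single_neg]
  | sumNeg i j h =>
    simp only [Root.char, wt, Root.fst, Root.snd, Pi.single_neg]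
    simp [Pi.single_neg]
    abel

/-- Since `wt p - wt q = wt p + wt (opp q)` is a sum of two weights that do not cancel, it
determines the unordered pair `{p, opp q}`. -/
lemma wt_sub_eq_iff {p q p' q' : Idx n} (h : p ≠ q) (h' : p' ≠ q') :
    wt p - wt q = wt p' - wt q' ↔ (p' = p ∧ q' = q) ∨ (p' = opp q ∧ q' = opp p) := by
  constructor
  · intro he
    obtain ⟨i, a⟩ := p
    obtain ⟨j, b⟩ := q
    obtain ⟨i', a'⟩ := p'
    obtain ⟨j', b'⟩ := q'
    have h1 := congrFun he i
    have h2 := congrFun he j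
    have h3 := congrFun he i'
    have h4 := congrFun he j'
    simp only [wt, Pi.sub_apply, Pi.single_apply] at h1 h2 h3 h4
    fin_cases a <;> fin_cases b <;> fin_cases a' <;> fin_cases b' <;>
      simp at h h' h1 h2 h3 h4 ⊢ <;> grind
  · rintro (⟨rfl, rfl⟩ | ⟨rfl, rfl⟩)
    · rfl
    · rw [wt_opp, wt_opp]; abel

lemma Root.pos_injective {α β : Root n} (h1 : α.fst = β.fst) (h2 : α.snd = β.snd) : α = β := by
  cases α <;> cases β <;> simp_all [Root.fst, Root.snd] <;> omega

/-- The condition `i < j` in `sumPos` and `sumNeg`, and the choice of sign for `diff`, select one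
position out of each mirror pair. -/
lemma Root.pos_opp {α β : Root n} (h1 : α.fst = opp β.snd) (h2 : α.snd = opp β.fst) : α = β := by
  cases α <;> cases β <;> simp_all [Root.fst, Root.snd] <;> omega

lemma Root.char_injective : Function.Injective (Root.char (n := n)) := by
  intro α β h
  rw [Root.char_eq, Root.char_eq, wt_sub_eq_iff α.fst_ne_snd β.fst_ne_snd] at h
  rcases h with ⟨h1, h2⟩ | ⟨h1, h2⟩
  · exact (Root.pos_injective h1 h2).symm
  · exact (Root.pos_opp h1 h2).symm

/-- The `ℓ¹` norm of a character. -/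
def norm₁ (f : Fin n → ℤ) : ℤ := ∑ c, |f c|

lemma norm₁_wt (p : Idx n) : norm₁ (wt p) = 1 := by
  rw [norm₁, Finset.sum_eq_single p.1]
  · simp only [wt, Pi.single_eq_same]; split_ifs <;> simp
  · intro c _ hc; simp [wt, hc]
  · simp

lemma norm₁_char_le (γ : Root n) : norm₁ γ.char ≤ 2 := by
  calc norm₁ γ.char ≤ norm₁ (wt γ.fst) + norm₁ (wt γ.snd) := by
        rw [Root.char_eq, norm₁, norm₁, norm₁, ← Finset.sum_add_distrib]
        exact Finset.sum_le_sum fun c _ => abs_sub _ _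
    _ = 2 := by rw [norm₁_wt, norm₁_wt]; rfl

lemma wt_self (p : Idx n) : wt p p.1 = 1 ∨ wt p p.1 = -1 := by
  simp only [wt, Pi.single_eq_same]
  split_ifs <;> simp

lemma wt_of_ne {p : Idx n} {c : Fin n} (h : p.1 ≠ c) : wt p c = 0 := by
  simp [wt, Ne.symm h]

lemma eq_or_eq_opp {p q : Idx n} (h : p.1 = q.1) : p = q ∨ p = opp q := by
  obtain ⟨i, a⟩ := p
  obtain ⟨j, b⟩ := q
  fin_cases a <;> fin_cases b <;> simp_all [opp]

lemma wt_mul_wt_nonpos {p q : Idx n} (h : p ≠ q) (c : Fin n) : wt p c * wt q c ≤ 0 := by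
  by_cases hp : p.1 = c
  · by_cases hq : q.1 = c
    · rcases eq_or_eq_opp (hp.trans hq.symm) with rfl | rfl
      · exact absurd rfl h
      · rw [wt_opp, Pi.neg_apply]
        nlinarith [mul_self_nonneg (wt q c)]
    · simp [wt_of_ne hq]
  · simp [wt_of_ne hp]

lemma wt_mul_wt_nonneg {p q : Idx n} (h : opp p ≠ q) (c : Fin n) : 0 ≤ wt p c * wt q c := by
  have := wt_mul_wt_nonpos h c
  rw [wt_opp, Pi.neg_apply] at this
  linarith

lemma abs_add_of_mul_nonneg {a b : ℤ} (h : 0 ≤ a * b) : |a + b| = |a| + |b| :=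
  (abs_add_eq_add_abs_iff a b).2 (mul_nonneg_iff.1 h)

lemma norm₁_wt_sub {p q : Idx n} (h : p ≠ q) : norm₁ (wt p - wt q) = 2 := by
  have h1 : norm₁ (wt p - wt q) = norm₁ (wt p) + norm₁ (wt q) := by
    rw [norm₁, norm₁, norm₁, ← Finset.sum_add_distrib]
    refine Finset.sum_congr rfl fun c _ => ?_
    rw [Pi.sub_apply, sub_eq_add_neg, abs_add_of_mul_nonneg, abs_neg]
    linarith [wt_mul_wt_nonpos h c]
  rw [h1, norm₁_wt, norm₁_wt]; rfl

lemma abs_apply_add_abs_apply_le (γ : Root n) {a b : Fin n} (h : a ≠ b) :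
    |γ.char a| + |γ.char b| ≤ 2 := by
  refine le_trans ?_ (norm₁_char_le γ)
  rw [← Finset.sum_pair h (f := fun c => |γ.char c|)]
  exact Finset.sum_le_sum_of_subset_of_nonneg (Finset.subset_univ _) fun _ _ _ => abs_nonneg _

/-- Two pairs without interaction have no positive combination that is a root. -/
lemma no_posComb {p q r t : Idx n} (hpq : p ≠ q) (hrt : r ≠ t) (h1 : q ≠ r) (h2 : opp q ≠ t)
    (h3 : p ≠ t) (h4 : opp p ≠ r) (γ : Root n) {i j : ℕ} (hi : 1 ≤ i) (hj : 1 ≤ j) :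
    γ.char ≠ i • (wt p - wt q) + j • (wt r - wt t) := by
  intro h
  -- The two characters have no coordinates of opposite sign, so their `ℓ¹` norms add up. A positive
  -- combination then has norm at least `4`, whereas roots have norm at most `2`.
  have hs : ∀ c, 0 ≤ (wt p - wt q) c * (wt r - wt t) c := by
    intro c
    have e1 := wt_mul_wt_nonneg h4 c
    have e2 := wt_mul_wt_nonneg h2 c
    have e3 := wt_mul_wt_nonpos h3 c
    have e4 := wt_mul_wt_nonpos h1 c
    simp only [Pi.sub_apply]
    linarith
  have h5 : norm₁ γ.char = i * norm₁ (wt p - wt q) + j * norm₁ (wt r - wt t) := by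
    rw [h, norm₁, norm₁, norm₁, Finset.mul_sum, Finset.mul_sum, ← Finset.sum_add_distrib]
    refine Finset.sum_congr rfl fun c _ => ?_
    have h6 : 0 ≤ ((i : ℤ) * (wt p - wt q) c) * ((j : ℤ) * (wt r - wt t) c) := by
      have := mul_nonneg (mul_nonneg (Nat.cast_nonneg (α := ℤ) i) (Nat.cast_nonneg (α := ℤ) j))
        (hs c)
      linarith
    rw [Pi.add_apply, Pi.smul_apply, Pi.smul_apply, nsmul_eq_mul, nsmul_eq_mul, abs_add_of_mul_nonneg h6, abs_mul, abs_mul, Nat.abs_cast, Nat.abs_cast]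
  rw [norm₁_wt_sub hpq, norm₁_wt_sub hrt] at h5
  have := norm₁_char_le γ
  omega

lemma fst_ne_fst {p q : Idx n} (h : p ≠ q) (h' : p ≠ opp q) : p.1 ≠ q.1 := fun he =>
  (eq_or_eq_opp he).elim h h'

/-- The coordinates of a root satisfy `|γ a| + |γ b| ≤ 2`. If `t = opp p`, the planes of `p` and `q`
give `(i + j) + |j - i| ≤ 2`; otherwise the planes of `p` and `t` give `i + j ≤ 2`. -/
lemma posComb_short {p q t : Idx n} (hqt : q ≠ t) (hpq : p ≠ q) (hpt : p ≠ t) (h1 : p ≠ opp q)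
    (h2 : t ≠ opp q) (γ : Root n) {i j : ℕ} (hi : 1 ≤ i) (hj : 1 ≤ j)
    (h : γ.char = i • (wt p - wt q) + j • (wt q - wt t)) : i = 1 ∧ j = 1 := by
  have hpq' := fst_ne_fst hpq h1
  have hqt' := (fst_ne_fst hqt.symm h2).symm
  have hc : ∀ c, γ.char c = i * (wt p c - wt q c) + j * (wt q c - wt t c) := fun c => by
    rw [h, Pi.add_apply, Pi.smul_apply, Pi.smul_apply, nsmul_eq_mul, nsmul_eq_mul]; rfl
  by_cases hpt' : p.1 = t.1
  · have h3 := abs_apply_add_abs_apply_le γ hpq'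
    have ht : t = opp p := (eq_or_eq_opp hpt'.symm).resolve_left (Ne.symm hpt)
    rw [hc, hc, ht, wt_opp, Pi.neg_apply, Pi.neg_apply, wt_of_ne hpq', wt_of_ne hpq'.symm] at h3
    rcases wt_self p with e | e <;> rw [e] at h3 <;> simp only [abs_le, abs] at h3 <;> omega
  · have h3 := abs_apply_add_abs_apply_le γ hpt'
    rw [hc, hc, wt_of_ne hpt', wt_of_ne (Ne.symm hpt'), wt_of_ne hpq'.symm, wt_of_ne hqt'] at h3
    rcases wt_self p with e | e <;> rcases wt_self t with e' | e' <;> rw [e, e'] at h3 <;> simp only [abs] at h3 <;> omega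

/-- The planes of `p` and `q` give `i + |2 j - i| ≤ 2`. -/
lemma posComb_long {p q : Idx n} (hpq : p ≠ q) (h1 : p ≠ opp q) (γ : Root n) {i j : ℕ}
    (hi : 1 ≤ i) (hj : 1 ≤ j) (h : γ.char = i • (wt p - wt q) + j • (wt q - wt (opp q))) :
    (i = 1 ∧ j = 1) ∨ (i = 2 ∧ j = 1) := by
  have hpq' := fst_ne_fst hpq h1
  have hc : ∀ c, γ.char c = i * (wt p c - wt q c) + j * (wt q c - wt (opp q) c) := fun c => by
    rw [h, Pi.add_apply, Pi.smul_apply, Pi.smul_apply, nsmul_eq_mul, nsmul_eq_mul]; rfl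
  have h3 := abs_apply_add_abs_apply_le γ hpq'
  rw [hc, hc, wt_opp, Pi.neg_apply, Pi.neg_apply, wt_of_ne hpq', wt_of_ne hpq'.symm] at h3
  rcases wt_self p with e | e <;> rcases wt_self q with e' | e' <;> rw [e, e'] at h3 <;>
    simp only [abs] at h3 <;> omega

end Weights

/-! ### Elementary systems in arbitrary groups. -/

section System

variable {k L : Type*} [Field k] [Field L] [Algebra k L] (τ : L ≃ₐ[k] L) {n : ℕ}
  {R : Type*} [CommRing R] [Algebra k R]

/-- Families of elements of a group that satisfy the relations of the elements `1 + lieMatrix`. -/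
structure IsElemSystem {Γ : Type*} [Group Γ] (g : Idx n → Idx n → R ⊗[k] L → Γ) : Prop where
  add : ∀ {p q}, p ≠ q → ∀ x y, g p q x * g p q y = g p q (x + y)
  opp : ∀ {p q}, p ≠ q → ∀ x, g (opp q) (opp p) (sgn p q • conj τ R x) = g p q x
  comm : ∀ {p q r t}, p ≠ q → r ≠ t → q ≠ r → SUHom.opp q ≠ t → p ≠ t → SUHom.opp p ≠ r →
    ∀ x y, Commute (g p q x) (g r t y)
  conj_short : ∀ {p q t}, p ≠ q → q ≠ t → p ≠ t → p ≠ SUHom.opp q → t ≠ SUHom.opp q → ∀ x y,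
    g p q x * g q t y = g q t y * g p t (x * y) * g p q x
  conj_long : ∀ {p q}, p ≠ q → p ≠ SUHom.opp q → ∀ x y,
    g p q x * g q (SUHom.opp q) y = g q (SUHom.opp q) y * g p (SUHom.opp q) (x * (y + conj τ R y))
      * g p (SUHom.opp p) (-(sgn p q • (x * conj τ R x * y))) * g p q x

variable [CharZero k] [Algebra.IsQuadraticExtension k L]

section

-- The position `(p, q)` or its mirror image belongs to a root, and at a long root the argument may
-- be replaced by half its trace without changing `lieMatrix`.
variable (n R) in
lemma elemMatrix_mem (hτ : τ ≠ AlgEquiv.refl) {p q : Idx n} (h : p ≠ q) (x : R ⊗[k] L) :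
    ∃ X : SU τ n R, X.1.1 = elemMatrix τ p q x := by
  obtain ⟨γ, hγ⟩ := exists_root h
  have hx : ∃ z, lieMatrix τ γ.fst γ.snd z = lieMatrix τ p q x := by
    rcases hγ with ⟨h1, h2⟩ | ⟨h1, h2⟩
    · exact ⟨x, by rw [h1, h2]⟩
    · exact ⟨sgn p q • conj τ R x, by rw [h1, h2, lieMatrix_opp]⟩
  obtain ⟨z, hz⟩ := hx
  have hv : lieMatrix τ γ.fst γ.snd (γ.coeff k • (rootArg hτ z γ : R ⊗[k] L))
      = lieMatrix τ γ.fst γ.snd z := by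
    cases γ with
    | twoPos i =>
      refine (lieMatrix_long τ (i, 0) _).trans (Eq.trans ?_ (lieMatrix_long τ (i, 0) z).symm)
      rw [conj_smul, conj_of_mem_range τ _ (rootArg hτ z (Root.twoPos i)).2]
      exact congrArg _ (half_add_half _)
    | twoNeg i =>
      refine (lieMatrix_long τ (i, 1) _).trans (Eq.trans ?_ (lieMatrix_long τ (i, 1) z).symm)
      rw [conj_smul, conj_of_mem_range τ _ (rootArg hτ z (Root.twoNeg i)).2]
      exact congrArg _ (half_add_half _)
    | _ => simp [Root.coeff, rootArg]
  refine ⟨rootElt τ γ (rootArg hτ z γ), ?_⟩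
  change rootMatrix τ γ _ = _
  rw [rootMatrix_eq, elemMatrix, hv, hz, elemMatrix]

/-- The element `1 + lieMatrix τ p q x` of `SU_{2n}(R)`. -/
def elemSU (hτ : τ ≠ AlgEquiv.refl) (p q : Idx n) (x : R ⊗[k] L) : SU τ n R :=
  -- The value on the diagonal is a default without meaning.
  if h : p ≠ q then (elemMatrix_mem τ n R hτ h x).choose else 1

variable {τ} (hτ : τ ≠ AlgEquiv.refl)

lemma coe_elemSU {p q : Idx n} (h : p ≠ q) (x : R ⊗[k] L) :
    (elemSU τ hτ p q x).1.1 = elemMatrix τ p q x := by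
  rw [elemSU, dif_pos h]
  exact (elemMatrix_mem τ n R hτ h x).choose_spec

lemma SU.ext' {X Y : SU τ n R} (h : X.1.1 = Y.1.1) : X = Y := Subtype.ext (Subtype.ext h)

lemma elemSU_isElemSystem :
    IsElemSystem τ (n := n) (R := R) (elemSU τ hτ) where
  add h x y := SU.ext' <| by
    change (elemSU τ hτ _ _ x).1.1 * (elemSU τ hτ _ _ y).1.1 = _
    rw [coe_elemSU hτ h, coe_elemSU hτ h, coe_elemSU hτ h, elemMatrix_mul_self τ h]
  opp {p q} h x := SU.ext' <| by
    rw [coe_elemSU hτ h, coe_elemSU hτ (fun h' => h (opp_inj.1 h').symm), elemMatrix, elemMatrix,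
      lieMatrix_opp]
  comm {p q r t} hpq hrt h1 h2 h3 h4 x y := SU.ext' <| by
    change (elemSU τ hτ p q x).1.1 * (elemSU τ hτ r t y).1.1
      = (elemSU τ hτ r t y).1.1 * (elemSU τ hτ p q x).1.1
    rw [coe_elemSU hτ hpq, coe_elemSU hτ hrt, elemMatrix, elemMatrix]
    have h5 := lieMatrix_comm τ h1 h2 h3 h4 x y
    have h6 := lieMatrix_comm τ (p := r) (q := t) (r := p) (t := q) h3.symm
      (fun h => h2 (by rw [← h, opp_opp])) h1.symm (fun h => h4 (by rw [← h, opp_opp])) y x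
    simp only [add_mul, mul_add, one_mul, mul_one, h5, h6]
    abel
  conj_short {p q t} hpq hqt hpt h1 h2 x y := SU.ext' <| by
    change (elemSU τ hτ p q x).1.1 * (elemSU τ hτ q t y).1.1
      = (elemSU τ hτ q t y).1.1 * (elemSU τ hτ p t (x * y)).1.1 * (elemSU τ hτ p q x).1.1
    rw [coe_elemSU hτ hpq, coe_elemSU hτ hqt, coe_elemSU hτ hpt]
    exact elemMatrix_conj_short τ hpq hqt hpt h1 h2 x y
  conj_long {p q} hpq h1 x y := SU.ext' <| by
    change (elemSU τ hτ p q x).1.1 * (elemSU τ hτ q (SUHom.opp q) y).1.1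
      = (elemSU τ hτ q (SUHom.opp q) y).1.1
        * (elemSU τ hτ p (SUHom.opp q) (x * (y + conj τ R y))).1.1
        * (elemSU τ hτ p (SUHom.opp p) (-(sgn p q • (x * conj τ R x * y)))).1.1
        * (elemSU τ hτ p q x).1.1
    rw [coe_elemSU hτ hpq, coe_elemSU hτ (self_ne_opp q), coe_elemSU hτ h1,
      coe_elemSU hτ (self_ne_opp p)]
    exact elemMatrix_conj_long τ hpq h1 x y

lemma rootElt_eq (α : Root n) (v : rootSpace k L R α) :
    rootElt τ α v = elemSU τ hτ α.fst α.snd (α.coeff k • (v : R ⊗[k] L)) :=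
  SU.ext' <| by rw [coe_elemSU hτ α.fst_ne_snd]; exact rootMatrix_eq τ α v

end

section

variable {τ} (hτ : τ ≠ AlgEquiv.refl) {Γ : Type*} [Group Γ] {g : Idx n → Idx n → R ⊗[k] L → Γ}

/-- The value of an elementary system at a root. -/
def atRoot (g : Idx n → Idx n → R ⊗[k] L → Γ) (α : Root n) (v : R ⊗[k] L) : Γ :=
  g α.fst α.snd (α.coeff k • v)

namespace IsElemSystem

variable (hg : IsElemSystem τ g)
include hg

lemma zero {p q : Idx n} (h : p ≠ q) : g p q 0 = 1 := by
  have := hg.add h 0 0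
  rwa [add_zero, mul_eq_left] at this

lemma inv {p q : Idx n} (h : p ≠ q) (x : R ⊗[k] L) : (g p q x)⁻¹ = g p q (-x) := by
  rw [inv_eq_iff_mul_eq_one, hg.add h, add_neg_cancel, hg.zero h]

lemma long {p q : Idx n} (h : q = SUHom.opp p) (x : R ⊗[k] L) : g p q (conj τ R x) = g p q x := by
  subst h
  have := hg.opp (self_ne_opp p) x
  rwa [opp_opp, sgn_self_opp, one_smul] at this

/-- An elementary system does not distinguish `x` from its conjugate at a long position. So `x` can
be replaced by half its trace, which lies in the root space. -/
lemma half_trace {p q : Idx n} (h : q = SUHom.opp p) (x : R ⊗[k] L) :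
    g p q ((2⁻¹ : k) • (x + conj τ R x)) = g p q x := by
  have h1 : p ≠ q := by rw [h]; exact self_ne_opp p
  rw [smul_add, ← hg.add h1, ← conj_smul, hg.long h, hg.add h1, half_add_half]

lemma atRoot_rootArg (γ : Root n) (z : R ⊗[k] L) :
    atRoot g γ (rootArg hτ z γ) = g γ.fst γ.snd z := by
  cases γ with
  | twoPos i => exact hg.half_trace (p := (i, 0)) rfl z
  | twoNeg i => exact hg.half_trace (p := (i, 1)) rfl z
  | _ => simp [atRoot, Root.coeff, rootArg]

end IsElemSystem

/-- A root and a map to its root space by which an elementary system can be expressed. -/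
lemma exists_root_arg {p q : Idx n} (h : p ≠ q) : ∃ γ : Root n,
    ((γ.fst = p ∧ γ.snd = q) ∨ (γ.fst = opp q ∧ γ.snd = opp p)) ∧
    ∀ x : R ⊗[k] L, ∃ z : R ⊗[k] L, (γ.fst = p ∧ γ.snd = q ∧ z = x) ∨
      (γ.fst = opp q ∧ γ.snd = opp p ∧ z = sgn p q • conj τ R x) := by
  obtain ⟨γ, hγ⟩ := exists_root h
  refine ⟨γ, hγ, fun x => ?_⟩
  rcases hγ with ⟨h1, h2⟩ | ⟨h1, h2⟩
  · exact ⟨x, Or.inl ⟨h1, h2, rfl⟩⟩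
  · exact ⟨sgn p q • conj τ R x, Or.inr ⟨h1, h2, rfl⟩⟩

lemma IsElemSystem.atRoot_eq (hg : IsElemSystem τ g) {p q : Idx n} (h : p ≠ q) {γ : Root n}
    {x z : R ⊗[k] L} (hz : (γ.fst = p ∧ γ.snd = q ∧ z = x) ∨
      (γ.fst = SUHom.opp q ∧ γ.snd = SUHom.opp p ∧ z = sgn p q • conj τ R x)) :
    atRoot g γ (rootArg hτ z γ) = g p q x := by
  rw [hg.atRoot_rootArg]
  rcases hz with ⟨h1, h2, rfl⟩ | ⟨h1, h2, rfl⟩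
  · rw [h1, h2]
  · rw [h1, h2, hg.opp h]

/-- The entry of `lieMatrix` at its own position recovers the argument in the root space. -/
lemma lieMatrix_apply_self (γ : Root n) (v : rootSpace k L R γ) :
    lieMatrix τ γ.fst γ.snd (γ.coeff k • (v : R ⊗[k] L)) γ.fst γ.snd = v := by
  cases γ with
  | twoPos i =>
    have := lieMatrix_long τ (i, 0) ((2⁻¹ : k) • (v : R ⊗[k] L))
    rw [conj_smul, conj_of_mem_range τ _ v.2, half_add_half] at this
    exact (congrFun (congrFun this _) _).trans (Matrix.single_apply_same _ _ _)
  | twoNeg i =>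
    have := lieMatrix_long τ (i, 1) ((2⁻¹ : k) • (v : R ⊗[k] L))
    rw [conj_smul, conj_of_mem_range τ _ v.2, half_add_half] at this
    exact (congrFun (congrFun this _) _).trans (Matrix.single_apply_same _ _ _)
  | diff i j h => simp [lieMatrix, Root.fst, Root.snd, Root.coeff, Matrix.single_apply]
  | sumPos i j h => simp [lieMatrix, Root.fst, Root.snd, Root.coeff, Matrix.single_apply, h.ne']
  | sumNeg i j h => simp [lieMatrix, Root.fst, Root.snd, Root.coeff, Matrix.single_apply, h.ne]

lemma lieMatrix_apply_of_ne {γ δ : Root n} (h : γ ≠ δ) (x : R ⊗[k] L) :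
    lieMatrix τ γ.fst γ.snd x δ.fst δ.snd = 0 := by
  rw [lieMatrix, Matrix.add_apply, Matrix.single_apply, Matrix.single_apply, if_neg, if_neg,
    add_zero]
  · rintro ⟨h1, h2⟩
    exact h (Root.pos_opp (by rw [← h2, opp_opp]) (by rw [← h1, opp_opp]))
  · rintro ⟨h1, h2⟩
    exact h (Root.pos_injective h1 h2)

end

end System

/-! ### The Chevalley commutator formula, and homomorphisms from the Steinberg group. -/

section Lift

variable {k L : Type*} [Field k] [Field L] [Algebra k L] {τ : L ≃ₐ[k] L} {n : ℕ}
  {R : Type*} [CommRing R] [Algebra k R] [CharZero k] [Algebra.IsQuadraticExtension k L]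
  (hτ : τ ≠ AlgEquiv.refl) {Γ : Type*} [Group Γ] {g : Idx n → Idx n → R ⊗[k] L → Γ}

variable (τ) in
/-- The root elements for the two roots are independent of each other, both in the Lie algebra of
`SU_{2n}` and for the elementary system `g`. -/
def IndepRoots (g : Idx n → Idx n → R ⊗[k] L → Γ) (γ δ : Root n) : Prop :=
  ∀ x y : R ⊗[k] L, lieMatrix τ γ.fst γ.snd x * lieMatrix τ δ.fst δ.snd y = 0 ∧
    lieMatrix τ δ.fst δ.snd y * lieMatrix τ γ.fst γ.snd x = 0 ∧
    Commute (g γ.fst γ.snd x) (g δ.fst δ.snd y)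

lemma IndepRoots.symm {γ δ : Root n} (h : IndepRoots τ g γ δ) : IndepRoots τ g δ γ :=
  fun x y => ⟨(h y x).2.1, (h y x).1, (h y x).2.2.symm⟩

lemma lieMatrix_mul_sum_eq_zero {γ : Root n} {l : List (Root n)}
    (h : ∀ δ ∈ l, IndepRoots τ g γ δ) (x : R ⊗[k] L) (w : Root n → R ⊗[k] L) :
    lieMatrix τ γ.fst γ.snd x * (l.map fun δ => lieMatrix τ δ.fst δ.snd (w δ)).sum = 0 := by
  induction l with
  | nil => simp
  | cons δ l ih =>
    rw [List.map_cons, List.sum_cons, mul_add, (h δ List.mem_cons_self x _).1,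
      ih fun ε hε => h ε (List.mem_cons_of_mem _ hε), add_zero]

lemma prod_elemMatrix {l : List (Root n)} (h : l.Pairwise (IndepRoots τ g))
    (w : Root n → R ⊗[k] L) :
    (l.map fun γ => elemMatrix τ γ.fst γ.snd (w γ)).prod
      = 1 + (l.map fun γ => lieMatrix τ γ.fst γ.snd (w γ)).sum := by
  induction l with
  | nil => simp
  | cons γ l ih =>
    rw [List.pairwise_cons] at h
    rw [List.map_cons, List.prod_cons, List.map_cons, List.sum_cons, ih h.2, elemMatrix, add_mul,
      one_mul, mul_add, mul_one, lieMatrix_mul_sum_eq_zero h.1]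
    abel

lemma sum_lieMatrix_apply {l : List (Root n)} (hl : l.Nodup) (w : ∀ γ, rootSpace k L R γ)
    {γ : Root n} (hγ : γ ∈ l) :
    (l.map fun γ => lieMatrix τ γ.fst γ.snd (γ.coeff k • (w γ : R ⊗[k] L))).sum γ.fst γ.snd
      = w γ := by
  have h0 : ∀ l : List (Root n), γ ∉ l →
      (l.map fun γ => lieMatrix τ γ.fst γ.snd (γ.coeff k • (w γ : R ⊗[k] L))).sum γ.fst γ.snd
        = 0 := by
    intro l hγ
    induction l with
    | nil => simp
    | cons δ l ih =>
      rw [List.mem_cons, not_or] at hγ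
      rw [List.map_cons, List.sum_cons, Matrix.add_apply, ih hγ.2, add_zero,
        lieMatrix_apply_of_ne (Ne.symm hγ.1)]
  induction l with
  | nil => simp at hγ
  | cons δ l ih =>
    rw [List.nodup_cons] at hl
    rw [List.map_cons, List.sum_cons, Matrix.add_apply]
    rcases List.mem_cons.1 hγ with rfl | hγ'
    · rw [lieMatrix_apply_self, h0 l hl.1, add_zero]
    · rw [ih hl.2 hγ', lieMatrix_apply_of_ne (fun h : δ = γ => hl.1 (by rw [h]; exact hγ')), zero_add]

/-- A product of independent root elements determines the factors. -/
lemma eq_of_prod_rootElt_eq {l : List (Root n)} (hl : l.Nodup)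
    (h : l.Pairwise (IndepRoots τ g)) {w w' : ∀ γ, rootSpace k L R γ}
    (he : (l.map fun γ => rootElt τ γ (w γ)).prod = (l.map fun γ => rootElt τ γ (w' γ)).prod)
    {γ : Root n} (hγ : γ ∈ l) : w γ = w' γ := by
  -- All cross terms of the product vanish, so it is `1` plus a sum of Lie algebra elements, and the
  -- entry at the position of a root returns its argument.
  have key : ∀ w : ∀ γ, rootSpace k L R γ, (l.map fun γ => rootElt τ γ (w γ)).prod.1.1
      = 1 + (l.map fun γ => lieMatrix τ γ.fst γ.snd (γ.coeff k • (w γ : R ⊗[k] L))).sum := by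
    intro w
    rw [← prod_elemMatrix h]
    have : (l.map fun γ => rootElt τ γ (w γ)).prod.1.1
        = ((l.map fun γ => rootElt τ γ (w γ)).map fun X => X.1.1).prod := by
      generalize l.map (fun γ => rootElt τ γ (w γ)) = l'
      induction l' with
      | nil => rfl
      | cons X l' ih => rw [List.prod_cons, List.map_cons, List.prod_cons, ← ih]; rfl
    rw [this, List.map_map]
    congr 2
    funext γ
    exact rootMatrix_eq τ γ (w γ)
  have h1 := key w
  rw [he, key w'] at h1
  have h1' := add_left_cancel h1
  have h2 := congrFun (congrFun h1' γ.fst) γ.snd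
  rw [sum_lieMatrix_apply hl _ hγ, sum_lieMatrix_apply hl _ hγ] at h2
  exact Subtype.ext h2.symm

/-- The commutator formula for two elements, uniformly for `SU_{2n}` and an elementary system. -/
def CommutatorFormula (g : Idx n → Idx n → R ⊗[k] L → Γ) (p q : Idx n) (x : R ⊗[k] L)
    (r t : Idx n) (y : R ⊗[k] L) : Prop :=
  ∃ (l : List (Root n)) (w : ∀ γ : Root n, rootSpace k L R γ), l.Nodup ∧
    (∀ γ, γ ∈ l ↔ ∃ i j : ℕ, 1 ≤ i ∧ 1 ≤ j ∧ γ.char = i • (wt p - wt q) + j • (wt r - wt t)) ∧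
    l.Pairwise (IndepRoots τ g) ∧
    ⁅elemSU τ hτ p q x, elemSU τ hτ r t y⁆ = (l.map fun γ => atRoot (elemSU τ hτ) γ (w γ)).prod ∧
    ⁅g p q x, g r t y⁆ = (l.map fun γ => atRoot g γ (w γ)).prod

variable {hτ} (hg : IsElemSystem τ g)

/-- Passing to the mirror position changes neither the element nor its weight. Together with the
exchange of the two factors this reduces the number of cases. -/
lemma CommutatorFormula.opp {p q r t : Idx n} {x y : R ⊗[k] L} (hg : IsElemSystem τ g)
    (h : CommutatorFormula hτ g p q x (opp t) (opp r) (sgn r t • conj τ R y)) (hrt : r ≠ t) :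
    CommutatorFormula hτ g p q x r t y := by
  obtain ⟨l, w, h1, h2, h3, h4, h5⟩ := h
  refine ⟨l, w, h1, fun γ => ?_, h3, ?_, ?_⟩
  · rw [h2, wt_opp, wt_opp, neg_sub_neg]
  · rw [← h4, (elemSU_isElemSystem hτ).opp hrt]
  · rw [← h5, hg.opp hrt]

lemma prod_atRoot_inv {Γ : Type*} [Group Γ] {g : Idx n → Idx n → R ⊗[k] L → Γ}
    (hg : IsElemSystem τ g) (l : List (Root n)) (w : ∀ γ, rootSpace k L R γ) :
    ((l.map fun γ => atRoot g γ (w γ)).prod)⁻¹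
      = (l.reverse.map fun γ => atRoot g γ ((-w γ : rootSpace k L R γ) : R ⊗[k] L)).prod := by
  rw [List.prod_inv_reverse, List.map_map, List.map_reverse]
  congr 2
  refine List.map_congr_left fun γ _ => ?_
  simp only [Function.comp_apply, atRoot]
  rw [hg.inv γ.fst_ne_snd, NegMemClass.coe_neg, smul_neg]

lemma CommutatorFormula.symm {p q r t : Idx n} {x y : R ⊗[k] L} (hg : IsElemSystem τ g)
    (h : CommutatorFormula hτ g r t y p q x) : CommutatorFormula hτ g p q x r t y := by
  obtain ⟨l, w, h1, h2, h3, h4, h5⟩ := h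
  refine ⟨l.reverse, fun γ => -w γ, List.nodup_reverse.2 h1, fun γ => ?_, ?_, ?_, ?_⟩
  · rw [List.mem_reverse, h2]
    exact ⟨fun ⟨i, j, hi, hj, h⟩ => ⟨j, i, hj, hi, by rw [h, add_comm]⟩,
      fun ⟨i, j, hi, hj, h⟩ => ⟨j, i, hj, hi, by rw [h, add_comm]⟩⟩
  · rw [List.pairwise_reverse]
    exact h3.imp fun h => h.symm
  · rw [← commutatorElement_inv, h4, prod_atRoot_inv (elemSU_isElemSystem hτ)]
  · rw [← commutatorElement_inv, h5, prod_atRoot_inv hg]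

lemma commutator_eq_of_mul_eq {Γ : Type*} [Group Γ] {a b c : Γ} (h : a * b = b * c * a)
    (hc : Commute b c) : ⁅a, b⁆ = c := by
  rw [commutatorElement_def, h, hc.eq]; group

include hg in
lemma commutatorFormula_comm {p q r t : Idx n} (hpq : p ≠ q) (hrt : r ≠ t) (h1 : q ≠ r)
    (h2 : opp q ≠ t) (h3 : p ≠ t) (h4 : opp p ≠ r) (x y : R ⊗[k] L) :
    CommutatorFormula hτ g p q x r t y := by
  refine ⟨[], fun _ => 0, List.nodup_nil, fun γ => ?_, List.Pairwise.nil, ?_, ?_⟩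
  · simp only [List.not_mem_nil, false_iff]
    rintro ⟨i, j, hi, hj, h⟩
    exact no_posComb hpq hrt h1 h2 h3 h4 γ hi hj h
  · exact commutatorElement_eq_one_iff_commute.2
      ((elemSU_isElemSystem hτ).comm hpq hrt h1 h2 h3 h4 x y)
  · exact commutatorElement_eq_one_iff_commute.2 (hg.comm hpq hrt h1 h2 h3 h4 x y)

lemma IsElemSystem.commutator_short {Γ : Type*} [Group Γ] {g : Idx n → Idx n → R ⊗[k] L → Γ}
    (hg : IsElemSystem τ g) {p q t : Idx n} (hpq : p ≠ q) (hqt : q ≠ t) (hpt : p ≠ t)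
    (h1 : p ≠ SUHom.opp q) (h2 : t ≠ SUHom.opp q) (x y : R ⊗[k] L) :
    ⁅g p q x, g q t y⁆ = g p t (x * y) :=
  commutator_eq_of_mul_eq (hg.conj_short hpq hqt hpt h1 h2 x y)
    (hg.comm hqt hpt hpt.symm (opp_ne_self t) hqt (fun h => h1 h.symm) _ _)

lemma IsElemSystem.commutator_long {Γ : Type*} [Group Γ] {g : Idx n → Idx n → R ⊗[k] L → Γ}
    (hg : IsElemSystem τ g) {p q : Idx n} (hpq : p ≠ q) (h1 : p ≠ SUHom.opp q) (x y : R ⊗[k] L) :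
    ⁅g p q x, g q (SUHom.opp q) y⁆ = g p (SUHom.opp q) (x * (y + conj τ R y))
      * g p (SUHom.opp p) (-(sgn p q • (x * conj τ R x * y))) := by
  refine commutator_eq_of_mul_eq (by rw [hg.conj_long hpq h1]; group) (Commute.mul_right ?_ ?_)
  · exact hg.comm (self_ne_opp q) h1 h1.symm (by simpa using hpq.symm) (self_ne_opp q) h1.symm _ _
  · exact hg.comm (self_ne_opp q) (self_ne_opp p) h1.symm (by simpa [eq_opp_comm] using h1)
      (by simpa [eq_opp_comm] using h1) h1.symm _ _

include hg in
lemma commutatorFormula_short {p q t : Idx n} (hpq : p ≠ q) (hqt : q ≠ t) (hpt : p ≠ t)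
    (h1 : p ≠ opp q) (h2 : t ≠ opp q) (x y : R ⊗[k] L) :
    CommutatorFormula hτ g p q x q t y := by
  obtain ⟨γ, hγ, hz⟩ := exists_root_arg (τ := τ) (R := R) hpt
  obtain ⟨z, hz⟩ := hz (x * y)
  have hchar : γ.char = wt p - wt t := by
    rw [Root.char_eq]
    exact ((wt_sub_eq_iff hpt γ.fst_ne_snd).2 hγ).symm
  refine ⟨[γ], rootArg hτ z, List.nodup_singleton _, fun δ => ?_, List.pairwise_singleton _ _,
    ?_, ?_⟩
  · rw [List.mem_singleton]
    constructor
    · rintro rfl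
      exact ⟨1, 1, le_rfl, le_rfl, by rw [hchar, one_smul, one_smul]; abel⟩
    · rintro ⟨i, j, hi, hj, h⟩
      obtain ⟨rfl, rfl⟩ := posComb_short hqt hpq hpt h1 h2 δ hi hj h
      apply Root.char_injective
      rw [h, hchar, one_smul, one_smul]; abel
  · rw [(elemSU_isElemSystem hτ).commutator_short hpq hqt hpt h1 h2, List.map_singleton,
      List.prod_singleton, (elemSU_isElemSystem hτ).atRoot_eq hτ hpt hz]
  · rw [hg.commutator_short hpq hqt hpt h1 h2, List.map_singleton,
      List.prod_singleton, hg.atRoot_eq hτ hpt hz]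

include hg in
lemma commutatorFormula_long {p q : Idx n} (hpq : p ≠ q) (h1 : p ≠ opp q) (x y : R ⊗[k] L) :
    CommutatorFormula hτ g p q x q (opp q) y := by
  classical
  obtain ⟨γ, hγ, hz⟩ := exists_root_arg (τ := τ) (R := R) h1
  obtain ⟨z, hz⟩ := hz (x * (y + conj τ R y))
  obtain ⟨δ, hδ, hu⟩ := exists_root_arg (τ := τ) (R := R) (self_ne_opp p)
  obtain ⟨u, hu⟩ := hu (-(sgn p q • (x * conj τ R x * y)))
  have hγc : γ.char = wt p - wt (opp q) := by
    rw [Root.char_eq]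
    exact ((wt_sub_eq_iff h1 γ.fst_ne_snd).2 hγ).symm
  have hδc : δ.char = wt p - wt (opp p) := by
    rw [Root.char_eq]
    exact ((wt_sub_eq_iff (self_ne_opp p) δ.fst_ne_snd).2 hδ).symm
  have hδ' : δ.fst = p ∧ δ.snd = opp p := by simpa using hδ
  have hγδ : γ ≠ δ := by
    rintro rfl
    rw [hδ'.1, hδ'.2] at hγ
    rcases hγ with ⟨-, h⟩ | ⟨h, -⟩
    · exact hpq (opp_inj.1 h)
    · exact hpq (h.trans (opp_opp q))
  have hindep : IndepRoots τ g γ δ := by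
    intro a b
    rw [hδ'.1, hδ'.2]
    have hpq' : opp p ≠ q := fun h => h1 (by rw [← h, opp_opp])
    rcases hγ with ⟨e1, e2⟩ | ⟨e1, e2⟩ <;> rw [e1, e2]
    · exact ⟨lieMatrix_comm τ h1.symm (by simpa using hpq'.symm) (self_ne_opp p) (opp_ne_self p) _ _,
        lieMatrix_comm τ (opp_ne_self p) (by simpa using h1) (by simpa using h1) (opp_ne_self p) _ _,
        hg.comm h1 (self_ne_opp p) h1.symm (by simpa using hpq'.symm) (self_ne_opp p)
          (opp_ne_self p) _ _⟩
    · rw [opp_opp]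
      exact ⟨lieMatrix_comm τ (opp_ne_self p) (by simp) hpq'.symm h1.symm _ _,
        lieMatrix_comm τ hpq' (by simp) (self_ne_opp p) hpq' _ _,
        hg.comm hpq'.symm (self_ne_opp p) (opp_ne_self p) (by simp) hpq'.symm h1.symm _ _⟩
  have hsum : wt p - wt q + (wt q - wt (opp q)) = wt p - wt (opp q) := by abel
  have hsum2 : 2 • (wt p - wt q) + (wt q - wt (opp q)) = wt p - wt (opp p) := by
    rw [wt_opp, wt_opp]; abel
  refine ⟨[γ, δ], fun ε => if ε = γ then rootArg hτ z ε else rootArg hτ u ε, by simp [hγδ],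
    fun ε => ?_, by simpa using hindep, ?_, ?_⟩
  · rw [List.mem_pair]
    constructor
    · rintro (rfl | rfl)
      · exact ⟨1, 1, le_rfl, le_rfl, by rw [hγc, one_smul, one_smul, hsum]⟩
      · exact ⟨2, 1, one_le_two, le_rfl, by rw [hδc, one_smul, hsum2]⟩
    · rintro ⟨i, j, hi, hj, h⟩
      rcases posComb_long hpq h1 ε hi hj h with ⟨rfl, rfl⟩ | ⟨rfl, rfl⟩
      · left
        apply Root.char_injective
        rw [h, hγc, one_smul, one_smul, hsum]
      · right
        apply Root.char_injective
        rw [h, hδc, one_smul, hsum2]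
  · rw [(elemSU_isElemSystem hτ).commutator_long hpq h1, List.map_cons, List.prod_cons,
      List.map_singleton, List.prod_singleton]
    dsimp only
    rw [if_pos rfl, if_neg hγδ.symm,
      (elemSU_isElemSystem hτ).atRoot_eq hτ h1 hz,
      (elemSU_isElemSystem hτ).atRoot_eq hτ (self_ne_opp p) hu]
  · rw [hg.commutator_long hpq h1, List.map_cons, List.prod_cons,
      List.map_singleton, List.prod_singleton]
    dsimp only
    rw [if_pos rfl, if_neg hγδ.symm,
      hg.atRoot_eq hτ h1 hz, hg.atRoot_eq hτ (self_ne_opp p) hu]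

-- At most one factor is long, as `p ≠ t`. If it is the first one, an exchange of the factors and a
-- reflection make it the second one.
include hg in
lemma commutatorFormula_adjacent {p q t : Idx n} (hpq : p ≠ q) (hqt : q ≠ t) (hpt : p ≠ t)
    (x y : R ⊗[k] L) : CommutatorFormula hτ g p q x q t y := by
  by_cases h1 : p = opp q
  · subst h1
    refine CommutatorFormula.opp hg (CommutatorFormula.symm hg ?_) hqt
    have := commutatorFormula_long (hτ := hτ) hg (p := opp t) (q := opp q)
      (fun h => hqt (opp_inj.1 h).symm) (fun h => hpt (by rw [← opp_inj]; exact h.symm))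
      (sgn q t • conj τ R y) x
    rwa [opp_opp] at this
  · by_cases h2 : t = opp q
    · subst h2
      exact commutatorFormula_long hg hpq h1 x y
    · exact commutatorFormula_short hg hpq hqt hpt h1 h2 x y

include hg in
/-- The Chevalley commutator formula. -/
lemma commutatorFormula {p q r t : Idx n} (hpq : p ≠ q) (hrt : r ≠ t)
    (h1 : wt p - wt q ≠ wt r - wt t) (h2 : wt p - wt q ≠ -(wt r - wt t)) (x y : R ⊗[k] L) :
    CommutatorFormula hτ g p q x r t y := by
  rw [Ne, wt_sub_eq_iff hpq hrt] at h1
  rw [neg_sub, Ne, wt_sub_eq_iff hpq hrt.symm] at h2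
  -- A column index of the first element can meet a row index of the second in four ways. Reflection
  -- of the second position and exchange of the factors reduce each of them to `q = r`; if none
  -- occurs, the elements commute.
  by_cases e1 : q = r
  · subst e1
    exact commutatorFormula_adjacent hg hpq hrt (fun h => h2 (Or.inl ⟨h.symm, rfl⟩)) x y
  by_cases e2 : opp q = t
  · subst e2
    refine CommutatorFormula.opp hg ?_ hrt
    rw [opp_opp]
    exact commutatorFormula_adjacent hg hpq (fun h => hrt (by rw [h, opp_opp]))
      (fun h => h2 (Or.inr ⟨rfl, by rw [h, opp_opp]⟩)) x _
  by_cases e3 : p = t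
  · subst e3
    exact CommutatorFormula.symm hg (commutatorFormula_adjacent hg hrt hpq (Ne.symm e1) y x)
  by_cases e4 : opp p = r
  · subst e4
    refine CommutatorFormula.opp hg (CommutatorFormula.symm hg ?_) hrt
    rw [opp_opp]
    exact commutatorFormula_adjacent hg (fun h => hrt (by rw [← h, opp_opp])) hpq
      (fun h => e2 (by rw [← h, opp_opp])) _ x
  exact commutatorFormula_comm hg hpq hrt e1 e2 e3 e4 x y

include hg in
lemma atRoot_add (α : Root n) (v w : rootSpace k L R α) :
    atRoot g α (v : R ⊗[k] L) * atRoot g α w = atRoot g α ((v + w : rootSpace k L R α)) := by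
  rw [atRoot, atRoot, hg.add α.fst_ne_snd, ← smul_add]; rfl

-- The list `l` and the arguments `w` are known only through an identity in `SU`. The general
-- formula provides another list `l'` with arguments `w'` that serve `SU` and `g` at once;
-- uniqueness in `SU` forces `w = w'` on it, and the order is irrelevant since the factors commute.
include hg hτ in
lemma atRoot_commutator (α β : Root n) (u : rootSpace k L R α) (v : rootSpace k L R β)
    (l : List (Root n)) (w : ∀ γ : Root n, rootSpace k L R γ) (h1 : α.char ≠ β.char)
    (h2 : α.char ≠ -β.char) (hl : l.Nodup) (hmem : ∀ γ, γ ∈ l ↔ IsPosComb α β γ)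
    (h : ⁅rootElt τ α u, rootElt τ β v⁆ = (l.map fun γ => rootElt τ γ (w γ)).prod) :
    ⁅atRoot g α (u : R ⊗[k] L), atRoot g β v⁆ = (l.map fun γ => atRoot g γ (w γ)).prod := by
  rw [Root.char_eq, Root.char_eq] at h1 h2
  obtain ⟨l', w', hl', hmem', hindep, hX, hg'⟩ := commutatorFormula (hτ := hτ) hg α.fst_ne_snd
    β.fst_ne_snd h1 h2 (α.coeff k • (u : R ⊗[k] L)) (β.coeff k • (v : R ⊗[k] L))
  have hperm : l.Perm l' := by
    rw [List.perm_ext_iff_of_nodup hl hl']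
    intro γ
    rw [hmem, hmem', IsPosComb, Root.char_eq α, Root.char_eq β]
  have hpairX : (l'.map fun γ => rootElt τ γ (w γ)).Pairwise Commute := by
    rw [List.pairwise_map]
    refine hindep.imp fun {γ δ} hγδ => SU.ext' ?_
    change rootMatrix τ γ _ * rootMatrix τ δ _ = rootMatrix τ δ _ * rootMatrix τ γ _
    rw [rootMatrix_eq, rootMatrix_eq, elemMatrix, elemMatrix]
    simp only [add_mul, mul_add, one_mul, mul_one, (hγδ _ _).1, (hγδ _ _).2.1]
    abel
  have hpairg : (l'.map fun γ => atRoot g γ (w γ : R ⊗[k] L)).Pairwise Commute := by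
    rw [List.pairwise_map]
    exact hindep.imp fun {γ δ} hγδ => (hγδ _ _).2.2
  have hw : ∀ γ ∈ l', w γ = w' γ := fun γ hγ => by
    refine eq_of_prod_rootElt_eq hl' hindep ?_ hγ
    rw [← (hperm.map _).symm.prod_eq' hpairX] at h
    rw [rootElt_eq hτ, rootElt_eq hτ, hX] at h
    rw [← h]
    congr 1
    exact List.map_congr_left fun γ _ => (rootElt_eq hτ γ (w' γ)).symm
  rw [← (hperm.map _).symm.prod_eq' hpairg]
  refine hg'.trans ?_
  congr 1
  exact List.map_congr_left fun γ hγ => by rw [hw γ hγ]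

/-- The homomorphism from the Steinberg group that is given by an elementary system. -/
def steinbergOfSystem (hτ : τ ≠ AlgEquiv.refl) (hg : IsElemSystem τ g) : Steinberg τ n R →* Γ :=
  Steinberg.lift τ (fun α v => atRoot g α (v : R ⊗[k] L)) (atRoot_add hg)
    (atRoot_commutator (hτ := hτ) hg)

lemma steinbergOfSystem_gen (hτ : τ ≠ AlgEquiv.refl) (hg : IsElemSystem τ g) (α : Root n)
    (v : rootSpace k L R α) :
    steinbergOfSystem hτ hg (steinbergGen τ α v) = atRoot g α (v : R ⊗[k] L) := by
  rw [steinbergOfSystem, Steinberg.lift, steinbergGen, PresentedGroup.toGroup.of]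

end Lift

/-! ### Gaussian elimination: root subgroups generate `SU` over the field. -/

section Generation

variable {k L : Type*} [Field k] [Field L] [Algebra k L] {τ : L ≃ₐ[k] L} {n : ℕ}
  [CharZero k] [Algebra.IsQuadraticExtension k L] (hτ : τ ≠ AlgEquiv.refl)

section

variable {R : Type*} [CommRing R] [Algebra k R]

lemma form_apply (X : SU τ n R) (i j : Idx n) :
    ∑ c, (conj τ R (X.1.1 (c, 1) i) * X.1.1 (c, 0) j - conj τ R (X.1.1 (c, 0) i) * X.1.1 (c, 1) j)
      = if j = opp i then (if i.2 = 0 then -1 else 1) else 0 := by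
  have h := congrFun (congrFun X.2 i) j
  have h1 : formMatrix n (R ⊗[k] L) i j
      = if j = opp i then (if i.2 = 0 then -1 else 1) else 0 := by
    obtain ⟨a, b⟩ := i
    obtain ⟨c, d⟩ := j
    obtain rfl | rfl : b = 0 ∨ b = 1 := by omega
    all_goals obtain rfl | rfl : d = 0 ∨ d = 1 := by omega
    all_goals simp [formMatrix, Matrix.one_apply, eq_comm (a := c)]
    split_ifs <;> simp
  rw [h1] at h
  rw [← h]
  simp only [Matrix.mul_apply, Fintype.sum_prod_type, Fin.sum_univ_two, formMatrix, star,
    Matrix.kroneckerMap_apply, Matrix.one_apply, Matrix.transpose_apply, Matrix.map_apply]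
  refine Finset.sum_congr rfl fun c _ => ?_
  simp [Finset.sum_add_distrib, sub_eq_add_neg]

lemma form_apply_of_plane (X : SU τ n R) {c : Fin n} {i j : Idx n}
    (hj : ∀ a : Idx n, a.1 ≠ c → X.1.1 a j = 0) :
    conj τ R (X.1.1 (c, 1) i) * X.1.1 (c, 0) j - conj τ R (X.1.1 (c, 0) i) * X.1.1 (c, 1) j
      = if j = opp i then (if i.2 = 0 then -1 else 1) else 0 := by
  rw [← form_apply X i j, Finset.sum_eq_single c]
  · intro b _ hb
    rw [hj (b, 0) hb, hj (b, 1) hb]; simp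
  · simp

/-- Pairing the unit column `p` with the column `j` isolates the entry at `(opp p, j)`, up to sign.
-/
lemma form_apply_of_unit_col (X : SU τ n R) {p : Idx n}
    (hp : ∀ a, X.1.1 a p = (1 : Matrix (Idx n) (Idx n) (R ⊗[k] L)) a p) (j : Idx n) :
    X.1.1 (opp p) j = (1 : Matrix (Idx n) (Idx n) (R ⊗[k] L)) (opp p) j := by
  have h := form_apply X p j
  obtain ⟨c, b⟩ := p
  rw [Finset.sum_eq_single c] at h
  · obtain rfl | rfl : b = 0 ∨ b = 1 := by omega
    · simp only [hp, opp_zero] at h ⊢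
      simp [Matrix.one_apply] at h ⊢
      split_ifs at h with h'
      · simpa [h'] using h
      · simpa [Ne.symm h'] using h
    · simp only [hp, opp_one] at h ⊢
      simp [Matrix.one_apply] at h ⊢
      by_cases hj : j = (c, 0)
      · subst hj; simpa using h
      · simpa [hj, Ne.symm hj] using h
  · intro d _ hd
    rw [hp, hp, Matrix.one_apply_ne, Matrix.one_apply_ne] <;> simp [hd]
  · simp

lemma elem_mul_apply {p q : Idx n} (h : p ≠ q) (x : R ⊗[k] L) (X : SU τ n R) (i j : Idx n) :
    (elemSU τ hτ p q x * X).1.1 i j = X.1.1 i j + (if i = p then x * X.1.1 q j else 0)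
      + (if i = opp q then sgn p q • conj τ R x * X.1.1 (opp p) j else 0) := by
  change ((elemSU τ hτ p q x).1.1 * X.1.1) i j = _
  rw [coe_elemSU hτ h, elemMatrix, lieMatrix, add_mul, add_mul, one_mul, Matrix.add_apply,
    Matrix.add_apply, ← add_assoc]
  congr 1
  · congr 1
    split_ifs with hi
    · subst hi; rw [Matrix.single_mul_apply_same]
    · rw [Matrix.single_mul_apply_of_ne _ _ _ _ _ hi]
  · split_ifs with hi
    · subst hi; rw [Matrix.single_mul_apply_same]
    · rw [Matrix.single_mul_apply_of_ne _ _ _ _ _ hi]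

lemma elem_long_mul_apply (p : Idx n) {x : R ⊗[k] L} (hx : conj τ R x = x) (X : SU τ n R)
    (i j : Idx n) : (elemSU τ hτ p (opp p) ((2⁻¹ : k) • x) * X).1.1 i j
      = X.1.1 i j + (if i = p then x * X.1.1 (opp p) j else 0) := by
  rw [elem_mul_apply hτ (self_ne_opp p), sgn_self_opp, one_smul, opp_opp, conj_smul, hx]
  split_ifs
  · rw [add_assoc, ← add_mul, half_add_half]
  · simp

variable (τ n R) in
/-- The subgroup that is generated by the root subgroups. -/
def elemSubgroup : Subgroup (SU τ n R) :=
  Subgroup.closure {X | ∃ (p q : Idx n) (x : R ⊗[k] L), p ≠ q ∧ X = elemSU τ hτ p q x}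

lemma elemSU_mem {p q : Idx n} (h : p ≠ q) (x : R ⊗[k] L) :
    elemSU τ hτ p q x ∈ elemSubgroup τ n hτ R :=
  Subgroup.subset_closure ⟨p, q, x, h, rfl⟩

/-- `X` is the identity outside of the hyperbolic planes with index in `S`. -/
def SupportedOn (S : Finset (Fin n)) (X : SU τ n R) : Prop :=
  ∀ a b : Idx n, a.1 ∉ S ∨ b.1 ∉ S → X.1.1 a b = (1 : Matrix (Idx n) (Idx n) (R ⊗[k] L)) a b

lemma SupportedOn.elem_mul {S : Finset (Fin n)} {X : SU τ n R} (h : SupportedOn S X) {p q : Idx n}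
    (hpq : p ≠ q) (hp : p.1 ∈ S) (hq : q.1 ∈ S) (x : R ⊗[k] L) :
    SupportedOn S (elemSU τ hτ p q x * X) := by
  intro a b hab
  rw [elem_mul_apply hτ hpq, h a b hab]
  rcases hab with ha | hb
  · rw [if_neg, if_neg, add_zero, add_zero]
    · rintro rfl; exact ha hq
    · rintro rfl; exact ha hp
  · have h1 : (1 : Matrix (Idx n) (Idx n) (R ⊗[k] L)) q b = 0 :=
      Matrix.one_apply_ne (by rintro rfl; exact hb hq)
    have h2 : (1 : Matrix (Idx n) (Idx n) (R ⊗[k] L)) (opp p) b = 0 :=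
      Matrix.one_apply_ne (by rintro rfl; exact hb hp)
    rw [h q b (Or.inr hb), h (opp p) b (Or.inr hb), h1, h2]
    simp

/-- Equivalence modulo the elementary subgroup, within the elements supported on `S`. -/
def ElemEquiv (S : Finset (Fin n)) (X Y : SU τ n R) : Prop :=
  Y * X⁻¹ ∈ elemSubgroup τ n hτ R ∧ (SupportedOn S X → SupportedOn S Y)

lemma ElemEquiv.refl (S : Finset (Fin n)) (X : SU τ n R) : ElemEquiv hτ S X X :=
  ⟨by rw [mul_inv_cancel]; exact Subgroup.one_mem _, id⟩

variable {hτ}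

lemma ElemEquiv.trans {S : Finset (Fin n)} {X Y Z : SU τ n R} (h : ElemEquiv hτ S X Y)
    (h' : ElemEquiv hτ S Y Z) : ElemEquiv hτ S X Z :=
  ⟨by have := Subgroup.mul_mem _ h'.1 h.1; rwa [mul_assoc, inv_mul_cancel_left] at this,
    h'.2 ∘ h.2⟩

lemma ElemEquiv.elem_mul {S : Finset (Fin n)} (X : SU τ n R) {p q : Idx n} (hpq : p ≠ q)
    (hp : p.1 ∈ S) (hq : q.1 ∈ S) (x : R ⊗[k] L) :
    ElemEquiv hτ S X (elemSU τ hτ p q x * X) :=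
  ⟨by rw [mul_inv_cancel_right]; exact elemSU_mem hτ hpq x, fun h => h.elem_mul hτ hpq hp hq x⟩

/-- The entries of a column outside of the plane of an entry `1` can be cleared. -/
lemma exists_clear_off_plane {S : Finset (Fin n)} {X : SU τ n R} (hX : SupportedOn S X)
    {r j : Idx n} (hr : r.1 ∈ S) (hj : j.1 ∈ S) (h1 : X.1.1 r j = 1) (T : Finset (Idx n)) :
    ∃ Y, ElemEquiv hτ S X Y ∧ Y.1.1 r j = 1 ∧ (∀ t ∈ T, t.1 ≠ r.1 → Y.1.1 t j = 0) ∧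
      ∀ i, (∀ a, X.1.1 a i = (1 : Matrix (Idx n) (Idx n) (R ⊗[k] L)) a (opp r)) →
        ∀ a, Y.1.1 a i = (1 : Matrix (Idx n) (Idx n) (R ⊗[k] L)) a (opp r) := by
  classical
  induction T using Finset.induction_on with
  | empty => exact ⟨X, .refl hτ S X, h1, by simp, fun i h => h⟩
  | insert t T ht ih =>
    obtain ⟨Y, hXY, hY1, hYT, hYi⟩ := ih
    by_cases htr : t.1 = r.1
    · refine ⟨Y, hXY, hY1, fun u hu hur => ?_, hYi⟩
      rcases Finset.mem_insert.1 hu with rfl | hu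
      · exact absurd htr hur
      · exact hYT u hu hur
    by_cases htS : t.1 ∈ S
    · have htr' : t ≠ r := fun h => htr (by rw [h])
      have htr'' : t ≠ opp r := fun h => htr (by rw [h]; rfl)
      -- This subtracts a multiple of row `r` from row `t` to kill the entry at `(t, j)`. The only
      -- other row affected is `opp r`, which lies in the plane of `r`.
      refine ⟨elemSU τ hτ t r (-Y.1.1 t j) * Y, hXY.trans (.elem_mul Y htr' htS hr _), ?_, ?_, ?_⟩
      · rw [elem_mul_apply hτ htr', hY1, if_neg htr'.symm, if_neg (self_ne_opp r)]; simp
      · intro u hu hur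
        rw [elem_mul_apply hτ htr', hY1, if_neg (show ¬u = opp r from fun h => hur (by rw [h]; rfl))]
        rcases eq_or_ne u t with rfl | hut
        · simp
        · rw [if_neg hut, hYT u ((Finset.mem_insert.1 hu).resolve_left hut) hur]; simp
      · intro i hi a
        have h2 := hYi i hi
        rw [elem_mul_apply hτ htr', h2, h2, h2, Matrix.one_apply_ne (self_ne_opp r),
          Matrix.one_apply_ne (fun h => htr' (opp_inj.1 h))]
        simp
    · refine ⟨Y, hXY, hY1, fun u hu hur => ?_, hYi⟩
      rcases Finset.mem_insert.1 hu with rfl | hu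
      · rw [hXY.2 hX u j (Or.inl htS), Matrix.one_apply_ne]
        rintro rfl; exact htS hj
      · exact hYT u hu hur

/-- The column is isotropic; as `1` and one further entry are all that remains, this entry is
invariant under `conj`. So a long root element can clear it. -/
lemma conj_eq_of_col {X : SU τ n R} {r j : Idx n} (h1 : X.1.1 r j = 1)
    (h2 : ∀ t : Idx n, t.1 ≠ r.1 → X.1.1 t j = 0) :
    conj τ R (X.1.1 (opp r) j) = X.1.1 (opp r) j := by
  have h := form_apply_of_plane X (i := j) h2
  rw [if_neg (self_ne_opp j)] at h
  obtain ⟨c, b⟩ := r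
  obtain rfl | rfl : b = 0 ∨ b = 1 := by omega
  · simp only [opp_zero] at h1 h ⊢
    rw [h1, map_one, mul_one, one_mul] at h
    exact sub_eq_zero.1 h
  · simp only [opp_one] at h1 h ⊢
    rw [h1, map_one, mul_one, one_mul] at h
    exact (sub_eq_zero.1 h).symm

/-- A column with an entry `1` can be transformed to a unit vector. -/
lemma exists_clear {S : Finset (Fin n)} {X : SU τ n R} (hX : SupportedOn S X)
    {r j : Idx n} (hr : r.1 ∈ S) (hj : j.1 ∈ S) (h1 : X.1.1 r j = 1) :
    ∃ Y, ElemEquiv hτ S X Y ∧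
      (∀ a, Y.1.1 a j = (1 : Matrix (Idx n) (Idx n) (R ⊗[k] L)) a r) ∧
      ∀ i, (∀ a, X.1.1 a i = (1 : Matrix (Idx n) (Idx n) (R ⊗[k] L)) a (opp r)) →
        ∀ a, Y.1.1 a i = (1 : Matrix (Idx n) (Idx n) (R ⊗[k] L)) a (opp r) := by
  obtain ⟨Y, hXY, hY1, hY2, hY3⟩ := exists_clear_off_plane (hτ := hτ) hX hr hj h1 Finset.univ
  have hc := conj_eq_of_col hY1 fun t => hY2 t (Finset.mem_univ t)
  have hc' : conj τ R (-Y.1.1 (opp r) j) = -Y.1.1 (opp r) j := by rw [map_neg, hc]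
  have key := elem_long_mul_apply hτ (opp r) hc' Y
  rw [opp_opp] at key
  refine ⟨_, hXY.trans (.elem_mul Y (opp_ne_self r) hr hr ((2⁻¹ : k) • (-Y.1.1 (opp r) j))),
    fun a => ?_, fun i hi a => ?_⟩
  · rw [key, hY1]
    by_cases ha : a.1 = r.1
    · rcases eq_or_eq_opp ha with rfl | rfl
      · rw [hY1, if_neg (self_ne_opp a), Matrix.one_apply_eq, add_zero]
      · rw [if_pos rfl, Matrix.one_apply_ne (opp_ne_self r)]; simp
    · rw [hY2 a (Finset.mem_univ a) ha, if_neg (fun h => ha (by rw [h]; rfl)), Matrix.one_apply_ne,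
        add_zero]
      rintro rfl; exact ha rfl
  · rw [key, hY3 i hi, hY3 i hi, Matrix.one_apply_ne (self_ne_opp r)]; simp

/-- If the column `p` is a unit vector, then the plane of `p` can be split off. -/
lemma exists_split {S : Finset (Fin n)} {X : SU τ n R} (hX : SupportedOn S X)
    {p : Idx n} (hp : p.1 ∈ S)
    (h1 : ∀ a, X.1.1 a p = (1 : Matrix (Idx n) (Idx n) (R ⊗[k] L)) a p) :
    ∃ Y, Y * X⁻¹ ∈ elemSubgroup τ n hτ R ∧ SupportedOn (S.erase p.1) Y := by
  -- The unit column `p` forces row `opp p` to be a unit vector, so column `opp p` has an entry `1`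
  -- and can be cleared as well, keeping column `p`. Both rows of the plane are then unit vectors
  -- too.
  obtain ⟨Y, hXY, hY1, hY2⟩ := exists_clear (hτ := hτ) hX (r := opp p) (j := opp p) hp hp
    (by rw [form_apply_of_unit_col X h1, Matrix.one_apply_eq])
  have hYp := hY2 p (by rwa [opp_opp])
  rw [opp_opp] at hYp
  have hrow1 := form_apply_of_unit_col Y hYp
  have hrow2 := form_apply_of_unit_col Y hY1
  rw [opp_opp] at hrow2
  refine ⟨Y, hXY.1, fun a b hab => ?_⟩
  simp only [Finset.mem_erase, not_and_or, not_not] at hab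
  rcases hab with (h | h) | (h | h)
  · rcases eq_or_eq_opp h with rfl | rfl
    · exact hrow2 b
    · exact hrow1 b
  · exact hXY.2 hX a b (Or.inl h)
  · rcases eq_or_eq_opp h with rfl | rfl
    · exact hYp a
    · exact hY1 a
  · exact hXY.2 hX a b (Or.inr h)

end

variable {hτ}

lemma exists_mul_eq_one {x : k ⊗[k] L} (hx : x ≠ 0) : ∃ y, x * y = 1 := by
  let e := Algebra.TensorProduct.lid k L
  refine ⟨e.symm (e x)⁻¹, e.injective ?_⟩
  rw [map_mul, AlgEquiv.apply_symm_apply, map_one, mul_inv_cancel₀]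
  simpa using hx

/-- A column with a non-zero entry at `q` can be transformed to the unit vector of index `r`, for
`r` in another plane. -/
lemma exists_col_eq {S : Finset (Fin n)} {X : SU τ n k} (hX : SupportedOn S X) {q r j : Idx n}
    (hq : q.1 ∈ S) (hr : r.1 ∈ S) (hj : j.1 ∈ S) (hqr : r.1 ≠ q.1) (h : X.1.1 q j ≠ 0) :
    ∃ Y, ElemEquiv hτ S X Y ∧
      ∀ a, Y.1.1 a j = (1 : Matrix (Idx n) (Idx n) (k ⊗[k] L)) a r := by
  obtain ⟨y, hy⟩ := exists_mul_eq_one h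
  have hrq : r ≠ q := fun h => hqr (by rw [h])
  -- With `y` the inverse of the entry at `(q, j)`, this multiple of row `q` turns the entry at `(r,
  -- j)` into `1`.
  have h2 := ElemEquiv.elem_mul (hτ := hτ) X hrq hr hq (y * (1 - X.1.1 r j))
  obtain ⟨Y, hY1, hY2, -⟩ := exists_clear (hτ := hτ) (h2.2 hX) hr hj (r := r) (j := j) (by
    rw [elem_mul_apply hτ hrq, if_pos rfl, if_neg (fun h => hqr (by rw [h]; rfl))]
    linear_combination (1 - X.1.1 r j) * hy)
  exact ⟨Y, h2.trans hY1, hY2⟩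

/-- A zero column would pair to `0` with the column `opp j`, whereas the form gives `±1`. -/
lemma exists_apply_ne_zero {S : Finset (Fin n)} {X : SU τ n k} (hX : SupportedOn S X) {j : Idx n}
    (hj : j.1 ∈ S) : ∃ q : Idx n, q.1 ∈ S ∧ X.1.1 q j ≠ 0 := by
  by_contra! h
  have h0 : ∀ a, X.1.1 a j = 0 := fun a => by
    by_cases ha : a.1 ∈ S
    · exact h a ha
    · rw [hX a j (Or.inl ha), Matrix.one_apply_ne]
      rintro rfl; exact ha hj
  have := form_apply_of_plane X (c := j.1) (i := opp j) (j := j) fun a _ => h0 a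
  rw [opp_opp, if_pos rfl, h0, h0, mul_zero, mul_zero, sub_zero] at this
  split_ifs at this <;> simp at this

lemma exists_supportedOn_erase {S : Finset (Fin n)} {X : SU τ n k} (hX : SupportedOn S X)
    (hS : 2 ≤ S.card) {c : Fin n} (hc : c ∈ S) :
    ∃ Y, Y * X⁻¹ ∈ elemSubgroup τ n hτ k ∧ SupportedOn (S.erase c) Y := by
  obtain ⟨q, hq, hqne⟩ := exists_apply_ne_zero hX (j := (c, 0)) hc
  have hcol : ∃ Y, ElemEquiv hτ S X Y ∧
      ∀ a, Y.1.1 a (c, 0) = (1 : Matrix (Idx n) (Idx n) (k ⊗[k] L)) a (c, 0) := by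
    -- If the non-zero entry lies in the plane of `c` itself, the column is first moved to a unit
    -- vector of another plane `d`, which exists as `S` has two elements.
    by_cases hqc : c = q.1
    · obtain ⟨d, hd, hdc⟩ := Finset.exists_mem_ne (s := S) (by omega) c
      obtain ⟨Y, hY1, hY2⟩ := exists_col_eq (hτ := hτ) hX hq (r := (d, 0)) hd (j := (c, 0)) hc
        (by rw [← hqc]; exact hdc) hqne
      obtain ⟨Z, hZ1, hZ2⟩ := exists_col_eq (hτ := hτ) (hY1.2 hX) (q := (d, 0)) hd (r := (c, 0)) hc
        (j := (c, 0)) hc hdc.symm (by rw [hY2, Matrix.one_apply_eq]; simp)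
      exact ⟨Z, hY1.trans hZ1, hZ2⟩
    · exact exists_col_eq hX hq (r := (c, 0)) hc hc hqc hqne
  obtain ⟨Y, hY1, hY2⟩ := hcol
  obtain ⟨Z, hZ1, hZ2⟩ := exists_split (hτ := hτ) (hY1.2 hX) (p := (c, 0)) hc hY2
  exact ⟨Z, by have := Subgroup.mul_mem _ hZ1 hY1.1; rwa [mul_assoc, inv_mul_cancel_left] at this,
    hZ2⟩

lemma exists_supportedOn_singleton (c : Fin n) (S : Finset (Fin n)) (hc : c ∈ S) (X : SU τ n k)
    (hX : SupportedOn S X) :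
    ∃ Y, Y * X⁻¹ ∈ elemSubgroup τ n hτ k ∧ SupportedOn {c} Y := by
  classical
  induction h : S.card generalizing S X with
  | zero => simp [Finset.card_eq_zero.1 h] at hc
  | succ m ih =>
    by_cases hm : S.card = 1
    · obtain ⟨d, rfl⟩ := Finset.card_eq_one.1 hm
      rw [Finset.mem_singleton] at hc
      subst hc
      exact ⟨X, by rw [mul_inv_cancel]; exact Subgroup.one_mem _, hX⟩
    · obtain ⟨d, hd, hdc⟩ := Finset.exists_mem_ne (s := S) (by omega) c
      obtain ⟨Y, hY1, hY2⟩ := exists_supportedOn_erase (hτ := hτ) hX (by omega) hd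
      obtain ⟨Z, hZ1, hZ2⟩ := ih (S.erase d) (Finset.mem_erase.2 ⟨hdc.symm, hc⟩) Y hY2
        (by rw [Finset.card_erase_of_mem hd]; omega)
      exact ⟨Z, by have := Subgroup.mul_mem _ hZ1 hY1; rwa [mul_assoc, inv_mul_cancel_left] at this,
        hZ2⟩

lemma mem_of_equiv {X Y : SU τ n k} (h : Y * X⁻¹ ∈ elemSubgroup τ n hτ k)
    (hY : Y ∈ elemSubgroup τ n hτ k) : X ∈ elemSubgroup τ n hτ k := by
  have := Subgroup.mul_mem _ (Subgroup.inv_mem _ h) hY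
  rwa [mul_inv_rev, inv_inv, mul_assoc, inv_mul_cancel, mul_one] at this

/-- Here `y = 1/a`, and the hypothesis says that `c/a` is invariant. It is supplied by the isotropy
of a column, and allows the use of `c/a` as the argument of a long root element. -/
lemma conj_div_eq {a c y : k ⊗[k] L} (hy : a * y = 1) (h : conj τ k c * a = conj τ k a * c) :
    conj τ k (c * y) = c * y := by
  have h1 : conj τ k a * conj τ k y = 1 := by rw [← map_mul, hy, map_one]
  rw [map_mul]
  linear_combination (y * conj τ k y) * h - conj τ k c * conj τ k y * hy + c * y * h1

lemma mem_of_col {c : Fin n} {X : SU τ n k} (hX : SupportedOn {c} X)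
    (h1 : X.1.1 (c, 0) (c, 0) = 1) : X ∈ elemSubgroup τ n hτ k := by
  have hc := Finset.mem_singleton_self c
  obtain ⟨Y, hY1, hY2, -⟩ := exists_clear (hτ := hτ) hX (r := (c, 0)) (j := (c, 0)) hc hc h1
  obtain ⟨Z, hZ1, hZ2⟩ := exists_split (hτ := hτ) (hY1.2 hX) (p := (c, 0)) hc hY2
  refine mem_of_equiv hY1.1 (mem_of_equiv hZ1 ?_)
  have : Z = 1 := SU.ext' (by ext a b; exact hZ2 a b (Or.inl (by simp)))
  rw [this]
  exact Subgroup.one_mem _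

/-- The diagonal entries satisfy `a d = 1` by the determinant and `conj a * d = 1` by the form, so
both are invariant and long root elements can reduce the matrix. -/
lemma mem_of_diagonal {c : Fin n} {X : SU τ n k} (hX : SupportedOn {c} X)
    (h1 : X.1.1 (c, 1) (c, 0) = 0) (h2 : X.1.1 (c, 0) (c, 1) = 0) :
    X ∈ elemSubgroup τ n hτ k := by
  have hoff : ∀ a b : Idx n, a.1 ≠ c → b.1 = c → X.1.1 a b = 0 := fun a b ha hb => by
    rw [hX a b (Or.inl (by simpa using ha)), Matrix.one_apply_ne]
    rintro rfl; exact ha hb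
  have hdiag : X.1.1 = Matrix.diagonal fun a => X.1.1 a a := by
    ext a b
    rcases eq_or_ne a b with rfl | hab
    · simp
    · rw [Matrix.diagonal_apply_ne _ hab]
      obtain ⟨a, s⟩ := a
      obtain ⟨b, t⟩ := b
      by_cases ha : a = c
      · by_cases hb : b = c
        · subst ha; subst hb
          obtain rfl | rfl : s = 0 ∨ s = 1 := by omega
          all_goals obtain rfl | rfl : t = 0 ∨ t = 1 := by omega
          · exact absurd rfl hab
          · exact h2
          · exact h1
          · exact absurd rfl hab
        · rw [hX _ _ (Or.inr (by simpa using hb)), Matrix.one_apply_ne hab]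
      · rw [hX _ _ (Or.inl (by simpa using ha)), Matrix.one_apply_ne hab]
  have hdet : X.1.1 (c, 0) (c, 0) * X.1.1 (c, 1) (c, 1) = 1 := by
    have h3 := X.1.2
    rw [hdiag, Matrix.det_diagonal, Fintype.prod_prod_type, Finset.prod_eq_single c] at h3
    · simpa using h3
    · intro b _ hb
      rw [Fin.prod_univ_two, hX _ _ (Or.inl (by simpa using hb)),
        hX _ _ (Or.inl (by simpa using hb))]
      simp
    · simp
  have hform := form_apply_of_plane X (c := c) (i := (c, 0)) (j := (c, 1))
    fun a ha => hoff a _ ha rfl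
  rw [h2, mul_zero, zero_sub, opp_zero, if_pos rfl, if_pos rfl, neg_inj] at hform
  set a := X.1.1 (c, 0) (c, 0) with ha
  set d := X.1.1 (c, 1) (c, 1)
  have hca : conj τ k a = a := by linear_combination a * hform - conj τ k a * hdet
  have hcd : conj τ k d = d := conj_div_eq (a := a) (c := 1) (y := d) hdet
    (by rw [map_one, hca, one_mul, mul_one]) |> fun h => by simpa using h
  have hc := Finset.mem_singleton_self c
  -- Adding `d` times the upper row to the lower one creates the entry `d a = 1` below `a`; then `1
  -- - a` times the lower row turns `a` into `1`.
  have e1 := elem_long_mul_apply hτ (c, 1) hcd X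
  have s1 := ElemEquiv.elem_mul (hτ := hτ) X (self_ne_opp (c, 1)) (S := {c}) hc hc
    ((2⁻¹ : k) • d)
  set Y := elemSU τ hτ (c, 1) (opp (c, 1)) ((2⁻¹ : k) • d) * X
  have e2 := elem_long_mul_apply hτ (c, 0) (x := 1 - a) (by rw [map_sub, map_one, hca]) Y
  have s2 := ElemEquiv.elem_mul (hτ := hτ) Y (self_ne_opp (c, 0)) (S := {c}) hc hc
    ((2⁻¹ : k) • (1 - a))
  refine mem_of_equiv (s1.trans s2).1 (mem_of_col ((s1.trans s2).2 hX) ?_)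
  rw [e2, if_pos rfl, opp_zero, e1, e1, if_neg (by simp), if_pos rfl, h1, opp_one, ← ha]
  linear_combination (1 - a) * hdet

lemma mem_of_supportedOn_singleton {c : Fin n} {X : SU τ n k} (hX : SupportedOn {c} X) :
    X ∈ elemSubgroup τ n hτ k := by
  have hc := Finset.mem_singleton_self c
  have hoff : ∀ {X : SU τ n k}, SupportedOn {c} X → ∀ b : Idx n, b.1 = c →
      ∀ a : Idx n, a.1 ≠ c → X.1.1 a b = 0 := fun {X} hX b hb a ha => by
    rw [hX a b (Or.inl (by simpa using ha)), Matrix.one_apply_ne]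
    rintro rfl; exact ha hb
  -- If this entry is zero, the one below it is not, and adding the lower row to the upper one
  -- repairs this.
  wlog ha : X.1.1 (c, 0) (c, 0) ≠ 0 generalizing X
  · rw [not_not] at ha
    have e := elem_long_mul_apply hτ (c, 0) (map_one _) X
    have s := ElemEquiv.elem_mul (hτ := hτ) X (self_ne_opp (c, 0)) (S := {c}) hc hc
      ((2⁻¹ : k) • 1)
    refine mem_of_equiv s.1 (this (s.2 hX) ?_)
    rw [e, if_pos rfl, ha, zero_add, one_mul, opp_zero]
    intro h0
    obtain ⟨⟨b, t⟩, hq, hne⟩ := exists_apply_ne_zero hX (j := (c, 0)) hc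
    rw [Finset.mem_singleton] at hq
    simp only at hq
    subst hq
    obtain rfl | rfl : t = 0 ∨ t = 1 := by omega
    · exact hne ha
    · exact hne h0
  obtain ⟨y, hy⟩ := exists_mul_eq_one ha
  have hf := form_apply_of_plane X (hoff hX (c, 0) rfl) (i := (c, 0))
  rw [if_neg (self_ne_opp _), sub_eq_zero] at hf
  have hx : conj τ k (-(X.1.1 (c, 1) (c, 0) * y)) = -(X.1.1 (c, 1) (c, 0) * y) := by
    rw [map_neg, conj_div_eq hy hf]
  have e1 := elem_long_mul_apply hτ (c, 1) hx X
  have s1 := ElemEquiv.elem_mul (hτ := hτ) X (self_ne_opp (c, 1)) (S := {c}) hc hc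
    ((2⁻¹ : k) • (-(X.1.1 (c, 1) (c, 0) * y)))
  generalize elemSU τ hτ (c, 1) (opp (c, 1)) ((2⁻¹ : k) • (-(X.1.1 (c, 1) (c, 0) * y))) * X = Y
    at e1 s1
  refine mem_of_equiv s1.1 ?_
  have hY := s1.2 hX
  have hY1 : Y.1.1 (c, 1) (c, 0) = 0 := by
    rw [e1, if_pos rfl, opp_one]
    linear_combination -X.1.1 (c, 1) (c, 0) * hy
  have hf1 := form_apply_of_plane Y (hoff hY (c, 1) rfl) (i := (c, 0))
  rw [hY1, map_zero, zero_mul, zero_sub, opp_zero, if_pos rfl, if_pos rfl, neg_inj, mul_comm] at hf1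
  have hf2 := form_apply_of_plane Y (hoff hY (c, 1) rfl) (i := (c, 1))
  rw [if_neg (self_ne_opp _), sub_eq_zero] at hf2
  -- By `hf1` the conjugate of the upper left entry is the inverse of the lower right one, so this
  -- multiplier clears the upper right entry.
  have hx2 : conj τ k (-(Y.1.1 (c, 0) (c, 1) * conj τ k (Y.1.1 (c, 0) (c, 0))))
      = -(Y.1.1 (c, 0) (c, 1) * conj τ k (Y.1.1 (c, 0) (c, 0))) := by
    rw [map_neg, conj_div_eq hf1 hf2.symm]
  have e2 := elem_long_mul_apply hτ (c, 0) hx2 Y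
  have s2 := ElemEquiv.elem_mul (hτ := hτ) Y (self_ne_opp (c, 0)) (S := {c}) hc hc
    ((2⁻¹ : k) • (-(Y.1.1 (c, 0) (c, 1) * conj τ k (Y.1.1 (c, 0) (c, 0)))))
  refine mem_of_equiv s2.1 (mem_of_diagonal (s2.2 hY) ?_ ?_)
  · rw [e2, if_neg (by simp), hY1, add_zero]
  · rw [e2, if_pos rfl, opp_zero]
    linear_combination -Y.1.1 (c, 0) (c, 1) * hf1

/-- `SU_{2n}(k)` is generated by its root subgroups. -/
lemma elemSubgroup_eq_top (hn : 0 < n) : elemSubgroup τ n hτ k = ⊤ := by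
  refine eq_top_iff.2 fun X _ => ?_
  obtain ⟨Y, hY1, hY2⟩ := exists_supportedOn_singleton (hτ := hτ) ⟨0, hn⟩ Finset.univ
    (Finset.mem_univ _) X fun a b h => by simp at h
  exact mem_of_equiv hY1 (mem_of_supportedOn_singleton hY2)

lemma steinbergProj_surjective (hτ : τ ≠ AlgEquiv.refl) (hn : 0 < n) :
    Function.Surjective (steinbergProj τ n k) := by
  rw [← MonoidHom.range_eq_top, eq_top_iff, ← elemSubgroup_eq_top (hτ := hτ) hn, elemSubgroup,
    Subgroup.closure_le]
  rintro _ ⟨p, q, x, hpq, rfl⟩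
  obtain ⟨γ, -, hz⟩ := exists_root_arg (τ := τ) (R := k) hpq
  obtain ⟨z, hz⟩ := hz x
  refine ⟨steinbergGen τ γ (rootArg hτ z γ), ?_⟩
  rw [← (elemSU_isElemSystem hτ).atRoot_eq hτ hpq hz, atRoot, ← rootElt_eq hτ, steinbergProj,
    Steinberg.lift, steinbergGen, PresentedGroup.toGroup.of]

end Generation

/-! ### Images of polynomial maps. -/

section Chevalley

open MvPolynomial

variable {K : Type*} [Field K]

/-- The image of a polynomial map between affine spaces contains a non-empty open subset of its
closure. -/
theorem exists_nonvanishing_subset_image [IsAlgClosed K] {σ ι : Type*} [Finite σ] [Finite ι]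
    (φ : MvPolynomial σ K →ₐ[K] MvPolynomial ι K) :
    ∃ b : MvPolynomial σ K, φ b ≠ 0 ∧ ∀ y : σ → K, (∀ p, φ p = 0 → eval y p = 0) → eval y b ≠ 0 →
      ∃ t : ι → K, ∀ s, eval t (φ (X s)) = y s := by
  have hfin : φ.toRingHom.FinitePresentation := by
    rw [← RingHom.FinitePresentation.of_finiteType]
    refine RingHom.FiniteType.of_comp_finiteType (f := C) ?_
    have : φ.toRingHom.comp C = C := by ext; simp
    rw [this]
    exact RingHom.finiteType_algebraMap.2 (inferInstance : Algebra.FiniteType K (MvPolynomial ι K))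
  obtain ⟨D, hD⟩ := PrimeSpectrum.exists_constructibleSetData_iff.2
    (PrimeSpectrum.isConstructible_range_comap hfin)
  -- The image of the generic point lies in one of the basic constructible pieces. The equations of
  -- this piece lie in the kernel of `φ`, its inequality `E.f` does not, so `E.f` can serve as `b`.
  have h0 : PrimeSpectrum.comap φ.toRingHom ⟨⊥, Ideal.isPrime_bot⟩
      ∈ Set.range (PrimeSpectrum.comap φ.toRingHom) := ⟨_, rfl⟩
  rw [← hD, PrimeSpectrum.ConstructibleSetData.toSet, Set.mem_iUnion₂] at h0
  obtain ⟨E, hE, hE0⟩ := h0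
  rw [PrimeSpectrum.BasicConstructibleSetData.toSet, Set.mem_sdiff, PrimeSpectrum.mem_zeroLocus,
    PrimeSpectrum.mem_zeroLocus, Set.singleton_subset_iff] at hE0
  refine ⟨E.f, fun h => hE0.2 ?_, fun y hy hyf => ?_⟩
  · change φ E.f ∈ (⊥ : Ideal _)
    rw [h]; exact Ideal.zero_mem _
  let Y : PrimeSpectrum (MvPolynomial σ K) := ⟨RingHom.ker (eval y), RingHom.ker_isPrime _⟩
  have hY : Y ∈ Set.range (PrimeSpectrum.comap φ.toRingHom) := by
    rw [← hD, PrimeSpectrum.ConstructibleSetData.toSet, Set.mem_iUnion₂]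
    refine ⟨E, hE, fun p hp => ?_, fun h => ?_⟩
    · have h1 : φ p ∈ (⊥ : Ideal _) := hE0.1 hp
      exact hy p h1
    · exact hyf (h rfl)
  obtain ⟨Q, hQ⟩ := hY
  -- A maximal ideal above `Q` is a point `t` by the Nullstellensatz, and it still contains the
  -- images of the `X s - y s`.
  obtain ⟨M, hM, hQM⟩ := Ideal.exists_le_maximal Q.asIdeal Q.isPrime.ne_top
  obtain ⟨t, rfl⟩ := isMaximal_iff_eq_vanishingIdeal_singleton.1 hM
  refine ⟨t, fun s => ?_⟩
  have h1 : (X s - C (y s) : MvPolynomial σ K) ∈ Y.asIdeal := by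
    change eval y _ = 0; simp
  rw [← hQ] at h1
  have h2 := hQM (show φ (X s - C (y s)) ∈ Q.asIdeal from h1)
  rw [mem_vanishingIdeal_singleton_iff] at h2
  have h3 : φ (C (y s)) = C (y s) := φ.commutes (y s)
  rw [map_sub, h3] at h2
  simpa [sub_eq_zero] using h2

end Chevalley

/-! ### Groups generated by images of affine spaces. -/

section ClosedImage

open MvPolynomial

variable {K : Type*} [Field K] {m : ℕ}

/-- The coordinates on `GL_m`. -/
abbrev GLCoord (m : ℕ) : Type := (Fin m × Fin m) ⊕ (Fin m × Fin m)

/-- The coordinates of an element of `GL_m`: the entries of the matrix and of its inverse. -/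
def glCoord (g : Matrix.GeneralLinearGroup (Fin m) K) : GLCoord m → K :=
  Sum.elim (fun i => g.1 i.1 i.2) (fun i => (g⁻¹).1 i.1 i.2)

lemma glCoord_injective : Function.Injective (glCoord (K := K) (m := m)) := by
  intro g h hgh
  refine Units.ext ?_
  ext i j
  exact congrFun hgh (Sum.inl (i, j))

lemma mem_glFunctions_iff (F : Matrix.GeneralLinearGroup (Fin m) K → K) :
    F ∈ glFunctions K m ↔ ∃ p : MvPolynomial (GLCoord m) K, ∀ g, F g = eval (glCoord g) p := by
  constructor
  · intro hF
    induction hF using Algebra.adjoin_induction with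
    | mem F hF =>
      rcases hF with ⟨i, j, rfl⟩ | ⟨i, j, rfl⟩
      · exact ⟨X (Sum.inl (i, j)), fun g => by simp [glCoord]⟩
      · exact ⟨X (Sum.inr (i, j)), fun g => by simp [glCoord]⟩
    | algebraMap c => exact ⟨C c, fun g => by simp⟩
    | add F G _ _ hF hG =>
      obtain ⟨p, hp⟩ := hF
      obtain ⟨q, hq⟩ := hG
      exact ⟨p + q, fun g => by simp [hp, hq]⟩
    | mul F G _ _ hF hG =>
      obtain ⟨p, hp⟩ := hF
      obtain ⟨q, hq⟩ := hG
      exact ⟨p * q, fun g => by simp [hp, hq]⟩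
  · rintro ⟨p, hp⟩
    have : F = fun g => eval (glCoord g) p := funext hp
    rw [this]
    clear hp this
    induction p using MvPolynomial.induction_on with
    | C c =>
      simp only [eval_C]
      exact (glFunctions K m).algebraMap_mem c
    | add p q hp hq =>
      simp only [map_add]
      exact (glFunctions K m).add_mem hp hq
    | mul_X p s hp =>
      simp only [map_mul, eval_X]
      refine (glFunctions K m).mul_mem hp ?_
      rcases s with ⟨i, j⟩ | ⟨i, j⟩
      · exact entry_mem i j
      · exact inv_entry_mem i j

/-- Polynomial maps from affine space to `GL_m`. -/
def IsPolyMap {ι : Type*} (ψ : (ι → K) → Matrix.GeneralLinearGroup (Fin m) K) : Prop :=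
  ∀ s, ∃ p : MvPolynomial ι K, ∀ t, glCoord (ψ t) s = eval t p

lemma IsPolyMap.exists_algHom {ι : Type*} {ψ : (ι → K) → Matrix.GeneralLinearGroup (Fin m) K}
    (h : IsPolyMap ψ) : ∃ φ : MvPolynomial (GLCoord m) K →ₐ[K] MvPolynomial ι K,
      ∀ p t, eval t (φ p) = eval (glCoord (ψ t)) p := by
  choose p hp using h
  refine ⟨aeval p, fun q t => ?_⟩
  have : (eval t).comp (aeval p : MvPolynomial (GLCoord m) K →ₐ[K] MvPolynomial ι K).toRingHom
      = eval (glCoord (ψ t)) := by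
    ext s
    · simp
    · simp [hp]
  exact RingHom.congr_fun this q

/-- Subsets of `GL_m` that are images of affine spaces under polynomial maps. -/
def IsPolyImage (I : Set (Matrix.GeneralLinearGroup (Fin m) K)) : Prop :=
  ∃ (d : ℕ) (ψ : (Fin d → K) → Matrix.GeneralLinearGroup (Fin m) K), IsPolyMap ψ ∧ Set.range ψ = I

open scoped Pointwise

lemma IsPolyImage.mul {I J : Set (Matrix.GeneralLinearGroup (Fin m) K)} (hI : IsPolyImage I)
    (hJ : IsPolyImage J) : IsPolyImage (I * J) := by
  obtain ⟨d, ψ, hψ, rfl⟩ := hI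
  obtain ⟨e, χ, hχ, rfl⟩ := hJ
  choose p hp using hψ
  choose q hq using hχ
  refine ⟨d + e, fun t => ψ (t ∘ Fin.castAdd e) * χ (t ∘ Fin.natAdd d), ?_, ?_⟩
  · rintro (⟨i, j⟩ | ⟨i, j⟩)
    · refine ⟨∑ l, rename (Fin.castAdd e) (p (Sum.inl (i, l)))
        * rename (Fin.natAdd d) (q (Sum.inl (l, j))), fun t => ?_⟩
      simp only [map_sum, map_mul, eval_rename, ← hp, ← hq]
      simp [glCoord, Matrix.mul_apply]
    · refine ⟨∑ l, rename (Fin.natAdd d) (q (Sum.inr (i, l)))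
        * rename (Fin.castAdd e) (p (Sum.inr (l, j))), fun t => ?_⟩
      simp only [map_sum, map_mul, eval_rename, ← hp, ← hq]
      simp only [glCoord, Sum.elim_inr, mul_inv_rev, Units.val_mul, Matrix.mul_apply]
  · ext g
    constructor
    · rintro ⟨t, rfl⟩
      exact Set.mul_mem_mul ⟨_, rfl⟩ ⟨_, rfl⟩
    · rintro ⟨_, ⟨s, rfl⟩, _, ⟨t, rfl⟩, rfl⟩
      refine ⟨Fin.append s t, ?_⟩
      have h1 : Fin.append s t ∘ Fin.castAdd e = s := funext fun i => by simp
      have h2 : Fin.append s t ∘ Fin.natAdd d = t := funext fun i => by simp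
      simp only [h1, h2]

lemma IsPolyImage.inv {I : Set (Matrix.GeneralLinearGroup (Fin m) K)} (hI : IsPolyImage I) :
    IsPolyImage I⁻¹ := by
  obtain ⟨d, ψ, hψ, rfl⟩ := hI
  refine ⟨d, fun t => (ψ t)⁻¹, ?_, ?_⟩
  · rintro (s | s)
    · obtain ⟨p, hp⟩ := hψ (Sum.inr s)
      exact ⟨p, fun t => hp t⟩
    · obtain ⟨p, hp⟩ := hψ (Sum.inl s)
      exact ⟨p, fun t => by rw [← hp]; simp [glCoord]⟩
  · ext g
    simp [inv_eq_iff_eq_inv]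

/-- The ideal of the polynomials that vanish on a subset of `GL_m`. -/
def glIdeal (I : Set (Matrix.GeneralLinearGroup (Fin m) K)) : Ideal (MvPolynomial (GLCoord m) K) :=
  vanishingIdeal K (glCoord '' I)

lemma mem_glIdeal {I : Set (Matrix.GeneralLinearGroup (Fin m) K)}
    {p : MvPolynomial (GLCoord m) K} : p ∈ glIdeal I ↔ ∀ g ∈ I, eval (glCoord g) p = 0 := by
  rw [glIdeal, mem_vanishingIdeal_iff]
  simp [aeval_eq_eval]

lemma glIdeal_anti {I J : Set (Matrix.GeneralLinearGroup (Fin m) K)} (h : I ⊆ J) :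
    glIdeal J ≤ glIdeal I := fun p hp =>
  mem_glIdeal.2 fun g hg => mem_glIdeal.1 hp g (h hg)

lemma IsPolyMap.glIdeal_eq [Infinite K] {d : ℕ}
    {ψ : (Fin d → K) → Matrix.GeneralLinearGroup (Fin m) K}
    {φ : MvPolynomial (GLCoord m) K →ₐ[K] MvPolynomial (Fin d) K}
    (h : ∀ p t, eval t (φ p) = eval (glCoord (ψ t)) p) : glIdeal (Set.range ψ) = RingHom.ker φ := by
  ext p
  rw [mem_glIdeal, RingHom.mem_ker, Set.forall_mem_range]
  simp only [← h]
  exact ⟨fun hp => MvPolynomial.funext fun t => by rw [hp, map_zero], fun hp t => by rw [hp, map_zero]⟩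

/-- Over an infinite field a polynomial that vanishes everywhere is zero, so the ideal is the kernel
of a homomorphism to a polynomial ring, which is a domain. -/
lemma IsPolyImage.isPrime [Infinite K] {I : Set (Matrix.GeneralLinearGroup (Fin m) K)}
    (hI : IsPolyImage I) : (glIdeal I).IsPrime := by
  obtain ⟨d, ψ, hψ, rfl⟩ := hI
  obtain ⟨φ, hφ⟩ := hψ.exists_algHom
  rw [IsPolyMap.glIdeal_eq hφ]
  exact RingHom.ker_isPrime _

lemma isTopologicalBasis_zariski {X : Type*} (𝒪 : Subalgebra K (X → K)) :
    @TopologicalSpace.IsTopologicalBasis X (zariski 𝒪) {U | ∃ F ∈ 𝒪, U = {x | F x ≠ 0}} := by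
  let _ := zariski 𝒪
  refine ⟨?_, ?_, rfl⟩
  · rintro _ ⟨F, hF, rfl⟩ _ ⟨G, hG, rfl⟩ x hx
    refine ⟨_, ⟨F * G, 𝒪.mul_mem hF hG, rfl⟩, ?_, ?_⟩
    · exact mul_ne_zero hx.1 hx.2
    · intro y hy
      exact ⟨left_ne_zero_of_mul hy, right_ne_zero_of_mul hy⟩
  · refine Set.eq_univ_of_univ_subset ?_
    exact Set.subset_sUnion_of_mem ⟨1, 𝒪.one_mem, by simp⟩

lemma eval_eq_zero_of_mem_closure {S : Set (Matrix.GeneralLinearGroup (Fin m) K)}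
    {p : MvPolynomial (GLCoord m) K} (hp : p ∈ glIdeal S)
    {g : Matrix.GeneralLinearGroup (Fin m) K} (hg : g ∈ @closure _ (zariski (glFunctions K m)) S) :
    eval (glCoord g) p = 0 := by
  let _ := zariski (glFunctions K m)
  by_contra h
  have hF : (fun g => eval (glCoord g) p) ∈ glFunctions K m :=
    (mem_glFunctions_iff _).2 ⟨p, fun _ => rfl⟩
  obtain ⟨x, hx, hxS⟩ := mem_closure_iff.1 hg _
    ((isTopologicalBasis_zariski (glFunctions K m)).isOpen ⟨_, hF, rfl⟩) h
  exact hx (mem_glIdeal.1 hp x hxS)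

lemma isIrreducible_of_glIdeal_isPrime {S : Set (Matrix.GeneralLinearGroup (Fin m) K)}
    (hS : (glIdeal S).IsPrime) : @IsIrreducible _ (zariski (glFunctions K m)) S := by
  let _ := zariski (glFunctions K m)
  have hB := isTopologicalBasis_zariski (glFunctions K m)
  constructor
  · by_contra h
    rw [Set.not_nonempty_iff_eq_empty] at h
    exact hS.ne_top (by rw [Ideal.eq_top_iff_one, mem_glIdeal, h]; simp)
  · rintro U V hU hV ⟨x, hxS, hxU⟩ ⟨y, hyS, hyV⟩
    obtain ⟨_, ⟨F, hF, rfl⟩, hxF, hFU⟩ := hB.exists_subset_of_mem_open hxU hU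
    obtain ⟨_, ⟨G, hG, rfl⟩, hyG, hGV⟩ := hB.exists_subset_of_mem_open hyV hV
    obtain ⟨p, hp⟩ := (mem_glFunctions_iff _).1 hF
    obtain ⟨q, hq⟩ := (mem_glFunctions_iff _).1 hG
    have h1 : p ∉ glIdeal S := fun h => hxF (by rw [hp]; exact mem_glIdeal.1 h x hxS)
    have h2 : q ∉ glIdeal S := fun h => hyG (by rw [hq]; exact mem_glIdeal.1 h y hyS)
    have h3 : p * q ∉ glIdeal S := fun h => (hS.mem_or_mem h).elim h1 h2
    rw [mem_glIdeal] at h3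
    push Not at h3
    obtain ⟨z, hz, hzpq⟩ := h3
    rw [map_mul] at hzpq
    refine ⟨z, hz, hFU ?_, hGV ?_⟩
    · change F z ≠ 0
      rw [hp]; exact left_ne_zero_of_mul hzpq
    · change G z ≠ 0
      rw [hq]; exact right_ne_zero_of_mul hzpq

/-- A subgroup of `GL_m` that is generated by images of affine spaces through `1` is exhausted by
such images. -/
lemma exists_polyImage_of_mem_closure {S : Set (Set (Matrix.GeneralLinearGroup (Fin m) K))}
    (hS : ∀ I ∈ S, IsPolyImage I ∧ 1 ∈ I) {g : Matrix.GeneralLinearGroup (Fin m) K}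
    (hg : g ∈ Subgroup.closure (⋃₀ S)) :
    ∃ I, IsPolyImage I ∧ 1 ∈ I ∧ I ⊆ Subgroup.closure (⋃₀ S) ∧ g ∈ I := by
  induction hg using Subgroup.closure_induction with
  | mem g hg =>
    obtain ⟨I, hI, hgI⟩ := hg
    exact ⟨I, (hS I hI).1, (hS I hI).2,
      (Set.subset_sUnion_of_mem hI).trans Subgroup.subset_closure, hgI⟩
  | one =>
    refine ⟨{1}, ⟨0, fun _ => 1, fun s => ⟨C (glCoord 1 s), fun t => by simp⟩, by simp⟩, rfl, ?_, rfl⟩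
    simp [Subgroup.one_mem]
  | mul g h _ _ hg hh =>
    obtain ⟨I, hI, hI1, hIS, hgI⟩ := hg
    obtain ⟨J, hJ, hJ1, hJS, hhJ⟩ := hh
    refine ⟨I * J, hI.mul hJ, ⟨1, hI1, 1, hJ1, mul_one 1⟩, ?_, Set.mul_mem_mul hgI hhJ⟩
    rintro _ ⟨x, hx, y, hy, rfl⟩
    exact Subgroup.mul_mem _ (hIS hx) (hJS hy)
  | inv g _ hg =>
    obtain ⟨I, hI, hI1, hIS, hgI⟩ := hg
    refine ⟨I⁻¹, hI.inv, by simpa using hI1, fun x hx => ?_, by simpa using hgI⟩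
    have := Subgroup.inv_mem _ (hIS hx)
    simpa using this

lemma le_zariskiClosure (Γ : Subgroup (Matrix.GeneralLinearGroup (Fin m) K)) :
    Γ ≤ zariskiClosure Γ :=
  let _ := zariski (glFunctions K m)
  fun _ hg => subset_closure hg

/-- A subgroup of `GL_m` that is generated by images of affine spaces through `1` is closed and
irreducible. -/
theorem closed_and_irreducible_of_generated [IsAlgClosed K]
    {S : Set (Set (Matrix.GeneralLinearGroup (Fin m) K))} (hS : ∀ I ∈ S, IsPolyImage I ∧ 1 ∈ I) :
    zariskiClosure (Subgroup.closure (⋃₀ S)) = Subgroup.closure (⋃₀ S) ∧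
      @IsIrreducible _ (zariski (glFunctions K m))
        (Subgroup.closure (⋃₀ S) : Set (Matrix.GeneralLinearGroup (Fin m) K)) := by
  have : Infinite K := IsAlgClosed.instInfinite
  set Γ := Subgroup.closure (⋃₀ S) with hΓ
  let 𝓘 : Set (Set (Matrix.GeneralLinearGroup (Fin m) K)) :=
    {I | IsPolyImage I ∧ 1 ∈ I ∧ I ⊆ Γ}
  obtain ⟨I₀, hI₀, hI₀1, hI₀Γ, -⟩ := exists_polyImage_of_mem_closure hS (Subgroup.one_mem Γ)
  -- Minimal height of the ideal means maximal dimension of the closure. Multiplying by a further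
  -- image `J` cannot enlarge the closure of `I`, so `I` is dense in `Γ`.
  obtain ⟨I, ⟨hI, hI1, hIΓ⟩, hmin⟩ := exists_minimalFor_of_wellFoundedLT
    (fun I => I ∈ 𝓘) (fun I => (glIdeal I).height) ⟨I₀, hI₀, hI₀1, hI₀Γ⟩
  have hprime := hI.isPrime
  have hsub : glIdeal I ≤ glIdeal (Γ : Set (Matrix.GeneralLinearGroup (Fin m) K)) := by
    intro p hp
    rw [mem_glIdeal]
    intro g hg
    obtain ⟨J, hJ, hJ1, hJΓ, hgJ⟩ := exists_polyImage_of_mem_closure hS hg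
    have hIJ : I ⊆ I * J := fun x hx => ⟨x, hx, 1, hJ1, mul_one x⟩
    have hJI : J ⊆ I * J := fun x hx => ⟨1, hI1, x, hx, one_mul x⟩
    have hmem : I * J ∈ 𝓘 := by
      refine ⟨hI.mul hJ, hIJ hI1, ?_⟩
      rintro _ ⟨x, hx, y, hy, rfl⟩
      exact Subgroup.mul_mem _ (hIΓ hx) (hJΓ hy)
    have heq : glIdeal (I * J) = glIdeal I := by
      by_contra hne
      have hlt : glIdeal (I * J) < glIdeal I := lt_of_le_of_ne (glIdeal_anti hIJ) hne
      have hprime' := (hI.mul hJ).isPrime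
      have h1 := Ideal.height_strict_mono_of_isPrime_of_isPrime hlt
      have h2 := hmin hmem h1.le
      exact absurd h1 (not_lt.2 h2)
    rw [← heq] at hp
    exact mem_glIdeal.1 hp g (hJI hgJ)
  have hΓI : glIdeal (Γ : Set (Matrix.GeneralLinearGroup (Fin m) K)) = glIdeal I :=
    le_antisymm (glIdeal_anti hIΓ) hsub
  refine ⟨le_antisymm ?_ ?_, isIrreducible_of_glIdeal_isPrime (hΓI ▸ hprime)⟩
  · obtain ⟨d, ψ, hψ, rfl⟩ := hI
    obtain ⟨φ, hφ⟩ := hψ.exists_algHom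
    have hker := IsPolyMap.glIdeal_eq hφ
    obtain ⟨b, hb, hopen⟩ := exists_nonvanishing_subset_image φ
    have hopen' : ∀ g ∈ zariskiClosure Γ, eval (glCoord g) b ≠ 0 → g ∈ Γ := by
      intro g hg hgb
      obtain ⟨t, ht⟩ := hopen (glCoord g) (fun p hp => eval_eq_zero_of_mem_closure
        (hsub (hker ▸ hp)) hg) hgb
      have : g = ψ t := glCoord_injective (funext fun s => by rw [← ht, hφ, eval_X])
      rw [this]
      exact hIΓ ⟨t, rfl⟩
    intro h hh
    -- Let `c` be the function `g ↦ b(g⁻¹ h)`. If it vanished on `I`, it would vanish on the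
    -- closure, in particular at `h g₀⁻¹`, where its value is `b(g₀) ≠ 0`. So some `g` in `I` has
    -- `b(g⁻¹ h) ≠ 0`, and `h = g (g⁻¹ h)` is a product of two elements of `Γ`.
    obtain ⟨c, hc⟩ := (mem_glFunctions_iff _).1 (isRegularMap_inv _ (isRegularMap_mul_right h _
      ((mem_glFunctions_iff _).2 ⟨b, fun g => rfl⟩)))
    have hbI : b ∉ glIdeal (Set.range ψ) := by rw [hker]; exact hb
    have hcI : c ∉ glIdeal (Set.range ψ) := by
      intro hc0
      obtain ⟨g₀, hg₀, hg₀b⟩ : ∃ g ∈ Set.range ψ, eval (glCoord g) b ≠ 0 := by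
        by_contra! h; exact hbI (mem_glIdeal.2 h)
      have h1 : h * g₀⁻¹ ∈ zariskiClosure Γ :=
        Subgroup.mul_mem _ hh (Subgroup.inv_mem _ (le_zariskiClosure Γ (hIΓ hg₀)))
      have h2 := eval_eq_zero_of_mem_closure (hsub hc0) h1
      rw [← hc] at h2
      simp at h2
      exact hg₀b h2
    have hbc : b * c ∉ glIdeal (Set.range ψ) := fun h => (hprime.mem_or_mem h).elim hbI hcI
    rw [mem_glIdeal] at hbc
    push Not at hbc
    obtain ⟨g, hg, hgbc⟩ := hbc
    rw [map_mul, ← hc] at hgbc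
    have h3 : g⁻¹ * h ∈ Γ := hopen' _ (Subgroup.mul_mem _ (Subgroup.inv_mem _
      (le_zariskiClosure Γ (hIΓ hg))) hh) (right_ne_zero_of_mul hgbc)
    have h4 := Subgroup.mul_mem _ (hIΓ hg) h3
    rwa [mul_inv_cancel_left] at h4
  · exact le_zariskiClosure Γ

end ClosedImage

/-! ### Regular functions on modules, and density. -/

section Affine

open MvPolynomial

variable {K : Type*} [Field K] {A M : Type*} [CommRing A] [Algebra K A] [AddCommGroup M]
  [Module A M]

lemma polyFunctions_comp_sum {ι : Type*} [Fintype ι] (b : ι → M) {F : M → K}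
    (hF : F ∈ polyFunctions K A M) :
    ∃ p : MvPolynomial ι K, ∀ t : ι → K, F (∑ i, algebraMap K A (t i) • b i) = eval t p := by
  induction hF using Algebra.adjoin_induction with
  | mem F hF =>
    obtain ⟨hadd, hsmul⟩ := hF
    refine ⟨∑ i, C (F (b i)) * X i, fun t => ?_⟩
    have h := map_sum (AddMonoidHom.mk' F hadd) (fun i => algebraMap K A (t i) • b i) Finset.univ
    simp only [AddMonoidHom.mk'_apply] at h
    simp [h, hsmul, mul_comm]
  | algebraMap c => exact ⟨C c, fun t => by simp⟩
  | add F G _ _ hF hG =>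
    obtain ⟨p, hp⟩ := hF
    obtain ⟨q, hq⟩ := hG
    exact ⟨p + q, fun t => by simp [hp, hq]⟩
  | mul F G _ _ hF hG =>
    obtain ⟨p, hp⟩ := hF
    obtain ⟨q, hq⟩ := hG
    exact ⟨p * q, fun t => by simp [hp, hq]⟩

variable (K A M) in
lemma exists_sum_algebraMap_smul [Module.Finite K A] [Module.Finite A M] :
    ∃ (d : ℕ) (b : Fin d → M), ∀ x, ∃ t : Fin d → K, ∑ i, algebraMap K A (t i) • b i = x := by
  let _ : Module K M := Module.compHom M (algebraMap K A)
  have : IsScalarTower K A M := ⟨fun c a x => by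
    rw [Algebra.smul_def, mul_smul]; rfl⟩
  have : Module.Finite K M := Module.Finite.trans A M
  obtain ⟨d, b, hb⟩ := Module.Finite.exists_fin (R := K) (M := M)
  refine ⟨d, b, fun x => ?_⟩
  have hx : x ∈ Submodule.span K (Set.range b) := hb ▸ Submodule.mem_top
  obtain ⟨t, ht⟩ := (Submodule.mem_span_range_iff_exists_fun K).1 hx
  exact ⟨t, ht⟩

lemma IsRegularMap.isPolyImage [Module.Finite K A] [Module.Finite A M] {m : ℕ}
    {ψ : M → Matrix.GeneralLinearGroup (Fin m) K}
    (hψ : IsRegularMap (polyFunctions K A M) (glFunctions K m) ψ) :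
    IsPolyImage (Set.range ψ) := by
  obtain ⟨d, b, hb⟩ := exists_sum_algebraMap_smul K A M
  refine ⟨d, fun t => ψ (∑ i, algebraMap K A (t i) • b i), ?_, ?_⟩
  · rintro (⟨i, j⟩ | ⟨i, j⟩)
    · exact polyFunctions_comp_sum b (hψ _ (entry_mem i j))
    · exact polyFunctions_comp_sum b (hψ _ (inv_entry_mem i j))
  · ext g
    constructor
    · rintro ⟨t, rfl⟩
      exact ⟨_, rfl⟩
    · rintro ⟨x, rfl⟩
      obtain ⟨t, ht⟩ := hb x
      exact ⟨t, congrArg ψ ht⟩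

/-- A subgroup of an affine space in characteristic `0` that spans it is Zariski dense. -/
lemma dense_of_closure_smul_eq_top [CharZero K] (D : AddSubgroup M)
    (hD : AddSubmonoid.closure {x : M | ∃ c : K, ∃ d ∈ D, x = algebraMap K A c • d} = ⊤) :
    @Dense M (zariski (polyFunctions K A M)) D := by
  let _ := zariski (polyFunctions K A M)
  let _ : Module K M := Module.compHom M (algebraMap K A)
  refine (isTopologicalBasis_zariski (polyFunctions K A M)).dense_iff.2 ?_
  rintro _ ⟨F, hF, rfl⟩ ⟨x, hx⟩
  have hxD : x ∈ Submodule.span K (D : Set M) := by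
    have h1 : x ∈ AddSubmonoid.closure {x : M | ∃ c : K, ∃ d ∈ D, x = algebraMap K A c • d} :=
      hD ▸ AddSubmonoid.mem_top x
    refine AddSubmonoid.closure_le (S := (Submodule.span K (D : Set M)).toAddSubmonoid) |>.2 ?_ h1
    rintro _ ⟨c, d, hd, rfl⟩
    exact Submodule.smul_mem _ c (Submodule.subset_span hd)
  obtain ⟨e, c, d, hcd⟩ := Submodule.mem_span_set'.1 hxD
  obtain ⟨p, hp⟩ := polyFunctions_comp_sum (fun i => (d i : M)) hF
  have hpc : eval c p ≠ 0 := by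
    rw [← hp]
    exact fun h => hx ((congrArg F hcd).symm.trans h)
  -- In characteristic `0` a polynomial that vanishes at all integer points is zero. Integer
  -- combinations of the `d i` stay in `D`.
  obtain ⟨t, ht⟩ : ∃ t : Fin e → ℤ, eval (fun i => (t i : K)) p ≠ 0 := by
    by_contra! h
    refine hpc ?_
    have : p = 0 := by
      refine MvPolynomial.funext_set (fun _ => Set.range ((↑) : ℤ → K))
        (fun _ => Set.infinite_range_of_injective Int.cast_injective) ?_
      intro x hx
      choose t ht using fun i => hx i (Set.mem_univ i)
      obtain rfl : (fun i => (t i : K)) = x := funext ht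
      rw [h, map_zero]
    rw [this, map_zero]
  refine ⟨∑ i, algebraMap K A (t i) • (d i : M), ?_, ?_⟩
  · change F _ ≠ 0
    rwa [hp]
  · refine D.sum_mem fun i _ => ?_
    rw [map_intCast, Int.cast_smul_eq_zsmul]
    exact D.zsmul_mem (d i).2 _

end Affine

/-! ### Surjectivity of Steinberg lifts. -/

section Surjective

variable {k L : Type*} [Field k] [Field L] [Algebra k L] [Algebra.IsQuadraticExtension k L]
  {τ : L ≃ₐ[k] L} {n m : ℕ} {K : Type*} [Field K]

lemma closure_range_steinbergGen (R : Type*) [CommRing R] [Algebra k R] :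
    Subgroup.closure (⋃ α, Set.range (steinbergGen τ (n := n) (R := R) α)) = ⊤ := by
  rw [← PresentedGroup.closure_range_of (steinbergRels τ n R)]
  congr 1
  ext x
  simp only [Set.mem_iUnion, Set.mem_range]
  exact ⟨fun ⟨α, v, h⟩ => ⟨⟨α, v⟩, h⟩, fun ⟨⟨α, v⟩, h⟩ => ⟨α, v, h⟩⟩

lemma steinbergGen_zero {R : Type*} [CommRing R] [Algebra k R] (α : Root n) :
    steinbergGen τ (R := R) α 0 = 1 := by
  have h := steinbergGen_add τ α (0 : rootSpace k L R α) 0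
  rwa [add_zero, mul_eq_left] at h

instance finite_rootSpace (R : Type*) [CommRing R] [Algebra k R] (α : Root n) :
    Module.Finite R (rootSpace k L R α) := by
  have : Module.Finite k L := Module.finite_of_finrank_pos
    (by rw [Algebra.IsQuadraticExtension.finrank_eq_two k L]; norm_num)
  cases α
  · exact Module.Finite.range _
  · exact Module.Finite.range _
  all_goals
    exact Module.Finite.of_surjective (Submodule.topEquiv (R := R) (M := R ⊗[k] L)).symm.toLinearMap
      (LinearEquiv.surjective _)

/-- The homomorphism of a Steinberg lift is surjective, and the target is irreducible. -/
theorem IsSteinbergLift.surjective_and_irreducible [IsAlgClosed K] [CharZero k] (hτ : τ ≠ AlgEquiv.refl) (hn : 0 < n)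
    {ρ : SU τ n k →* Matrix.GeneralLinearGroup (Fin m) K} {A : Type*} [CommRing A] [Algebra K A]
    [Algebra k A] {ψ : ∀ α : Root n, rootSpace k L A α → imageClosure ρ}
    {σ : Steinberg τ n A →* imageClosure ρ} (h : IsSteinbergLift ρ A ψ σ) :
    Function.Surjective σ ∧ @IsIrreducible _ (zariski (glFunctions K m))
      (imageClosure ρ : Set (Matrix.GeneralLinearGroup (Fin m) K)) := by
  have := h.finite
  let S : Set (Set (Matrix.GeneralLinearGroup (Fin m) K)) :=
    Set.range fun α => Set.range fun v => (ψ α v : Matrix.GeneralLinearGroup (Fin m) K)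
  have hS : ∀ I ∈ S, IsPolyImage I ∧ 1 ∈ I := by
    rintro _ ⟨α, rfl⟩
    refine ⟨(h.regular α).isPolyImage, 0, ?_⟩
    simp only
    rw [← h.comp_gen, steinbergGen_zero, map_one, Subgroup.coe_one]
  obtain ⟨hcl, hirr⟩ := closed_and_irreducible_of_generated hS
  have hrange : Subgroup.closure (⋃₀ S) = ((imageClosure ρ).subtype.comp σ).range := by
    rw [MonoidHom.range_eq_map, ← closure_range_steinbergGen, MonoidHom.map_closure]
    congr 1
    ext g
    simp only [S, Set.sUnion_range, Set.mem_iUnion, Set.mem_range, Set.mem_image]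
    constructor
    · rintro ⟨α, v, rfl⟩
      exact ⟨_, ⟨α, v, rfl⟩, by simp [h.comp_gen]⟩
    · rintro ⟨_, ⟨α, v, rfl⟩, rfl⟩
      exact ⟨α, v, by simp [h.comp_gen]⟩
  -- Root subgroups generate `G(k)`, so every value of `ρ` is a value of `ρ ∘ π_k = σ̃ ∘ F̃`.
  have hle : ρ.range ≤ Subgroup.closure (⋃₀ S) := by
    rintro _ ⟨g, rfl⟩
    obtain ⟨x, rfl⟩ := steinbergProj_surjective (τ := τ) hτ hn g
    rw [hrange, ← h.comp_map]
    exact ⟨_, rfl⟩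
  have htop : imageClosure ρ ≤ Subgroup.closure (⋃₀ S) := by
    rw [← hcl]
    let _ := zariski (glFunctions K m)
    exact closure_mono hle
  have hle' : Subgroup.closure (⋃₀ S) ≤ imageClosure ρ := by
    rw [hrange]
    rintro _ ⟨x, rfl⟩
    exact (σ x).2
  refine ⟨fun g => ?_, ?_⟩
  · have hg := htop g.2
    rw [hrange] at hg
    obtain ⟨x, hx⟩ := hg
    exact ⟨x, Subtype.ext hx⟩
  · rw [le_antisymm htop hle']
    exact hirr

end Surjective

/-! ### Exponentials and logarithms in a `ℚ`-algebra. -/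

section NilpotentExp

open IsNilpotent Finset

variable {B : Type*} [Ring B] [Algebra ℚ B]

/-- The remainder `c` is a polynomial in `a`; this gives the commutation needed later. -/
lemma exp_eq_of_pow_eq_zero {a : B} {r : ℕ} (h : a ^ r = 0) :
    ∃ c ∈ Algebra.adjoin ℚ {a}, exp a = 1 + a + a ^ 2 * c := by
  have ha : a ∈ Algebra.adjoin ℚ {a} := Algebra.self_mem_adjoin_singleton ℚ a
  refine ⟨∑ i ∈ range r, ((i + 2).factorial : ℚ)⁻¹ • a ^ i, Subalgebra.sum_mem _ fun i _ =>
    Subalgebra.smul_mem _ (Subalgebra.pow_mem _ ha _) _, ?_⟩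
  have h' : a ^ (r + 2) = 0 := by rw [pow_add, h, zero_mul]
  rw [exp_eq_sum h', sum_range_succ', sum_range_succ', mul_sum]
  simp only [mul_smul_comm, ← pow_add, Nat.factorial_zero, Nat.factorial_one, zero_add]
  simp only [pow_zero, pow_one, Nat.cast_one, inv_one, one_smul, add_comm 2]
  abel

/-- Unipotent elements are exponentials. -/
lemma exists_exp_eq_one_add (r : ℕ) : ∀ N : B, N ^ r = 0 →
    ∃ a ∈ Algebra.adjoin ℚ {N}, IsNilpotent a ∧ exp a = 1 + N := by
  induction r using Nat.strong_induction_on with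
  | _ r ih =>
  intro N hN
  rcases Nat.lt_or_ge r 2 with hr | hr
  · have : N = 0 := by
      interval_cases r
      · rw [pow_zero] at hN
        rw [← mul_one N, hN, mul_zero]
      · simpa using hN
    subst this
    exact ⟨0, Subalgebra.zero_mem _, IsNilpotent.zero, by simp⟩
  · have hN' : (-N) ^ r = 0 := by rw [neg_pow, hN, mul_zero]
    obtain ⟨c, hc, hexp⟩ := exp_eq_of_pow_eq_zero hN'
    have hNm : N ∈ Algebra.adjoin ℚ {N} := Algebra.self_mem_adjoin_singleton ℚ N
    have hcm : c ∈ Algebra.adjoin ℚ {N} :=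
      Algebra.adjoin_le (Set.singleton_subset_iff.2 (Subalgebra.neg_mem _ hNm)) hc
    let d := c * (1 + N) - 1
    have hdm : d ∈ Algebra.adjoin ℚ {N} := Subalgebra.sub_mem _ (Subalgebra.mul_mem _ hcm
      (Subalgebra.add_mem _ (Subalgebra.one_mem _) hNm)) (Subalgebra.one_mem _)
    have hNd : Commute N d := (Algebra.commute_of_mem_adjoin_self hdm)
    -- Multiplication by `exp (-N)` replaces `N` by a multiple of `N²`, whose power `r - 1` vanishes
    -- as `2 (r - 1) ≥ r`. If `a` is a logarithm of the result, then `N + a` is one of `1 + N`.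
    have hM : exp (-N) * (1 + N) = 1 + N ^ 2 * d := by
      rw [hexp]
      simp only [d]
      noncomm_ring
    have hMr : (N ^ 2 * d) ^ (r - 1) = 0 := by
      rw [(hNd.pow_left 2).mul_pow, ← pow_mul,
        show 2 * (r - 1) = r + (r - 2) by omega, pow_add, hN, zero_mul, zero_mul]
    obtain ⟨a, ha, hanil, haexp⟩ := ih (r - 1) (by omega) _ hMr
    have ham : a ∈ Algebra.adjoin ℚ {N} := Algebra.adjoin_le (Set.singleton_subset_iff.2
      (Subalgebra.mul_mem _ (Subalgebra.pow_mem _ hNm 2) hdm)) ha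
    have hNa : Commute N a := Algebra.commute_of_mem_adjoin_self ham
    have hNnil : IsNilpotent N := ⟨r, hN⟩
    refine ⟨N + a, Subalgebra.add_mem _ hNm ham, hNa.isNilpotent_add hNnil hanil, ?_⟩
    rw [exp_add_of_commute hNa hNnil hanil, haexp, ← hM, ← mul_assoc,
      exp_mul_exp_neg_self hNnil, one_mul]

lemma exists_exp_eq {u : B} (h : IsNilpotent (u - 1)) :
    ∃ a ∈ Algebra.adjoin ℚ {u}, IsNilpotent a ∧ exp a = u := by
  obtain ⟨r, hr⟩ := h
  obtain ⟨a, ha, hanil, hexp⟩ := exists_exp_eq_one_add r _ hr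
  refine ⟨a, Algebra.adjoin_le (Set.singleton_subset_iff.2 ?_) ha, hanil, by rw [hexp]; abel⟩
  exact Subalgebra.sub_mem _ (Algebra.self_mem_adjoin_singleton ℚ u) (Subalgebra.one_mem _)

/-- Here `exp c - 1 = c (1 + c d)`, and the second factor is a unit. -/
lemma eq_zero_of_exp_eq_one {c : B} (hc : IsNilpotent c) (h : exp c = 1) : c = 0 := by
  obtain ⟨r, hr⟩ := hc
  obtain ⟨d, hd, he⟩ := exp_eq_of_pow_eq_zero hr
  have h1 : c * (1 + c * d) = 0 := by
    have : 1 + c + c ^ 2 * d = 1 := by rw [← he, h]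
    rw [mul_add, mul_one, ← mul_assoc, ← pow_two]
    have h2 := congrArg (fun x => x - 1) this
    simp only [sub_self] at h2
    rw [← h2]
    abel
  have h2 : IsUnit (1 + c * d) := by
    refine IsNilpotent.isUnit_one_add ?_
    exact (Algebra.commute_of_mem_adjoin_self hd).isNilpotent_mul_right ⟨r, hr⟩
  exact (h2.mul_left_eq_zero).1 h1

lemma commute_exp_right {a x : B} (ha : IsNilpotent a) (h : Commute x a) : Commute x (exp a) := by
  obtain ⟨r, hr⟩ := ha
  rw [exp_eq_sum hr]
  exact Commute.sum_right _ _ _ fun i _ => (h.pow_right i).smul_right _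

/-- A logarithm `l` of `exp a` exists in the algebra generated by `exp a`. It commutes with `a`, so
`exp (a - l) = 1` and `a = l`. Injectivity of `exp` on nilpotents, and the passage from commuting
exponentials to commuting logarithms, follow from this. -/
lemma mem_adjoin_exp {a : B} (ha : IsNilpotent a) : a ∈ Algebra.adjoin ℚ {exp a} := by
  obtain ⟨l, hl, hlnil, hexp⟩ := exists_exp_eq (isNilpotent_exp_sub_one ha)
  have hcomm : Commute a l := Algebra.commute_of_mem_adjoin_singleton_of_commute hl
    (commute_exp_right ha (Commute.refl a))
  have hnil : IsNilpotent (a - l) := hcomm.isNilpotent_sub ha hlnil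
  have h0 : a - l = 0 := by
    refine eq_zero_of_exp_eq_one hnil ?_
    rw [sub_eq_add_neg, exp_add_of_commute hcomm.neg_right ha hlnil.neg, ← hexp,
      exp_mul_exp_neg_self hlnil]
  rw [sub_eq_zero.1 h0, hexp]
  exact hl

lemma commute_of_commute_exp {a x : B} (ha : IsNilpotent a) (h : Commute x (exp a)) :
    Commute x a :=
  Algebra.commute_of_mem_adjoin_singleton_of_commute (mem_adjoin_exp ha) h

lemma exp_injective {a b : B} (ha : IsNilpotent a) (hb : IsNilpotent b) (h : exp a = exp b) :
    a = b := by
  have hcomm : Commute a b :=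
    commute_of_commute_exp hb (h ▸ commute_exp_right ha (Commute.refl a))
  refine sub_eq_zero.1 (eq_zero_of_exp_eq_one (hcomm.isNilpotent_sub ha hb) ?_)
  rw [sub_eq_add_neg, exp_add_of_commute hcomm.neg_right ha hb.neg, h, exp_mul_exp_neg_self hb]

lemma isNilpotent_conj {a u v : B} (huv : u * v = 1) (hvu : v * u = 1) (ha : IsNilpotent a) :
    IsNilpotent (u * a * v) := by
  have h := ha.map (MulSemiringAction.toRingHom (ConjAct Bˣ) B (ConjAct.toConjAct ⟨u, v, huv, hvu⟩))
  exact h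

lemma exp_conj {a u v : B} (huv : u * v = 1) (hvu : v * u = 1) (ha : IsNilpotent a) :
    exp (u * a * v) = u * exp a * v :=
  exp_smul (ConjAct.toConjAct (⟨u, v, huv, hvu⟩ : Bˣ)) ha

/-- The inner derivation `ad X`. -/
def innerDer (X : B) : B →ₗ[ℚ] B := LinearMap.mulLeft ℚ X - LinearMap.mulRight ℚ X

@[simp] lemma innerDer_apply (X Y : B) : innerDer X Y = X * Y - Y * X := rfl

lemma commute_innerDer (X : B) : Commute (innerDer X) (LinearMap.mulRight ℚ X) := by
  refine Commute.sub_left ?_ (Commute.refl _)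
  exact LinearMap.commute_mulLeft_right X X

lemma isNilpotent_mulRight {X : B} (hX : IsNilpotent X) :
    IsNilpotent (LinearMap.mulRight ℚ X : Module.End ℚ B) :=
  (LinearMap.isNilpotent_mulRight_iff ℚ X).2 hX

lemma isNilpotent_innerDer {X : B} (hX : IsNilpotent X) :
    IsNilpotent (innerDer X : Module.End ℚ B) :=
  (LinearMap.commute_mulLeft_right X X).isNilpotent_sub
    ((LinearMap.isNilpotent_mulLeft_iff ℚ X).2 hX) (isNilpotent_mulRight hX)

/-- Left multiplication by `X` is the sum of right multiplication and `ad X`. These are commuting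
nilpotent operators, so the exponential of the sum factors. -/
lemma exp_mul_eq {X : B} (hX : IsNilpotent X) (Y : B) :
    exp X * Y = exp (innerDer X : Module.End ℚ B) Y * exp X := by
  have h1 : (LinearMap.mulLeft ℚ X : Module.End ℚ B)
      = LinearMap.mulRight ℚ X + innerDer X := by
    rw [innerDer]; abel
  have h2 : exp (LinearMap.mulLeft ℚ X : Module.End ℚ B) Y = exp X * Y :=
    (LinearMap.congr_fun (map_exp hX (Algebra.lmul ℚ B)) Y).symm
  have h3 : ∀ Z, exp (LinearMap.mulRight ℚ X : Module.End ℚ B) Z = Z * exp X := by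
    intro Z
    obtain ⟨r, hr⟩ := hX
    have hr' : (LinearMap.mulRight ℚ X : Module.End ℚ B) ^ r = 0 := by
      rw [LinearMap.pow_mulRight, hr, LinearMap.mulRight_zero_eq_zero]
    rw [exp_eq_sum hr', exp_eq_sum hr, LinearMap.sum_apply, mul_sum]
    refine sum_congr rfl fun i _ => ?_
    rw [LinearMap.smul_apply, LinearMap.pow_mulRight, LinearMap.mulRight_apply, mul_smul_comm]
  rw [← h2, h1, exp_add_of_commute (commute_innerDer X).symm (isNilpotent_mulRight hX)
    (isNilpotent_innerDer hX), Module.End.mul_apply, h3]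

/-- `exp X` acts on `Y` by `exp (ad X)`, which is quadratic if `(ad X)³ Y = 0`. -/
lemma exp_mul_eq_of_quadratic {X Y Z W : B} (hX : IsNilpotent X) (hZ : X * Y - Y * X = Z)
    (hW : X * Z - Z * X = 2 * W) (hW' : Commute X W) :
    exp X * Y = (Y + Z + W) * exp X := by
  have h3 : ((innerDer X : Module.End ℚ B) ^ 3) • Y = 0 := by
    change innerDer X (innerDer X (innerDer X Y)) = 0
    rw [innerDer_apply X Y, hZ, innerDer_apply X Z, hW, innerDer_apply, sub_eq_zero]
    exact ((Commute.ofNat_right X 2).mul_right hW').eq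
  rw [exp_mul_eq hX, ← Module.End.smul_def, exp_smul_eq_sum h3 (isNilpotent_innerDer hX)]
  have h2 : ((innerDer X : Module.End ℚ B) ^ 2) Y = innerDer X (innerDer X Y) := rfl
  simp only [sum_range_succ, range_zero, sum_empty, zero_add, Module.End.smul_def, h2, pow_zero,
    pow_one, Module.End.one_apply, innerDer_apply X Y, hZ, innerDer_apply X Z, hW]
  congr 2
  · simp
  · rw [Nat.factorial_two, two_mul, ← two_smul ℚ W, smul_smul]
    norm_num

lemma eq_zero_of_forall_natCast_eval (p : Polynomial ℚ) (h : ∀ j : ℕ, p.eval (j : ℚ) = 0) :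
    p = 0 := by
  refine Polynomial.eq_zero_of_infinite_isRoot p ?_
  refine (Set.infinite_range_of_injective (Nat.cast_injective (R := ℚ))).mono ?_
  rintro _ ⟨j, rfl⟩
  exact h j

/-- If `exp (j X)` acts on `Y` by a quadratic polynomial in `j`, then its linear coefficient is
`[X, Y]`. -/
lemma bracket_eq_of_forall_exp_mul {X Y Z W : B} (hX : IsNilpotent X)
    (h : ∀ j : ℕ, exp (j • X) * Y = (Y + j • Z + (j * j) • W) * exp (j • X)) :
    X * Y - Y * X = Z := by
  obtain ⟨r, hr⟩ := isNilpotent_innerDer hX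
  -- The bound `r + 2` guarantees that the linear term occurs in the sum.
  have hr' : (innerDer X : Module.End ℚ B) ^ (r + 2) = 0 := by rw [pow_add, hr, zero_mul]
  have h1 : ∀ j : ℕ, ∑ i ∈ range (r + 2), ((i.factorial : ℚ)⁻¹ * (j : ℚ) ^ i) •
      ((innerDer X : Module.End ℚ B) ^ i) Y = Y + (j : ℚ) • Z + ((j : ℚ) ^ 2) • W := by
    intro j
    have hjX : IsNilpotent (j • X) := hX.smul j
    have hinner : (innerDer (j • X) : Module.End ℚ B) = (j : ℚ) • innerDer X := by
      ext V
      rw [LinearMap.smul_apply, innerDer_apply, innerDer_apply, Nat.cast_smul_eq_nsmul, smul_sub,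
        smul_mul_assoc, mul_smul_comm]
    have h2 := exp_mul_eq hjX Y
    rw [h j] at h2
    have h3 := (isUnit_exp hjX).mul_right_cancel h2
    rw [hinner, exp_eq_sum (k := r + 2) (by rw [smul_pow, hr', smul_zero]), LinearMap.sum_apply] at h3
    rw [Nat.cast_smul_eq_nsmul, ← Nat.cast_pow, Nat.cast_smul_eq_nsmul, pow_two, h3]
    refine sum_congr rfl fun i _ => ?_
    rw [smul_pow, smul_smul, LinearMap.smul_apply]
  rw [← sub_eq_zero, ← Module.forall_dual_apply_eq_zero_iff ℚ]
  intro f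
  -- After applying a linear form, both sides are polynomials over `ℚ` that agree at all natural
  -- numbers; the claim is the equality of the coefficients of degree one.
  let p : Polynomial ℚ := ∑ i ∈ range (r + 2), Polynomial.C ((i.factorial : ℚ)⁻¹ *
    f (((innerDer X : Module.End ℚ B) ^ i) Y)) * Polynomial.X ^ i
    - (Polynomial.C (f Y) + Polynomial.C (f Z) * Polynomial.X + Polynomial.C (f W) * Polynomial.X ^ 2)
  have hp : p = 0 := by
    refine eq_zero_of_forall_natCast_eval p fun j => ?_
    have h4 := congrArg f (h1 j)
    simp only [map_sum, map_add, map_smul, smul_eq_mul] at h4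
    simp only [p, Polynomial.eval_sub, Polynomial.eval_finsetSum, Polynomial.eval_mul,
      Polynomial.eval_C, Polynomial.eval_pow, Polynomial.eval_X, Polynomial.eval_add, sub_eq_zero]
    rw [mul_comm (f Z), mul_comm (f W), ← h4]
    exact sum_congr rfl fun i _ => by ring
  have h5 := congrArg (fun p => Polynomial.coeff p 1) hp
  simp only [p, Polynomial.coeff_sub, Polynomial.finsetSum_coeff, Polynomial.coeff_C_mul,
    Polynomial.coeff_X_pow, Polynomial.coeff_add, Polynomial.coeff_C, Polynomial.coeff_X] at h5
  simpa [sub_eq_zero] using h5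

end NilpotentExp

/-! ### Diagonal elements that scale root subgroups. -/

section Torus

variable {k L : Type*} [Field k] [Field L] [Algebra k L] (τ : L ≃ₐ[k] L) {n : ℕ}
  {R : Type*} [CommRing R] [Algebra k R]

/-- The entries of the diagonal matrix that scales a hyperbolic pair by `2` and `1/2`. -/
def torusEntry (k : Type*) [Field k] (p a : Idx n) : k :=
  if a = p then 2 else if a = opp p then 2⁻¹ else 1

/-- The factor by which `torusElt p` scales the root subgroup of `(p, q)`. -/
def torusFactor (p q : Idx n) : ℕ := if q = opp p then 4 else 2

lemma two_le_torusFactor (p q : Idx n) : 2 ≤ torusFactor p q := by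
  unfold torusFactor; split_ifs <;> norm_num

lemma torusEntry_mul_opp [CharZero k] (p a : Idx n) :
    torusEntry k p a * torusEntry k p (opp a) = 1 := by
  unfold torusEntry
  by_cases h1 : a = p
  · subst h1; simp
  · by_cases h2 : a = opp p
    · subst h2; simp
    · have h3 : opp a ≠ p := fun h => h2 (by rw [← h, opp_opp])
      simp [h1, h2, h3]

lemma torusEntry_mul [CharZero k] {p q : Idx n} (h : p ≠ q) :
    torusEntry k p p = torusFactor p q * torusEntry k p q := by
  unfold torusEntry torusFactor
  by_cases h1 : q = opp p
  · subst h1; norm_num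
  · simp [h1, h.symm]

variable (R) in
/-- The matrix of `torusElt`. -/
def torusMatrix (p : Idx n) : Matrix (Idx n) (Idx n) (R ⊗[k] L) :=
  Matrix.diagonal fun a => algebraMap k (R ⊗[k] L) (torusEntry k p a)

lemma star_torusMatrix [CharZero k] (p : Idx n) :
    star τ (torusMatrix R p) * formMatrix n (R ⊗[k] L) * torusMatrix R p
      = formMatrix n (R ⊗[k] L) := by
  have h1 : star τ (torusMatrix (L := L) R p) = torusMatrix R p := by
    rw [star, torusMatrix, Matrix.diagonal_map (map_zero _), Matrix.diagonal_transpose]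
    congr 1
    ext a
    rw [Algebra.algebraMap_eq_smul_one, conj_smul, map_one]
  rw [h1]
  ext a b
  rw [torusMatrix, Matrix.mul_diagonal, Matrix.diagonal_mul]
  by_cases h : b = opp a
  · subst h
    rw [mul_right_comm, ← map_mul, torusEntry_mul_opp, map_one, one_mul]
  · have : formMatrix n (R ⊗[k] L) a b = 0 := by
      obtain ⟨i, a⟩ := a
      obtain ⟨j, b⟩ := b
      obtain rfl | rfl : a = 0 ∨ a = 1 := by omega
      all_goals obtain rfl | rfl : b = 0 ∨ b = 1 := by omega
      all_goals simp_all [formMatrix, Matrix.one_apply, eq_comm]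
    rw [this, mul_zero, zero_mul]

lemma det_torusMatrix [CharZero k] (p : Idx n) : (torusMatrix (k := k) (L := L) R p).det = 1 := by
  rw [torusMatrix, Matrix.det_diagonal, Fintype.prod_prod_type]
  refine Finset.prod_eq_one fun i _ => ?_
  rw [Fin.prod_univ_two, ← map_mul, ← opp_zero, torusEntry_mul_opp, map_one]

variable (R) in
/-- The diagonal element of `SU_{2n}(R)` with entries `2` at `p` and `1/2` at `opp p`. -/
def torusElt [CharZero k] (p : Idx n) : SU τ n R :=
  ⟨⟨torusMatrix R p, det_torusMatrix p⟩, star_torusMatrix τ p⟩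

variable {τ} [CharZero k] [Algebra.IsQuadraticExtension k L] (hτ : τ ≠ AlgEquiv.refl)

/-- The position `(p, q)` is scaled by the quotient of the diagonal entries at `p` and `q`, which is
`2`, or `4` if `q = opp p`. Paired entries are inverse, so the mirror position is scaled by the same
factor. -/
lemma torusElt_mul_elemSU {p q : Idx n} (h : p ≠ q) (x : R ⊗[k] L) :
    torusElt τ R p * elemSU τ hτ p q x
      = elemSU τ hτ p q (torusFactor p q • x) * torusElt τ R p := by
  refine SU.ext' ?_
  change torusMatrix R p * (elemSU τ hτ p q x).1.1
    = (elemSU τ hτ p q (torusFactor p q • x)).1.1 * torusMatrix R p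
  rw [coe_elemSU hτ h, coe_elemSU hτ h, elemMatrix, elemMatrix, mul_add, add_mul, one_mul, mul_one,
    lieMatrix, lieMatrix, mul_add, add_mul, torusMatrix, map_nsmul, smul_comm (sgn p q)]
  have h2 : ∀ (r s : Idx n) (z : R ⊗[k] L),
      torusEntry k p r = torusFactor p q * torusEntry k p s →
      Matrix.diagonal (fun a => algebraMap k (R ⊗[k] L) (torusEntry k p a)) * Matrix.single r s z
        = Matrix.single r s (torusFactor p q • z)
          * Matrix.diagonal fun a => algebraMap k (R ⊗[k] L) (torusEntry k p a) := by
    intro r s z hrs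
    ext a b
    rw [Matrix.diagonal_mul, Matrix.mul_diagonal, Matrix.single_apply, Matrix.single_apply]
    split_ifs with hab
    · obtain ⟨rfl, rfl⟩ := hab
      rw [hrs, map_mul, map_natCast, nsmul_eq_mul]
      ring
    · rw [mul_zero, zero_mul]
  rw [h2 p q x (torusEntry_mul h), h2]
  have h3 := torusEntry_mul_opp (k := k) p q
  have h4 := torusEntry_mul_opp (k := k) p p
  have h5 := torusEntry_mul (k := k) h
  have h6 : torusEntry k p p ≠ 0 := left_ne_zero_of_mul_eq_one h4
  have h7 : torusEntry k p q ≠ 0 := left_ne_zero_of_mul_eq_one h3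
  rw [eq_div_of_mul_eq h6 ((mul_comm _ _).trans h4), eq_div_of_mul_eq h7 ((mul_comm _ _).trans h3), h5]
  have h8 : (torusFactor p q : k) ≠ 0 := by
    have := two_le_torusFactor p q
    exact Nat.cast_ne_zero.2 (by omega)
  field_simp

end Torus

/-! ### Root elements act unipotently. -/

section Unipotent

variable {K : Type*} [Field K] {m : ℕ}

/-- Two of the `m + 1` elements `x ^ c ^ i`, `i ≤ m`, coincide, so `x` has order at most `c ^ m`.
The factorial is an exponent that does not depend on `x`. -/
lemma pow_eq_one_of_forall_pow_mem {S : Finset K} (h0 : (0 : K) ∉ S) {c : ℕ} (hc : 2 ≤ c)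
    (hS : ∀ x ∈ S, x ^ c ∈ S) (hm : S.card ≤ m) {x : K} (hx : x ∈ S) :
    x ^ (c ^ m).factorial = 1 := by
  have hmem : ∀ i : ℕ, x ^ c ^ i ∈ S := by
    intro i
    induction i with
    | zero => simpa using hx
    | succ i ih => rw [pow_succ, pow_mul]; exact hS _ ih
  obtain ⟨i, hi, j, hj, hij, heq⟩ := Finset.exists_ne_map_eq_of_card_lt_of_maps_to
    (s := Finset.range (m + 1)) (t := S) (by rw [Finset.card_range]; omega)
    (f := fun i => x ^ c ^ i) (fun i _ => hmem i)
  wlog hlt : i < j generalizing i j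
  · exact this j hj i hi hij.symm heq.symm (by omega)
  have hx0 : x ≠ 0 := fun h => h0 (h ▸ hx)
  have hlt' : c ^ i < c ^ j := Nat.pow_lt_pow_right (by omega) hlt
  have h1 : x ^ (c ^ j - c ^ i) = 1 := by
    rw [pow_sub₀ x hx0 hlt'.le, ← heq, mul_inv_cancel₀ (pow_ne_zero _ hx0)]
  have h2 : c ^ j ≤ c ^ m := Nat.pow_le_pow_right (by omega) (by simp at hj; omega)
  obtain ⟨e, he⟩ := Nat.dvd_factorial (show 0 < c ^ j - c ^ i by omega)
    (show c ^ j - c ^ i ≤ c ^ m by omega)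
  rw [he, pow_mul, h1, one_pow]

/-- The characteristic polynomial is a power of `X - 1`, and Cayley–Hamilton applies. -/
lemma isNilpotent_sub_one_of_spectrum [IsAlgClosed K] (M : Matrix (Fin m) (Fin m) K)
    (h : ∀ x ∈ spectrum K M, x = 1) : IsNilpotent (M - 1) := by
  have h1 := (IsAlgClosed.splits M.charpoly).eq_prod_roots_of_monic M.charpoly_monic
  have h2 : M.charpoly.roots = Multiset.replicate M.charpoly.roots.card 1 :=
    Multiset.eq_replicate_card.2 fun x hx => h x
      (Matrix.mem_spectrum_iff_isRoot_charpoly.2 (Polynomial.isRoot_of_mem_roots hx))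
  rw [h2, Multiset.map_replicate, Multiset.prod_replicate] at h1
  refine ⟨M.charpoly.roots.card, ?_⟩
  have h3 := M.aeval_self_charpoly
  rw [h1] at h3
  simpa using h3

/-- As `g ^ c` is conjugate to `g`, the set of eigenvalues is stable under the `c`-th power, so they
are roots of unity of bounded order. -/
lemma isNilpotent_pow_sub_one [IsAlgClosed K] {g d : Matrix.GeneralLinearGroup (Fin m) K} {c : ℕ}
    (hc : 2 ≤ c) (h : d * g * d⁻¹ = g ^ c) :
    IsNilpotent ((g ^ (c ^ m).factorial).1 - 1) := by
  classical
  refine isNilpotent_sub_one_of_spectrum _ fun x hx => ?_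
  have hspec : spectrum K (g.1 ^ c) = spectrum K g.1 := by
    rw [← Units.val_pow_eq_pow_val, ← h]
    exact spectrum.units_conjugate
  rw [Units.val_pow_eq_pow_val, spectrum.map_pow_of_pos _ (Nat.factorial_pos _)] at hx
  obtain ⟨y, hy, rfl⟩ := hx
  have hroots : ∀ x, x ∈ g.1.charpoly.roots.toFinset ↔ x ∈ spectrum K g.1 := fun x => by
    rw [Multiset.mem_toFinset, Polynomial.mem_roots g.1.charpoly_monic.ne_zero,
      Matrix.mem_spectrum_iff_isRoot_charpoly]
  refine pow_eq_one_of_forall_pow_mem (S := g.1.charpoly.roots.toFinset) ?_ hc ?_ ?_ ((hroots y).2 hy)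
  · rw [hroots]
    exact spectrum.zero_notMem K g.isUnit
  · intro x hx
    rw [hroots] at hx ⊢
    rw [← hspec]
    exact spectrum.pow_mem_pow _ _ hx
  · refine (Multiset.toFinset_card_le _).trans ((Polynomial.card_roots' _).trans ?_)
    rw [Matrix.charpoly_natDegree_eq_dim, Fintype.card_fin]

variable {k L : Type*} [Field k] [CharZero k] [Field L] [Algebra k L]
  [Algebra.IsQuadraticExtension k L] {τ : L ≃ₐ[k] L} {n : ℕ} (hτ : τ ≠ AlgEquiv.refl)

lemma elemSU_nsmul {p q : Idx n} (h : p ≠ q) (x : k ⊗[k] L) (j : ℕ) :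
    elemSU τ hτ p q (j • x) = elemSU τ hτ p q x ^ j := by
  induction j with
  | zero => rw [zero_smul, pow_zero, (elemSU_isElemSystem hτ).zero h]
  | succ j ih => rw [succ_nsmul, pow_succ, ← ih, (elemSU_isElemSystem hτ).add h]

/-- Representations of `SU_{2n}(k)` map elementary elements to unipotent ones. -/
theorem isNilpotent_map_elemSU_sub_one [IsAlgClosed K]
    (ρ : SU τ n k →* Matrix.GeneralLinearGroup (Fin m) K) {p q : Idx n} (h : p ≠ q) (x : k ⊗[k] L) :
    IsNilpotent ((ρ (elemSU τ hτ p q x)).1 - 1) := by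
  -- The exponent `N` does not depend on the element. Since `x / N` is available, the element for
  -- `x` is itself an `N`-th power.
  set N := (torusFactor p q ^ m).factorial with hN
  have hN0 : (N : k) ≠ 0 := Nat.cast_ne_zero.2 (Nat.factorial_pos _).ne'
  set y : k ⊗[k] L := (N : k)⁻¹ • x with hy
  have hx : x = N • y := by
    rw [hy, ← Nat.cast_smul_eq_nsmul k, smul_smul, mul_inv_cancel₀ hN0, one_smul]
  rw [hx, elemSU_nsmul hτ h, map_pow]
  refine isNilpotent_pow_sub_one (d := ρ (torusElt τ k p)) (two_le_torusFactor p q) ?_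
  rw [← map_pow, ← map_inv, ← map_mul, ← map_mul, torusElt_mul_elemSU hτ h, elemSU_nsmul hτ h,
    mul_inv_cancel_right]

end Unipotent

/-! ### Lie systems: logarithms of elementary systems. -/

section LieSystem

open IsNilpotent

variable {k L : Type*} [Field k] [Field L] [Algebra k L] (τ : L ≃ₐ[k] L) {n : ℕ}
  {R : Type*} [CommRing R] [Algebra k R] {B : Type*} [Ring B]

/-- Families of elements of an associative ring that satisfy the commutator relations of the
elements `lieMatrix`. -/
structure IsLieSystem (D : Idx n → Idx n → R ⊗[k] L →+ B) : Prop where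
  opp : ∀ {p q}, p ≠ q → ∀ x, D (opp q) (opp p) (sgn p q • conj τ R x) = D p q x
  comm : ∀ {p q r t}, p ≠ q → r ≠ t → q ≠ r → SUHom.opp q ≠ t → p ≠ t → SUHom.opp p ≠ r →
    ∀ x y, Commute (D p q x) (D r t y)
  bracket_short : ∀ {p q t}, p ≠ q → q ≠ t → p ≠ t → p ≠ SUHom.opp q → t ≠ SUHom.opp q → ∀ x y,
    D p q x * D q t y - D q t y * D p q x = D p t (x * y)
  bracket_long : ∀ {p q}, p ≠ q → p ≠ SUHom.opp q → ∀ x y,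
    D p q x * D q (SUHom.opp q) y - D q (SUHom.opp q) y * D p q x
      = D p (SUHom.opp q) (x * (y + conj τ R y))

section

variable [Algebra ℚ B]

lemma exp_mul_exp_of_exp_mul {X Y Y' : B} (hX : IsNilpotent X) (hY : IsNilpotent Y)
    (h : exp X * Y = Y' * exp X) : exp X * exp Y = exp Y' * exp X := by
  have h1 := exp_mul_exp_neg_self hX
  have h2 := exp_neg_mul_exp_self hX
  have h3 : Y' = exp X * Y * exp (-X) := by rw [h, mul_assoc, h1, mul_one]
  rw [h3, exp_conj h1 h2 hY, mul_assoc, h2, mul_one]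

lemma exp_mul_of_exp_mul_exp {X Y Y' : B} (hX : IsNilpotent X) (hY : IsNilpotent Y)
    (hY' : IsNilpotent Y') (h : exp X * exp Y = exp Y' * exp X) : exp X * Y = Y' * exp X := by
  have h1 := exp_mul_exp_neg_self hX
  have h2 := exp_neg_mul_exp_self hX
  have h3 : exp X * Y * exp (-X) = Y' := by
    refine exp_injective (isNilpotent_conj h1 h2 hY) hY' ?_
    rw [exp_conj h1 h2 hY, h, mul_assoc, h1, mul_one]
  rw [← h3, mul_assoc, h2, mul_one]

end

variable {τ} {D : Idx n → Idx n → R ⊗[k] L →+ B}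

namespace IsLieSystem

variable (hD : IsLieSystem τ D)
include hD

lemma commute_self {p q : Idx n} (h : p ≠ q) (x y : R ⊗[k] L) : Commute (D p q x) (D p q y) :=
  hD.comm h h h.symm (opp_ne_self q) h (opp_ne_self p) x y

lemma long (p : Idx n) (x : R ⊗[k] L) :
    D p (SUHom.opp p) (conj τ R x) = D p (SUHom.opp p) x := by
  have := hD.opp (self_ne_opp p) x
  rwa [opp_opp, sgn_self_opp, one_smul] at this

/-- Reflecting the position `(p, opp q)` to `(q, opp p)` makes this a short bracket. Its value is
the long root element at `-(sgn p q • (x * conj τ R x * (y + conj τ R y)))`, where the two summands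
contribute equally because long positions ignore `conj`. -/
lemma bracket_bracket_long [Algebra.IsQuadraticExtension k L] {p q : Idx n} (hpq : p ≠ q)
    (h : p ≠ SUHom.opp q) (x y : R ⊗[k] L) :
    D p q x * D p (SUHom.opp q) (x * (y + conj τ R y))
        - D p (SUHom.opp q) (x * (y + conj τ R y)) * D p q x
      = 2 * D p (SUHom.opp p) (-(sgn p q • (x * conj τ R x * y))) := by
  have h1 := hD.opp h (x * (y + conj τ R y))
  rw [opp_opp] at h1
  have h2 : q ≠ SUHom.opp p := fun h' => h (by rw [h', opp_opp])
  rw [← h1, hD.bracket_short hpq h2 (self_ne_opp p) h (fun h' => hpq (opp_inj.1 h')), sgn_opp_right,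
    map_mul (conj τ R), map_add (conj τ R), conj_conj, neg_smul, mul_neg, mul_smul_comm, ← mul_assoc, mul_add, smul_add,
    neg_add, map_add, two_mul]
  congr 1
  rw [map_neg, map_neg, map_zsmul, map_zsmul, ← hD.long p (x * conj τ R x * conj τ R y)]
  simp only [map_mul, conj_conj, mul_comm x]

/-- The exponentials of a Lie system form an elementary system. -/
theorem isElemSystem [Algebra.IsQuadraticExtension k L] [Algebra ℚ B] {Γ : Type*} [Group Γ]
    {g : Idx n → Idx n → R ⊗[k] L → Γ} (e : Γ →* B) (he : Function.Injective e)
    (hnil : ∀ {p q}, p ≠ q → ∀ x, IsNilpotent (D p q x))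
    (hexp : ∀ {p q}, p ≠ q → ∀ x, e (g p q x) = exp (D p q x)) : IsElemSystem τ g where
  add h x y := he <| by
    rw [map_mul, hexp h, hexp h, hexp h, map_add, exp_add_of_commute (hD.commute_self h x y)
      (hnil h x) (hnil h y)]
  opp {p q} h x := he <| by
    rw [hexp h, hexp (fun h' => h (opp_inj.1 h').symm), hD.opp h]
  comm {p q r t} hpq hrt h1 h2 h3 h4 x y := he <| by
    rw [map_mul, map_mul, hexp hpq, hexp hrt]
    exact commute_exp_right (hnil hrt y)
      (commute_exp_right (hnil hpq x) (hD.comm hpq hrt h1 h2 h3 h4 x y).symm).symm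
  conj_short {p q t} hpq hqt hpt h1 h2 x y := he <| by
    have hc : Commute (D q t y) (D p t (x * y)) :=
      hD.comm hqt hpt hpt.symm (opp_ne_self t) hqt h1.symm _ _
    have hc' : Commute (D p q x) (D p t (x * y)) :=
      hD.comm hpq hpt hpq.symm h2.symm hpt (opp_ne_self p) _ _
    simp only [map_mul, hexp hpq, hexp hqt, hexp hpt]
    rw [← exp_add_of_commute hc (hnil hqt _) (hnil hpt _)]
    refine exp_mul_exp_of_exp_mul (hnil hpq _) (hnil hqt _) ?_
    have := exp_mul_eq_of_quadratic (W := 0) (hnil hpq x)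
      (hD.bracket_short hpq hqt hpt h1 h2 x y) (by rw [hc'.eq]; simp) (Commute.zero_right _)
    rwa [add_zero] at this
  conj_long {p q} hpq h x y := he <| by
    have h2 : q ≠ SUHom.opp p := fun h' => h (by rw [h', opp_opp])
    have h3 := self_ne_opp p
    have h4 := self_ne_opp q
    have hc1 : Commute (D q (SUHom.opp q) y) (D p (SUHom.opp q) (x * (y + conj τ R y))) :=
      hD.comm h4 h h.symm (by rwa [opp_opp]) h4 h.symm _ _
    have hc2 : ∀ u v, Commute (D q (SUHom.opp q) u) (D p (SUHom.opp p) v) := fun u v =>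
      hD.comm h4 h3 h.symm (by rwa [opp_opp]) h2 h.symm _ _
    have hc3 : ∀ u v, Commute (D p (SUHom.opp q) u) (D p (SUHom.opp p) v) := fun u v =>
      hD.comm h h3 h.symm (by rwa [opp_opp]) h3 (opp_ne_self p) _ _
    have hc4 : ∀ u v, Commute (D p q u) (D p (SUHom.opp p) v) := fun u v =>
      hD.comm hpq h3 hpq.symm (fun h' => hpq (opp_inj.1 h').symm) h3 (opp_ne_self p) _ _
    simp only [map_mul, hexp hpq, hexp h, hexp h3, hexp h4]
    rw [← exp_add_of_commute hc1 (hnil h4 _) (hnil h _), ← exp_add_of_commute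
      ((hc2 _ _).add_left (hc3 _ _)) (hc1.isNilpotent_add (hnil h4 _) (hnil h _)) (hnil h3 _)]
    exact exp_mul_exp_of_exp_mul (hnil hpq _) (hnil h4 _) (exp_mul_eq_of_quadratic (hnil hpq x)
      (hD.bracket_long hpq h x y) (hD.bracket_bracket_long hpq h x y) (hc4 _ _))

end IsLieSystem

/-- The logarithms of a unipotent elementary system form a Lie system. -/
theorem IsElemSystem.exists_isLieSystem [Algebra ℚ B] {Γ : Type*} [Group Γ]
    {g : Idx n → Idx n → R ⊗[k] L → Γ} (hg : IsElemSystem τ g) (e : Γ →* B)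
    (hnil : ∀ {p q}, p ≠ q → ∀ x, IsNilpotent (e (g p q x) - 1)) :
    ∃ D : Idx n → Idx n → R ⊗[k] L →+ B, IsLieSystem τ D ∧
      (∀ {p q}, p ≠ q → ∀ x, IsNilpotent (D p q x)) ∧
      ∀ {p q}, p ≠ q → ∀ x, exp (D p q x) = e (g p q x) := by
  have hex : ∀ p q, ∃ D : R ⊗[k] L →+ B, p ≠ q →
      ∀ x, IsNilpotent (D x) ∧ exp (D x) = e (g p q x) := by
    intro p q
    by_cases h : p ≠ q
    · choose l hl hlnil hlexp using fun x => exists_exp_eq (hnil h x)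
      refine ⟨AddMonoidHom.mk' l fun x y => ?_, fun _ x => ⟨hlnil x, hlexp x⟩⟩
      -- Logarithms of commuting unipotents commute, so additivity follows from the injectivity of
      -- `exp`.
      have hc : Commute (l x) (l y) := by
        refine commute_of_commute_exp (hlnil y) (commute_of_commute_exp (hlnil x) ?_).symm
        rw [hlexp, hlexp, commute_iff_eq, ← map_mul, ← map_mul, hg.add h, hg.add h, add_comm]
      refine exp_injective (hlnil _) (hc.isNilpotent_add (hlnil x) (hlnil y)) ?_
      rw [exp_add_of_commute hc (hlnil x) (hlnil y), hlexp, hlexp, hlexp, ← map_mul, hg.add h]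
    · exact ⟨0, fun h' => absurd h' h⟩
  choose D hD using hex
  have hDnil : ∀ {p q}, p ≠ q → ∀ x, IsNilpotent (D p q x) := fun h x => (hD _ _ h x).1
  have hDexp : ∀ {p q}, p ≠ q → ∀ x, exp (D p q x) = e (g p q x) := fun h x => (hD _ _ h x).2
  have hcomm : ∀ {p q r t}, p ≠ q → r ≠ t → q ≠ r → SUHom.opp q ≠ t → p ≠ t → SUHom.opp p ≠ r →
      ∀ x y, Commute (D p q x) (D r t y) := by
    intro p q r t hpq hrt h1 h2 h3 h4 x y
    refine commute_of_commute_exp (hDnil hrt y) (commute_of_commute_exp (hDnil hpq x) ?_).symm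
    rw [hDexp hpq, hDexp hrt]
    exact ((hg.comm hpq hrt h1 h2 h3 h4 x y).map e).symm
  refine ⟨D, ⟨?_, hcomm, ?_, ?_⟩, hDnil, hDexp⟩
  · intro p q h x
    have h' : SUHom.opp q ≠ SUHom.opp p := fun h' => h (opp_inj.1 h').symm
    exact exp_injective (hDnil h' _) (hDnil h _) (by rw [hDexp h', hDexp h, hg.opp h])
  · intro p q t hpq hqt hpt h1 h2 x y
    have hc : ∀ u v, Commute (D q t u) (D p t v) := fun u v =>
      hcomm hqt hpt hpt.symm (opp_ne_self t) hqt h1.symm _ _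
    refine bracket_eq_of_forall_exp_mul (W := 0) (hDnil hpq x) fun j => ?_
    rw [smul_zero, add_zero, ← map_nsmul, ← map_nsmul]
    refine exp_mul_of_exp_mul_exp (hDnil hpq _) (hDnil hqt _)
      ((hc _ _).isNilpotent_add (hDnil hqt _) (hDnil hpt _)) ?_
    rw [exp_add_of_commute (hc _ _) (hDnil hqt _) (hDnil hpt _)]
    simp only [hDexp hpq, hDexp hqt, hDexp hpt, ← map_mul]
    rw [hg.conj_short hpq hqt hpt h1 h2, smul_mul_assoc]
  · intro p q hpq h x y
    have h2 : q ≠ SUHom.opp p := fun h' => h (by rw [h', opp_opp])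
    have h3 := self_ne_opp p
    have h4 := self_ne_opp q
    have hc1 : ∀ u v, Commute (D q (SUHom.opp q) u) (D p (SUHom.opp q) v) := fun u v =>
      hcomm h4 h h.symm (by rwa [opp_opp]) h4 h.symm _ _
    have hc2 : ∀ u v, Commute (D q (SUHom.opp q) u) (D p (SUHom.opp p) v) := fun u v =>
      hcomm h4 h3 h.symm (by rwa [opp_opp]) h2 h.symm _ _
    have hc3 : ∀ u v, Commute (D p (SUHom.opp q) u) (D p (SUHom.opp p) v) := fun u v =>
      hcomm h h3 h.symm (by rwa [opp_opp]) h3 (opp_ne_self p) _ _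
    -- Replacing `x` by `j x` makes the short factor linear and the long factor quadratic in `j`.
    -- The linear coefficient is the bracket.
    refine bracket_eq_of_forall_exp_mul
      (W := D p (SUHom.opp p) (-(sgn p q • (x * conj τ R x * y)))) (hDnil hpq x) fun j => ?_
    rw [← map_nsmul, ← map_nsmul, ← map_nsmul]
    have hn1 := (hc1 y (j • (x * (y + conj τ R y)))).isNilpotent_add (hDnil h4 _) (hDnil h _)
    have hc4 := (hc2 y ((j * j) • -(sgn p q • (x * conj τ R x * y)))).add_left
      (hc3 (j • (x * (y + conj τ R y))) _)
    refine exp_mul_of_exp_mul_exp (hDnil hpq _) (hDnil h4 _)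
      (hc4.isNilpotent_add hn1 (hDnil h3 _)) ?_
    rw [exp_add_of_commute hc4 hn1 (hDnil h3 _),
      exp_add_of_commute (hc1 _ _) (hDnil h4 _) (hDnil h _)]
    simp only [hDexp hpq, hDexp h, hDexp h3, hDexp h4, ← map_mul]
    rw [hg.conj_long hpq h, smul_mul_assoc, map_nsmul, smul_mul_smul_comm, smul_mul_assoc,
      smul_neg, smul_comm (j * j)]

end LieSystem

/-! ### All logarithms depend linearly on one of them. -/

section Dependence

variable {k L : Type*} [Field k] [Field L] [Algebra k L] {τ : L ≃ₐ[k] L} {n : ℕ}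
  (K : Type*) [Field K] [CharZero K] {B : Type*} [Ring B] [Algebra K B]
  {D : Idx n → Idx n → k ⊗[k] L →+ B}

/-- The additive map `x ↦ D p q (x y)` is the composition of `D₀` and a linear map. -/
def FactorsThrough (D : Idx n → Idx n → k ⊗[k] L →+ B) (D₀ : k → B) (p q : Idx n)
    (y : k ⊗[k] L) : Prop :=
  ∃ T : B →ₗ[K] B, ∀ x : k, D p q (x • y) = T (D₀ x)

variable {K}

namespace IsLieSystem

variable (hD : IsLieSystem τ D) {D₀ : k → B}
include hD

/-- Bracketing `D p q y` with the long element at the scalar `x` gives `D p (opp q)` at `2 x y`. -/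
lemma factorsThrough_short {p q : Idx n} (h : FactorsThrough K D D₀ q (SUHom.opp q) 1)
    (hpq : p ≠ q) (hpq' : p ≠ SUHom.opp q) (y : k ⊗[k] L) :
    FactorsThrough K D D₀ p (SUHom.opp q) y := by
  obtain ⟨T, hT⟩ := h
  refine ⟨(2⁻¹ : K) • ((LinearMap.mulLeft K (D p q y) - LinearMap.mulRight K (D p q y)) ∘ₗ T),
    fun x => ?_⟩
  have h1 := hD.bracket_long hpq hpq' y (x • 1)
  rw [hT, map_smul, map_one, mul_add, map_add, mul_smul_comm, mul_one] at h1
  rw [LinearMap.smul_apply, LinearMap.comp_apply, LinearMap.sub_apply, LinearMap.mulLeft_apply,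
    LinearMap.mulRight_apply, h1, ← two_smul K, smul_smul, inv_mul_cancel₀ two_ne_zero, one_smul]

/-- A short element at `x y`, bracketed with `D q (opp p) 1`, gives the long element at `x y`. -/
lemma factorsThrough_long {p q : Idx n} (h : ∀ y, FactorsThrough K D D₀ p q y)
    (hpq : p ≠ q) (hpq' : p ≠ SUHom.opp q) (y : k ⊗[k] L) :
    FactorsThrough K D D₀ p (SUHom.opp p) y := by
  obtain ⟨T, hT⟩ := h y
  refine ⟨(LinearMap.mulRight K (D q (SUHom.opp p) 1) - LinearMap.mulLeft K (D q (SUHom.opp p) 1))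
    ∘ₗ T, fun x => ?_⟩
  have h1 := hD.bracket_short hpq (fun h' => hpq' (by rw [h', opp_opp])) (self_ne_opp p) hpq'
    (fun h' => hpq (opp_inj.1 h')) (x • y) 1
  rw [hT, mul_one] at h1
  rw [LinearMap.comp_apply, LinearMap.sub_apply, LinearMap.mulLeft_apply,
    LinearMap.mulRight_apply, h1]

/-- Each long root is reached from a long root in another plane through a short root. For the plane
of `p₀` itself the way leads through a second plane and back, which requires `n ≥ 2`. -/
lemma factorsThrough (hn : 2 ≤ n) {p₀ : Idx n} (h₀ : FactorsThrough K D D₀ p₀ (SUHom.opp p₀) 1)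
    {p q : Idx n} (hpq : p ≠ q) (y : k ⊗[k] L) : FactorsThrough K D D₀ p q y := by
  have hstep : ∀ {q : Idx n}, FactorsThrough K D D₀ q (SUHom.opp q) 1 →
      ∀ {p : Idx n}, p ≠ q → p ≠ SUHom.opp q → ∀ y, FactorsThrough K D D₀ p (SUHom.opp p) y := by
    intro q hq p h1 h2
    exact hD.factorsThrough_long (hD.factorsThrough_short hq h1 h2) h2 (by rwa [opp_opp])
  obtain ⟨j, hj⟩ : ∃ j : Fin n, j ≠ p₀.1 := by
    have : Nontrivial (Fin n) := Fin.nontrivial_iff_two_le.2 hn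
    exact exists_ne _
  have hlong : ∀ p y, FactorsThrough K D D₀ p (SUHom.opp p) y := by
    intro p
    by_cases h1 : p = p₀ ∨ p = SUHom.opp p₀
    · have h2 : FactorsThrough K D D₀ (j, 0) (SUHom.opp (j, 0)) 1 :=
        hstep h₀ (fun h => hj (congrArg Prod.fst h)) (fun h => hj (congrArg Prod.fst h)) 1
      have h3 : p.1 = p₀.1 := by rcases h1 with rfl | rfl <;> rfl
      exact hstep h2 (fun h => hj (h3 ▸ (congrArg Prod.fst h).symm))
        (fun h => hj (h3 ▸ (congrArg Prod.fst h).symm))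
    · push Not at h1
      exact hstep h₀ h1.1 h1.2
  by_cases h : q = SUHom.opp p
  · rw [h]
    exact hlong p y
  · have h1 := hD.factorsThrough_short (q := SUHom.opp q) (p := p) (hlong _ 1)
      (fun h' => h (by rw [h', opp_opp])) (by rwa [opp_opp]) y
    rwa [opp_opp] at h1

end IsLieSystem

end Dependence

/-! ### Construction of the algebra `A`. -/

section Algebra

/-- If multiplication in a field `k` is compatible with an additive map to a vector space `V` of
finite dimension over `K`, the map factors through a ring homomorphism from `k` to a `K`-algebra
of finite dimension. -/
theorem exists_algebra_of_forall_mul {k : Type*} {K V : Type v} [Field k] [Field K]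
    [AddCommGroup V] [Module K V] [Module.Finite K V] (D₀ : k →+ V)
    (hT : ∀ t : k, ∃ T : V →ₗ[K] V, ∀ x, D₀ (t * x) = T (D₀ x)) :
    ∃ (A : Type v) (_ : CommRing A) (_ : Algebra K A) (f : k →+* A) (Θ : A →ₗ[K] V),
      Module.Finite K A ∧ Submodule.span K (Set.range f) = ⊤ ∧ ∀ x, Θ (f x) = D₀ x := by
  let W := Submodule.span K (Set.range D₀)
  have hW : ∀ x, D₀ x ∈ W := fun x => Submodule.subset_span ⟨x, rfl⟩
  choose T hT using hT
  have hTW : ∀ t, ∀ w ∈ W, T t w ∈ W := by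
    intro t w hw
    induction hw using Submodule.span_induction with
    | mem w hw => obtain ⟨x, rfl⟩ := hw; rw [← hT]; exact hW _
    | zero => rw [map_zero]; exact W.zero_mem
    | add v w _ _ hv hw => rw [map_add]; exact W.add_mem hv hw
    | smul c w _ hw => rw [map_smul]; exact W.smul_mem c hw
  -- On the span `W` of the values of `D₀`, the operator `M t` is determined by `D₀ x ↦ D₀ (t x)`.
  -- This makes `M` a ring homomorphism although the `T t` were chosen arbitrarily.
  let M : k → Module.End K W := fun t => (T t).restrict (hTW t)
  let d : k → W := fun x => ⟨D₀ x, hW x⟩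
  have hM : ∀ t x, M t (d x) = d (t * x) := fun t x => Subtype.ext (hT t x).symm
  have hext : ∀ {S S' : Module.End K W}, (∀ x, S (d x) = S' (d x)) → S = S' := by
    intro S S' h
    refine LinearMap.ext fun ⟨w, hw⟩ => ?_
    induction hw using Submodule.span_induction with
    | mem w hw => obtain ⟨x, rfl⟩ := hw; exact h x
    | zero => exact (map_zero S).trans (map_zero S').symm
    | add v w hv hw h1 h2 =>
      exact (map_add S ⟨v, hv⟩ ⟨w, hw⟩).trans ((congrArg₂ _ h1 h2).trans
        (map_add S' ⟨v, hv⟩ ⟨w, hw⟩).symm)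
    | smul c w hw h1 =>
      exact (map_smul S c ⟨w, hw⟩).trans ((congrArg _ h1).trans (map_smul S' c ⟨w, hw⟩).symm)
  have hd : ∀ x y, d (x + y) = d x + d y := fun x y => Subtype.ext (map_add D₀ x y)
  let F : k →+* Module.End K W :=
    { toFun := M
      map_one' := hext fun x => by rw [hM, one_mul]; rfl
      map_mul' := fun s t => hext fun x => by
        rw [Module.End.mul_apply, hM, hM, hM, mul_assoc]
      map_zero' := hext fun x => by
        rw [hM, zero_mul]
        exact Subtype.ext (map_zero D₀)
      map_add' := fun s t => hext fun x => by
        rw [LinearMap.add_apply, hM, hM, hM, add_mul, hd] }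
  let A := Algebra.adjoin K (Set.range F)
  have hcomm : ∀ a ∈ Set.range F, ∀ b ∈ Set.range F, a * b = b * a := by
    rintro _ ⟨s, rfl⟩ _ ⟨t, rfl⟩
    rw [← map_mul, ← map_mul, mul_comm]
  let _ : CommRing A := { (inferInstance : Ring A) with
    mul_comm := (Algebra.isMulCommutative_adjoin K hcomm).is_comm.comm }
  have hspan : Submodule.span K (Set.range F) = Subalgebra.toSubmodule A := by
    have : (Set.range F : Set (Module.End K W)) = (MonoidHom.mrange (F : k →* Module.End K W) : Set _) := rfl
    rw [Algebra.adjoin_eq_span, this, Submonoid.closure_eq]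
  let f : k →+* A := F.codRestrict A fun x => Algebra.subset_adjoin ⟨x, rfl⟩
  refine ⟨A, inferInstance, inferInstance, f,
    -- The map `Θ` evaluates operators at `D₀ 1`.
    W.subtype ∘ₗ LinearMap.applyₗ (d 1) ∘ₗ A.val.toLinearMap, ?_, ?_, ?_⟩
  · exact Module.Finite.of_injective A.val.toLinearMap Subtype.val_injective
  · have hinj : Function.Injective A.val.toLinearMap := Subtype.val_injective
    refine Submodule.map_injective_of_injective hinj ?_
    rw [Submodule.map_span, ← Set.range_comp, Submodule.map_top]
    refine hspan.trans ?_
    ext x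
    exact ⟨fun h => ⟨⟨x, h⟩, rfl⟩, by rintro ⟨y, rfl⟩; exact y.2⟩
  · intro x
    change ((M x (d 1) : W) : V) = D₀ x
    rw [hM, mul_one]

end Algebra

/-! ### Extension of Lie systems to `A`. -/

section BaseExtension

variable {k L : Type*} [Field k] [Field L] [Algebra k L] {τ : L ≃ₐ[k] L} {n : ℕ}
  {K : Type*} [Field K] {A : Type*} [CommRing A] [Algebra K A] [Algebra k A]
  {B : Type*} [Ring B] [Algebra K B]

lemma closure_smul_algebraMap (hA : Submodule.span K (Set.range (algebraMap k A)) = ⊤) :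
    AddSubmonoid.closure {x : A | ∃ c : K, ∃ d ∈ (algebraMap k A).toAddMonoidHom.range,
      x = algebraMap K A c • d} = ⊤ := by
  rw [eq_top_iff]
  rintro x -
  have hx : x ∈ Submodule.span K (Set.range (algebraMap k A)) := hA ▸ Submodule.mem_top
  induction hx using Submodule.closure_induction with
  | zero => exact AddSubmonoid.zero_mem _
  | add x y _ _ hx hy => exact AddSubmonoid.add_mem _ hx hy
  | smul_mem c x hx =>
    obtain ⟨t, rfl⟩ := hx
    exact AddSubmonoid.subset_closure ⟨c, _, ⟨t, rfl⟩, by rw [Algebra.smul_def]; rfl⟩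

lemma closure_smul_baseChange (hA : Submodule.span K (Set.range (algebraMap k A)) = ⊤) :
    AddSubmonoid.closure {z : A ⊗[k] L | ∃ c : K,
      ∃ d ∈ (baseChange L (Algebra.ofId k A) : k ⊗[k] L →+ A ⊗[k] L).range,
      z = algebraMap K A c • d} = ⊤ := by
  rw [eq_top_iff]
  rintro z -
  induction z using TensorProduct.induction_on with
  | zero => exact AddSubmonoid.zero_mem _
  | add x y hx hy => exact AddSubmonoid.add_mem _ hx hy
  | tmul a l =>
    have ha : a ∈ Submodule.span K (Set.range (algebraMap k A)) := hA ▸ Submodule.mem_top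
    induction ha using Submodule.closure_induction with
    | zero => rw [TensorProduct.zero_tmul]; exact AddSubmonoid.zero_mem _
    | add x y _ _ hx hy => rw [TensorProduct.add_tmul]; exact AddSubmonoid.add_mem _ hx hy
    | smul_mem c x hx =>
      obtain ⟨t, rfl⟩ := hx
      refine AddSubmonoid.subset_closure ⟨c, _, ⟨t ⊗ₜ l, rfl⟩, ?_⟩
      simp [baseChange, TensorProduct.smul_tmul', Algebra.smul_def, Algebra.ofId_apply]

/-- Additive statements about `A ⊗ L` can be checked on scalar multiples of elements that come from
`k ⊗ L`. -/
lemma baseChange_induction (hA : Submodule.span K (Set.range (algebraMap k A)) = ⊤)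
    {P : A ⊗[k] L → Prop} (zero : P 0) (add : ∀ x y, P x → P y → P (x + y))
    (smul : ∀ (c : K) (y : k ⊗[k] L),
      P (algebraMap K A c • baseChange L (Algebra.ofId k A) y)) (z : A ⊗[k] L) : P z := by
  have hz : z ∈ AddSubmonoid.closure {z : A ⊗[k] L | ∃ c : K,
      ∃ d ∈ (baseChange L (Algebra.ofId k A) : k ⊗[k] L →+ A ⊗[k] L).range,
      z = algebraMap K A c • d} := by
    rw [closure_smul_baseChange hA]
    exact AddSubmonoid.mem_top z
  induction hz using AddSubmonoid.closure_induction with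
  | mem z hz =>
    obtain ⟨c, _, ⟨y, rfl⟩, rfl⟩ := hz
    exact smul c y
  | zero => exact zero
  | add x y _ _ hx hy => exact add x y hx hy

/-- For fixed `l`, the map `x ↦ D (x ⊗ l)` extends to a `K`-linear map on `A`, uniquely since the
image of `k` spans `A`. Uniqueness makes the extension additive in `l` and balanced over `k`, so it
descends to the tensor product. -/
lemma exists_extension (hA : Submodule.span K (Set.range (algebraMap k A)) = ⊤)
    (D : k ⊗[k] L →+ B)
    (hD : ∀ y, ∃ S : A →ₗ[K] B, ∀ x : k, D (x • y) = S (algebraMap k A x)) :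
    ∃ Ψ : A ⊗[k] L →+ B, (∀ (c : K) z, Ψ (algebraMap K A c • z) = c • Ψ z) ∧
      ∀ y, Ψ (baseChange L (Algebra.ofId k A) y) = D y := by
  have hext : ∀ {S S' : A →ₗ[K] B}, (∀ x, S (algebraMap k A x) = S' (algebraMap k A x)) →
      S = S' := fun h => LinearMap.ext_on_range hA h
  choose S hS using fun l : L => hD (1 ⊗ₜ l)
  have hS' : ∀ l (x : k), S l (algebraMap k A x) = D (x ⊗ₜ l) := fun l x => by
    rw [← hS, TensorProduct.smul_tmul', smul_eq_mul, mul_one]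
  let f : A →+ L →+ B :=
    { toFun := fun a =>
        { toFun := fun l => S l a
          map_zero' := by
            have : S 0 = 0 := hext fun x => by
              rw [hS', TensorProduct.tmul_zero, map_zero, LinearMap.zero_apply]
            rw [this, LinearMap.zero_apply]
          map_add' := fun l l' => by
            have : S (l + l') = S l + S l' := hext fun x => by
              rw [hS', TensorProduct.tmul_add, map_add, LinearMap.add_apply, hS', hS']
            rw [this, LinearMap.add_apply] }
      map_zero' := by ext l; exact map_zero (S l)
      map_add' := fun a b => by ext l; exact map_add (S l) a b }
  have hf : ∀ (t : k) (a : A) (l : L), f (t • a) l = f a (t • l) := by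
    intro t a l
    change S l (t • a) = S (t • l) a
    rw [Algebra.smul_def]
    have : S l ∘ₗ LinearMap.mulLeft K (algebraMap k A t) = S (t • l) := hext fun x => by
      rw [LinearMap.comp_apply, LinearMap.mulLeft_apply, ← map_mul, hS', hS', ← smul_eq_mul,
        TensorProduct.smul_tmul]
    rw [← this]
    rfl
  refine ⟨TensorProduct.liftAddHom f hf, fun c z => ?_, fun y => ?_⟩
  · induction z using TensorProduct.induction_on with
    | zero => simp
    | add x y hx hy => rw [smul_add, map_add, hx, hy, map_add, smul_add]
    | tmul a l =>
      rw [TensorProduct.smul_tmul', TensorProduct.liftAddHom_tmul, TensorProduct.liftAddHom_tmul]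
      change S l (algebraMap K A c * a) = c • S l a
      rw [← Algebra.smul_def, map_smul]
  · induction y using TensorProduct.induction_on with
    | zero => simp
    | add x y hx hy => rw [map_add, map_add, hx, hy, map_add]
    | tmul x l => exact hS' l x

/-- The unique extension of a Lie system over `k` to `A`. -/
lemma IsLieSystem.extension {D : Idx n → Idx n → k ⊗[k] L →+ B} (hD : IsLieSystem τ D)
    (hA : Submodule.span K (Set.range (algebraMap k A)) = ⊤) {Ψ : Idx n → Idx n → A ⊗[k] L →+ B}
    (hsmul : ∀ {p q}, p ≠ q → ∀ (c : K) z, Ψ p q (algebraMap K A c • z) = c • Ψ p q z)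
    (hΨ : ∀ {p q}, p ≠ q → ∀ y, Ψ p q (baseChange L (Algebra.ofId k A) y) = D p q y) :
    IsLieSystem τ Ψ where
  opp {p q} h x := by
    have h' : SUHom.opp q ≠ SUHom.opp p := fun h' => h (opp_inj.1 h').symm
    induction x using baseChange_induction hA with
    | zero => simp
    | add x y hx hy => rw [map_add, smul_add, map_add, map_add, hx, hy]
    | smul c y =>
      rw [map_smul (conj τ A), smul_comm, hsmul h', hsmul h, ← baseChange_conj, ← map_zsmul, hΨ h', hΨ h,
        hD.opp h]
  comm {p q r t} hpq hrt h1 h2 h3 h4 x y := by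
    induction x using baseChange_induction hA with
    | zero => rw [map_zero]; exact Commute.zero_left _
    | add x x' hx hx' => rw [map_add]; exact hx.add_left hx'
    | smul c x =>
      induction y using baseChange_induction hA with
      | zero => rw [map_zero]; exact Commute.zero_right _
      | add y y' hy hy' => rw [map_add]; exact hy.add_right hy'
      | smul c' y =>
        rw [hsmul hpq, hsmul hrt, hΨ hpq, hΨ hrt]
        exact ((hD.comm hpq hrt h1 h2 h3 h4 x y).smul_left c).smul_right c'
  bracket_short {p q t} hpq hqt hpt h1 h2 x y := by
    induction x using baseChange_induction hA with
    | zero => simp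
    | add x x' hx hx' => rw [map_add, add_mul, mul_add, add_mul, map_add, ← hx, ← hx']; abel
    | smul c x =>
      induction y using baseChange_induction hA with
      | zero => simp
      | add y y' hy hy' => rw [map_add, add_mul, mul_add, mul_add, map_add, ← hy, ← hy']; abel
      | smul c' y =>
        rw [smul_mul_smul_comm, ← map_mul, ← map_mul, hsmul hpq, hsmul hqt, hsmul hpt, hΨ hpq,
          hΨ hqt, hΨ hpt, ← hD.bracket_short hpq hqt hpt h1 h2, smul_sub, smul_mul_smul_comm,
          smul_mul_smul_comm, mul_comm c']
  bracket_long {p q} hpq h x y := by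
    have hq := self_ne_opp q
    induction x using baseChange_induction hA with
    | zero => simp
    | add x x' hx hx' => rw [map_add, add_mul, mul_add, add_mul, map_add, ← hx, ← hx']; abel
    | smul c x =>
      induction y using baseChange_induction hA with
      | zero => simp
      | add y y' hy hy' =>
        have : y + y' + conj τ A (y + y') = (y + conj τ A y) + (y' + conj τ A y') := by
          rw [map_add]; abel
        rw [this, map_add, add_mul, mul_add, mul_add, map_add, ← hy, ← hy']; abel
      | smul c' y =>
        rw [map_smul (conj τ A), ← smul_add, smul_mul_smul_comm, ← map_mul, ← baseChange_conj, ← map_add,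
          ← map_mul, hsmul hpq, hsmul hq, hsmul h, hΨ hpq, hΨ hq, hΨ h, ← hD.bracket_long hpq h,
          smul_sub, smul_mul_smul_comm, smul_mul_smul_comm, mul_comm c']

/-- Values at the same position commute, so sums of nilpotents remain nilpotent. -/
lemma isNilpotent_extension {D : Idx n → Idx n → k ⊗[k] L →+ B}
    (hA : Submodule.span K (Set.range (algebraMap k A)) = ⊤) {Ψ : Idx n → Idx n → A ⊗[k] L →+ B}
    (hsmul : ∀ {p q}, p ≠ q → ∀ (c : K) z, Ψ p q (algebraMap K A c • z) = c • Ψ p q z)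
    (hΨ : ∀ {p q}, p ≠ q → ∀ y, Ψ p q (baseChange L (Algebra.ofId k A) y) = D p q y)
    (hlie : IsLieSystem τ Ψ) (hnil : ∀ {p q}, p ≠ q → ∀ x, IsNilpotent (D p q x)) {p q : Idx n}
    (h : p ≠ q) (z : A ⊗[k] L) : IsNilpotent (Ψ p q z) := by
  induction z using baseChange_induction hA with
  | zero => rw [map_zero]; exact IsNilpotent.zero
  | add x y hx hy => rw [map_add]; exact (hlie.commute_self h x y).isNilpotent_add hx hy
  | smul c y => rw [hsmul h, hΨ h]; exact (hnil h y).smul c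

end BaseExtension

/-! ### Exponentials as regular maps to `GL_m`. -/

section ExpUnit

open IsNilpotent

variable {K : Type*} [Field K] [CharZero K] {m : ℕ}

/-- The exponential of a nilpotent matrix, as an element of `GL_m`. -/
def expUnit (N : Matrix (Fin m) (Fin m) K) : Matrix.GeneralLinearGroup (Fin m) K :=
  open scoped Classical in
  if h : IsNilpotent N then
    ⟨exp N, exp (-N), exp_mul_exp_neg_self h, exp_neg_mul_exp_self h⟩ else 1

lemma coe_expUnit {N : Matrix (Fin m) (Fin m) K} (h : IsNilpotent N) : (expUnit N).1 = exp N := by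
  rw [expUnit, dif_pos h]

lemma coe_expUnit_inv {N : Matrix (Fin m) (Fin m) K} (h : IsNilpotent N) :
    ((expUnit N)⁻¹).1 = exp (-N) := by
  rw [expUnit, dif_pos h]
  rfl

/-- The characteristic polynomial is `X ^ m`. The uniform exponent makes `exp` a single polynomial
on all nilpotent matrices. -/
lemma pow_eq_zero_of_isNilpotent_matrix {N : Matrix (Fin m) (Fin m) K} (h : IsNilpotent N) :
    N ^ m = 0 := by
  have h1 := (Matrix.isNilpotent_charpoly_sub_pow_of_isNilpotent h).eq_zero
  rw [sub_eq_zero, Fintype.card_fin] at h1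
  have h2 := N.aeval_self_charpoly
  rwa [h1, map_pow, Polynomial.aeval_X] at h2

variable {A M : Type*} [CommRing A] [Algebra K A] [AddCommGroup M] [Module A M]

lemma entry_pow_mem_polyFunctions {Ξ : M →+ Matrix (Fin m) (Fin m) K}
    (hsmul : ∀ (c : K) x, Ξ (algebraMap K A c • x) = c • Ξ x) (r : ℕ) (i j : Fin m) :
    (fun x => (Ξ x ^ r) i j) ∈ polyFunctions K A M := by
  induction r generalizing j with
  | zero => exact (polyFunctions K A M).algebraMap_mem ((1 : Matrix (Fin m) (Fin m) K) i j)
  | succ r ih =>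
    have h : (∑ l, (fun x => (Ξ x ^ r) i l) * fun x => Ξ x l j) ∈ polyFunctions K A M := by
      refine Subalgebra.sum_mem _ fun l _ => Subalgebra.mul_mem _ (ih l) ?_
      refine Algebra.subset_adjoin ⟨fun x y => ?_, fun c x => ?_⟩
      · simp only [map_add, Matrix.add_apply]
      · simp only [hsmul, Matrix.smul_apply, smul_eq_mul]
    convert h using 1
    ext x
    rw [_root_.pow_succ, Matrix.mul_apply, Finset.sum_apply]
    rfl

lemma entry_exp_mem_polyFunctions {Ξ : M →+ Matrix (Fin m) (Fin m) K}
    (hsmul : ∀ (c : K) x, Ξ (algebraMap K A c • x) = c • Ξ x)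
    (hnil : ∀ x, IsNilpotent (Ξ x)) (i j : Fin m) :
    (fun x => exp (Ξ x) i j) ∈ polyFunctions K A M := by
  have h : (∑ r ∈ Finset.range m, ((r.factorial : ℚ)⁻¹ : K) • fun x => (Ξ x ^ r) i j)
      ∈ polyFunctions K A M :=
    Subalgebra.sum_mem _ fun r _ => Subalgebra.smul_mem _ (entry_pow_mem_polyFunctions hsmul r i j) _
  convert h using 1
  ext x
  rw [exp_eq_sum (pow_eq_zero_of_isNilpotent_matrix (hnil x)), Matrix.sum_apply, Finset.sum_apply]
  refine Finset.sum_congr rfl fun r _ => ?_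
  rw [Matrix.smul_apply, Pi.smul_apply, Algebra.smul_def, smul_eq_mul]
  simp

lemma isRegularMap_expUnit {Ξ : M →+ Matrix (Fin m) (Fin m) K}
    (hsmul : ∀ (c : K) x, Ξ (algebraMap K A c • x) = c • Ξ x)
    (hnil : ∀ x, IsNilpotent (Ξ x)) :
    IsRegularMap (polyFunctions K A M) (glFunctions K m) fun x => expUnit (Ξ x) := by
  refine isRegularMap_adjoin ?_
  rintro F (⟨i, j, rfl⟩ | ⟨i, j, rfl⟩)
  · convert entry_exp_mem_polyFunctions hsmul hnil i j using 1
    ext x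
    exact congrFun (congrFun (coe_expUnit (hnil x)) i) j
  · convert entry_exp_mem_polyFunctions (A := A) (Ξ := -Ξ) (fun c x => by simp [hsmul])
      (fun x => (hnil x).neg) i j using 1
    ext x
    exact congrFun (congrFun (coe_expUnit_inv (hnil x)) i) j

end ExpUnit

/-! ### Existence of Steinberg lifts; perfectness. -/

section Existence

open IsNilpotent

variable {k L : Type*} {K : Type v} [Field k] [CharZero k] [Field L] [Algebra k L]
  [Algebra.IsQuadraticExtension k L] {τ : L ≃ₐ[k] L} {n m : ℕ} [Field K] [IsAlgClosed K]
  [CharZero K]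

/-- The logarithms of the root subgroups of `G(k)` extend linearly to a `K`-algebra `A` of finite
dimension. -/
lemma exists_algebra_and_extension (hτ : τ ≠ AlgEquiv.refl) (hn : 2 ≤ n)
    (ρ : SU τ n k →* Matrix.GeneralLinearGroup (Fin m) K) :
    ∃ (A : Type v) (_ : CommRing A) (_ : Algebra K A) (_ : Algebra k A)
      (Ψ : Idx n → Idx n → A ⊗[k] L →+ Matrix (Fin m) (Fin m) K), Module.Finite K A ∧
      Submodule.span K (Set.range (algebraMap k A)) = ⊤ ∧ IsLieSystem τ Ψ ∧
      (∀ p q, p ≠ q → ∀ (c : K) z, Ψ p q (algebraMap K A c • z) = c • Ψ p q z) ∧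
      (∀ p q, p ≠ q → ∀ z, IsNilpotent (Ψ p q z)) ∧
      ∀ p q, p ≠ q → ∀ y, exp (Ψ p q (baseChange L (Algebra.ofId k A) y))
        = (ρ (elemSU τ hτ p q y)).1 := by
  obtain ⟨D, hD, hDnil, hDexp⟩ := (elemSU_isElemSystem hτ (R := k) (n := n)).exists_isLieSystem
    ((Units.coeHom (Matrix (Fin m) (Fin m) K)).comp ρ)
    (fun h x => isNilpotent_map_elemSU_sub_one hτ ρ h x)
  let p₀ : Idx n := (⟨0, by omega⟩, 0)
  let D₀ : k →+ Matrix (Fin m) (Fin m) K :=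
    (D p₀ (opp p₀)).comp (algebraMap k (k ⊗[k] L)).toAddMonoidHom
  have hD₀ : ∀ x, D₀ x = D p₀ (opp p₀) (x • 1) := fun x => by
    rw [← Algebra.algebraMap_eq_smul_one]; rfl
  have hfac : ∀ {p q}, p ≠ q → ∀ y, FactorsThrough K D D₀ p q y := fun h y =>
    hD.factorsThrough hn (p₀ := p₀) ⟨LinearMap.id, fun x => (hD₀ x).symm⟩ h y
  -- Multiplication by `t` in the argument of `D₀` is the case `y = t • 1` of linear dependence.
  obtain ⟨A, _, _, f, Θ, hfin, hspan, hΘ⟩ := exists_algebra_of_forall_mul D₀ fun t => by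
    obtain ⟨T, hT⟩ := hfac (self_ne_opp p₀) (t • 1)
    refine ⟨T, fun x => ?_⟩
    rw [← hT, hD₀, smul_smul, mul_comm]
  let _ : Algebra k A := f.toAlgebra
  have hex : ∀ p q, ∃ Ψ : A ⊗[k] L →+ Matrix (Fin m) (Fin m) K, p ≠ q →
      (∀ (c : K) z, Ψ (algebraMap K A c • z) = c • Ψ z) ∧
      ∀ y, Ψ (baseChange L (Algebra.ofId k A) y) = D p q y := by
    intro p q
    by_cases h : p ≠ q
    · obtain ⟨Ψ, hΨ⟩ := exists_extension (K := K) (A := A) hspan (D p q) fun y => by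
        obtain ⟨T, hT⟩ := hfac h y
        exact ⟨T ∘ₗ Θ, fun x => by rw [hT, ← hΘ]; rfl⟩
      exact ⟨Ψ, fun _ => hΨ⟩
    · exact ⟨0, fun h' => absurd h' h⟩
  choose Ψ hΨ using hex
  have hlie := hD.extension (K := K) (A := A) hspan (fun h => (hΨ _ _ h).1) (fun h => (hΨ _ _ h).2)
  refine ⟨A, inferInstance, inferInstance, inferInstance, Ψ, hfin, hspan, hlie,
    fun p q h => (hΨ p q h).1, fun p q h => isNilpotent_extension (K := K) hspan
      (fun h => (hΨ _ _ h).1) (fun h => (hΨ _ _ h).2) hlie hDnil h, fun p q h y => ?_⟩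
  rw [(hΨ p q h).2, hDexp h]
  rfl

/-- Steinberg lifts exist, and can be chosen such that the root subgroups consist of commutators. -/
theorem exists_isSteinbergLift (hτ : τ ≠ AlgEquiv.refl) (hn : 2 ≤ n)
    (ρ : SU τ n k →* Matrix.GeneralLinearGroup (Fin m) K) :
    ∃ (A : Type v) (_ : CommRing A) (_ : Algebra K A) (_ : Algebra k A)
      (ψ : ∀ α : Root n, rootSpace k L A α → imageClosure ρ)
      (σ : Steinberg τ n A →* imageClosure ρ), IsSteinbergLift ρ A ψ σ ∧
      ∀ α v, ψ α v ∈ commutator (imageClosure ρ) := by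
  obtain ⟨A, _, _, _, Ψ, hfin, hspan, hΨ, hsmul, hnil, hexp⟩ :=
    exists_algebra_and_extension hτ hn ρ
  have hval : ∀ p q, p ≠ q → ∀ y,
      expUnit (Ψ p q (baseChange L (Algebra.ofId k A) y)) = ρ (elemSU τ hτ p q y) :=
    fun p q h y => Units.ext (by rw [coe_expUnit (hnil p q h _), hexp p q h])
  -- Elements from `k ⊗ L` are dense in `A ⊗ L` and are mapped to values of `ρ`; continuity gives
  -- values in the closure `H`.
  have hmem : ∀ p q, p ≠ q → ∀ z, expUnit (Ψ p q z) ∈ imageClosure ρ := by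
    intro p q h z
    let _ := zariski (glFunctions K m)
    let _ := zariski (polyFunctions K A (A ⊗[k] L))
    refine map_mem_closure (f := fun z => expUnit (Ψ p q z)) (isRegularMap_expUnit (hsmul p q h) (hnil p q h)).continuous
      (dense_of_closure_smul_eq_top _ (closure_smul_baseChange hspan) z) ?_
    rintro _ ⟨y, rfl⟩
    exact ⟨_, (hval p q h y).symm⟩
  let g : Idx n → Idx n → A ⊗[k] L → imageClosure ρ := fun p q z =>
    if h : p ≠ q then ⟨expUnit (Ψ p q z), hmem p q h z⟩ else 1
  have hg : ∀ {p q}, p ≠ q → ∀ z,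
      (g p q z : Matrix.GeneralLinearGroup (Fin m) K) = expUnit (Ψ p q z) := fun h z => by
    simp only [g, dif_pos h]
  have hsys : IsElemSystem τ g := hΨ.isElemSystem
    ((Units.coeHom (Matrix (Fin m) (Fin m) K)).comp (imageClosure ρ).subtype)
    (fun x y h => Subtype.ext (Units.ext h)) (fun h x => hnil _ _ h x)
    (fun h x => (congrArg Units.val (hg h x)).trans (coe_expUnit (hnil _ _ h x)))
  have hbase : ∀ α (v : rootSpace k L k α),
      ((atRoot g α (rootSpaceMap (Algebra.ofId k A) α v : A ⊗[k] L) : imageClosure ρ) :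
        Matrix.GeneralLinearGroup (Fin m) K) = ρ (rootElt τ α v) := by
    intro α v
    rw [atRoot, hg α.fst_ne_snd, rootElt_eq hτ, ← hval _ _ α.fst_ne_snd, map_smul (baseChange L (Algebra.ofId k A))]
    rfl
  refine ⟨A, inferInstance, inferInstance, inferInstance, fun α v => atRoot g α v,
    steinbergOfSystem hτ hsys, ⟨hfin, ?_, ?_, hbase, ?_, steinbergOfSystem_gen hτ hsys⟩, ?_⟩
  · exact dense_of_closure_smul_eq_top _ (closure_smul_algebraMap hspan)
  · intro α
    let c : A ⊗[k] L →+ A ⊗[k] L := DistribSMul.toAddMonoidHom _ (α.coeff k)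
    have h := isRegularMap_expUnit (A := A) (Ξ := ((Ψ α.fst α.snd).comp c).comp
      (rootSpace k L A α).subtype.toAddMonoidHom) (fun a x => ?_)
      (fun x => hnil _ _ α.fst_ne_snd _)
    · have h' : (fun v : rootSpace k L A α => ((atRoot g α (v : A ⊗[k] L) : imageClosure ρ) :
          Matrix.GeneralLinearGroup (Fin m) K)) = _ := funext fun v => hg α.fst_ne_snd _
      rw [h']
      exact h
    · change Ψ _ _ (α.coeff k • algebraMap K A a • (x : A ⊗[k] L)) = a • Ψ _ _ (α.coeff k • (x : A ⊗[k] L))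
      rw [smul_comm, hsmul _ _ α.fst_ne_snd]
  · intro x
    have : ((imageClosure ρ).subtype.comp (steinbergOfSystem hτ hsys)).comp
        (steinbergMap τ (Algebra.ofId k A)) = ρ.comp (steinbergProj τ n k) := by
      refine PresentedGroup.ext fun ⟨α, v⟩ => ?_
      have h1 : steinbergMap τ (Algebra.ofId k A) (steinbergGen τ α v)
          = steinbergGen τ α (rootSpaceMap (Algebra.ofId k A) α v) := by
        rw [steinbergMap, Steinberg.lift, steinbergGen, PresentedGroup.toGroup.of]
      have h2 : steinbergProj τ n k (steinbergGen τ α v) = rootElt τ α v := by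
        rw [steinbergProj, Steinberg.lift, steinbergGen, PresentedGroup.toGroup.of]
      change ((steinbergOfSystem hτ hsys (steinbergMap τ (Algebra.ofId k A) (steinbergGen τ α v)) :
        imageClosure ρ) : Matrix.GeneralLinearGroup (Fin m) K)
          = ρ (steinbergProj τ n k (steinbergGen τ α v))
      rw [h1, h2, steinbergOfSystem_gen, hbase]
    exact DFunLike.congr_fun this x
  · intro α v
    have hne := α.fst_ne_snd
    set p := α.fst
    set q := α.snd
    set z := α.coeff k • (v : A ⊗[k] L) with hz
    set c := torusFactor p q
    have hc : 2 ≤ c := two_le_torusFactor p q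
    -- The identity is additive and `K`-linear in `z`, so it suffices to prove it for arguments from
    -- `k ⊗ L`, where it is the logarithm of a relation in `G(k)`.
    have htorus : ∀ z, (ρ (torusElt τ k p)).1 * Ψ p q z = (c • Ψ p q z) * (ρ (torusElt τ k p)).1 := by
      have hinv : (ρ (torusElt τ k p)).1 * (ρ (torusElt τ k p))⁻¹.1 = 1 := Units.mul_inv _
      have hinv' : (ρ (torusElt τ k p))⁻¹.1 * (ρ (torusElt τ k p)).1 = 1 := Units.inv_mul _
      intro z
      induction z using baseChange_induction hspan with
      | zero => simp
      | add x y hx hy => rw [map_add, mul_add, smul_add, add_mul, hx, hy]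
      | smul a y =>
        have hy : (ρ (torusElt τ k p)).1 * Ψ p q (baseChange L (Algebra.ofId k A) y)
              * (ρ (torusElt τ k p))⁻¹.1
            = c • Ψ p q (baseChange L (Algebra.ofId k A) y) := by
          refine exp_injective (isNilpotent_conj hinv hinv' (hnil p q hne _))
            ((hnil p q hne _).smul c) ?_
          rw [exp_conj hinv hinv' (hnil p q hne _), ← map_nsmul, ← map_nsmul, hexp p q hne,
            hexp p q hne, ← Units.val_mul, ← Units.val_mul, ← map_inv, ← map_mul, ← map_mul,
            torusElt_mul_elemSU hτ hne, mul_inv_cancel_right]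
        rw [hsmul p q hne, smul_comm, mul_smul_comm, smul_mul_assoc, ← hy, mul_assoc, hinv', mul_one]
    have hconj : ∀ z, ρ (torusElt τ k p) * expUnit (Ψ p q z)
        = expUnit (Ψ p q (c • z)) * ρ (torusElt τ k p) := by
      intro z
      refine Units.ext ?_
      rw [Units.val_mul, Units.val_mul, coe_expUnit (hnil p q hne _), coe_expUnit (hnil p q hne _),
        map_nsmul]
      have hinv : (ρ (torusElt τ k p)).1 * (ρ (torusElt τ k p))⁻¹.1 = 1 := Units.mul_inv _
      have hinv' : (ρ (torusElt τ k p))⁻¹.1 * (ρ (torusElt τ k p)).1 = 1 := Units.inv_mul _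
      have h1 : c • Ψ p q z = (ρ (torusElt τ k p)).1 * Ψ p q z * (ρ (torusElt τ k p))⁻¹.1 := by
        rw [htorus, mul_assoc, hinv, mul_one]
      rw [h1, exp_conj hinv hinv' (hnil p q hne _), mul_assoc, hinv', mul_one]
    let t : imageClosure ρ := ⟨ρ (torusElt τ k p), le_zariskiClosure _ ⟨_, rfl⟩⟩
    have hck : ((c : k) - 1) ≠ 0 := by
      rw [sub_ne_zero]
      exact_mod_cast (show c ≠ 1 by omega)
    -- With this choice `⁅t, g p q w⁆ = g p q (c w) (g p q w)⁻¹ = g p q ((c - 1) w) = g p q z`.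
    set w := ((c : k) - 1)⁻¹ • z with hw
    have hwz : z = c • w - w := by
      rw [hw, ← Nat.cast_smul_eq_nsmul k, smul_smul, ← sub_smul, ← sub_one_mul,
        mul_inv_cancel₀ hck, one_smul]
    have h1 : g p q z = ⁅t, g p q w⁆ := by
      have h2 : t * g p q w = g p q (c • w) * t := Subtype.ext (by
        rw [Subgroup.coe_mul, Subgroup.coe_mul, hg hne, hg hne]
        exact hconj w)
      rw [commutatorElement_def, h2, mul_inv_cancel_right, hsys.inv hne, hsys.add hne, hwz,
        sub_eq_add_neg]
    change g p q z ∈ _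
    rw [h1]
    exact Subgroup.commutator_mem_commutator (Subgroup.mem_top _) (Subgroup.mem_top _)

/-- The image closure of a Steinberg lift whose root subgroups consist of commutators is perfect. -/
lemma IsSteinbergLift.isPerfect {ρ : SU τ n k →* Matrix.GeneralLinearGroup (Fin m) K}
    {A : Type*} [CommRing A] [Algebra K A] [Algebra k A]
    {ψ : ∀ α : Root n, rootSpace k L A α → imageClosure ρ}
    {σ : Steinberg τ n A →* imageClosure ρ} (h : IsSteinbergLift ρ A ψ σ)
    (hσ : Function.Surjective σ) (hψ : ∀ α v, ψ α v ∈ commutator (imageClosure ρ)) :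
    Group.IsPerfect (imageClosure ρ) := by
  rw [Group.isPerfect_def, ← MonoidHom.range_eq_top.2 hσ, MonoidHom.range_eq_map,
    ← closure_range_steinbergGen, MonoidHom.map_closure]
  refine le_antisymm ?_ ?_
  · rw [← MonoidHom.map_closure, closure_range_steinbergGen, ← MonoidHom.range_eq_map,
      MonoidHom.range_eq_top.2 hσ]
    exact le_top
  · rw [Subgroup.closure_le]
    rintro _ ⟨_, hx, rfl⟩
    obtain ⟨α, v, rfl⟩ := Set.mem_iUnion.1 hx
    rw [h.comp_gen]
    exact hψ α v

end Existence

end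

end SUHom

theorem lemma4p1 {k : Type*} {L : Type*} {K : Type v} [Field k] [CharZero k] [Field L] [Algebra k L]
    [Algebra.IsQuadraticExtension k L] (τ : L ≃ₐ[k] L) (hτ : τ ≠ AlgEquiv.refl)
    (n : ℕ) (hn : 2 ≤ n) [Field K] [IsAlgClosed K] [CharZero K] (m : ℕ)
    (ρ : SUHom.SU τ n k →* Matrix.GeneralLinearGroup (Fin m) K) :
    -- the data `A`, `f`, `ψ_α`, `σ̃` exist
    (∃ (A : Type v) (_ : CommRing A) (_ : Algebra K A) (_ : Algebra k A)
      (ψ : ∀ α : SUHom.Root n, SUHom.rootSpace k L A α → SUHom.imageClosure ρ)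
      (σ : SUHom.Steinberg τ n A →* SUHom.imageClosure ρ), SUHom.IsSteinbergLift ρ A ψ σ) ∧
    -- and for all such data, `σ̃` is surjective
    (∀ (A : Type w) [CommRing A] [Algebra K A] [Algebra k A]
      (ψ : ∀ α : SUHom.Root n, SUHom.rootSpace k L A α → SUHom.imageClosure ρ)
      (σ : SUHom.Steinberg τ n A →* SUHom.imageClosure ρ), SUHom.IsSteinbergLift ρ A ψ σ →
      Function.Surjective σ) ∧
    -- `H` is connected in the Zariski topology
    @IsConnected _ (SUHom.zariski (SUHom.glFunctions K m))
      (SUHom.imageClosure ρ : Set (Matrix.GeneralLinearGroup (Fin m) K)) ∧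
    -- `H` is perfect
    Group.IsPerfect (SUHom.imageClosure ρ) := by
  have hn0 : 0 < n := by omega
  obtain ⟨A, _, _, _, ψ, σ, h, hψ⟩ := SUHom.exists_isSteinbergLift hτ hn ρ
  -- Connectedness and perfectness concern `H` alone, so this one lift suffices for both.
  obtain ⟨hsurj, hirr⟩ := h.surjective_and_irreducible hτ hn0
  refine ⟨⟨A, inferInstance, inferInstance, inferInstance, ψ, σ, h⟩, ?_, ?_, h.isPerfect hsurj hψ⟩
  · intro A _ _ _ ψ σ h
    exact (h.surjective_and_irreducible hτ hn0).1
  · let _ := SUHom.zariski (SUHom.glFunctions K m)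
    exact hirr.isConnected
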